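/- Setting. Let $d\ge 2$, let $\mathcal M$ be the set of probability measures on the unit vectors $\{e\in\mathbb Z^d:|e|=1\}$ and $\Omega=\mathcal M^{\mathbb Z^d}$. Let $P$ be a probability measure on $\Omega$ that is stationary under the shifts of $\mathbb Z^d$, uniformly elliptic (for some $\kappa\in(0,\frac1{2d})$, $P$-a.s. $\omega(o,e)>\kappa$ for all $|e|=1$), $r$-Markov for some $r\ge1$ (for every finite $V$, the conditional law of $(\omega_x)_{x\in V}$ given $(\omega_x)_{x\in V^c}$ equals its conditional law given $(\omega_x)_{x\notin V,\,d(x,V)\le r}$, where $d(\cdot,\cdot)$ is the $\ell^1$-distance), and such that for some constants $\gamma,C\in(0,\infty)$: for all finite $\Delta\subset V\subset\mathbb Z^d$ with $d(\Delta,V^c)\ge r$ and all $A\subset V^c$, $$\frac{dP((\omega_x)_{x\in\Delta}\in\cdot\mid\eta)}{dP((\omega_x)_{x\in\Delta}\in\cdot\mid\eta')}\le\exp\Big(C\sum_{x\in A,\,y\in\Delta}e^{-\gamma d(x,y)}\Big)$$ for $P$-almost all pairs of configurations $\eta,\eta'\in\mathcal M^{V^c}$ that agree on $V^c\setminus A$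 (i.e. for all such pairs in a set of configurations of full measure). Let $\mathbf P=P\otimes P_\omega^o$ be the joint law of the environment and of the walk $(X_n)$ started at the origin $o$ ($P_\omega^x(X_{n+1}=z+e\mid X_n=z)=\omega(z,e)$). Let $(\epsilon_{i,x})_{i\in\mathbb N,x\in\mathbb Z^d}$ be iid coins with $Q(\epsilon_{i,x}=1)=d\kappa=1-Q(\epsilon_{i,x}=0)$, let $P_{\omega,\epsilon}^x$ be the law of the Markov chain started at $x$ with $$P_{\omega,\epsilon}^x(X_{n+1}=z+e\mid X_n=z)=\frac{1_{\epsilon_{n,z}=1}}{2d}+\frac{1_{\epsilon_{n,z}=0}}{1-d\kappa}\Big[\omega(z,e)-\frac\kappa2\Big],$$ and let $\bar{\mathbf P}=P\otimes Q\otimes P_{\omega,\epsilon}^o$ be the law of $(\omega,\epsilon,X_\cdot)$. For a constant $c_5$ let $$R=\inf\Big\{n\ge0:\ \#\{0\le i\le n: X_i\cdot e_1=X_0\cdot e_1+j\}>c_5(j+1)^2\text{ for some }j\ge0\Big\}\wedge\inf\{n\ge1:X_n\cdot e_1\le X_0\cdot e_1\}.$$ When $\mathbf P(R=\infty)>0$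 let $\hat{\mathbf P}=\bar{\mathbf P}(\,\cdot\mid R=\infty)$. For $L\in\mathbb N$ put $R_0=0$ and, for $k\ge0$, with $\theta_n$ the time shift of the path and of the coins, $$S_{k+1}=\inf\{n\ge R_k:\ n\ge L,\ X_{n-L}\cdot e_1>\max_{m<n-L}X_m\cdot e_1,\ \epsilon_{n-i,X_{n-i}}=1,\ X_{n-i+1}-X_{n-i}=e_1\ (1\le i\le L)\},$$ $$R_{k+1}=R\circ\theta_{S_{k+1}}+S_{k+1},$$ where the condition on the maximum is void for $n=L$. Let $K=\inf\{k\ge1:S_k<\infty,R_k=\infty\}$, $\tau_0=0$, $\tau_1=S_K$, $\tau_{k+1}=\tau_1\circ\theta_{\tau_k}+\tau_k$. For $n\ge1$ let $$P_n=(X_{i+\tau_{n-1}}-X_{\tau_{n-1}})_{0\le i\le\tau_n-\tau_{n-1}-L},\quad W_n=(\omega_{x+X_{\tau_{n-1}}})_{x\in P_n},\quad F_n=X_{\tau_n}-X_{\tau_{n-1}},$$ $$J_n=(P_n,W_n,F_n,\tau_n-\tau_{n-1}),$$ and for $i\ge0$ let $h_{i+1}(\cdot\mid j_i,\dots,j_1)=\hat{\mathbf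 P}(J_{i+1}\in\cdot\mid J_i,\dots,J_1)|_{J_i=j_i,\dots,J_1=j_1}$ be the regular conditional distribution (for $i=0$ the law of $J_1$ under $\hat{\mathbf P}$). Lemma. There is a constant $c>0$, depending only on $d$ and $P$ (including $\kappa$ and $r$), such that the following holds. If $\mathbf P(R=\infty)>0$, then there is $L_0$ such that for all integers $L\ge L_0$ and all $0\le k\le n$, $\hat{\mathbf P}$-almost surely, $$\exp\big(-e^{-c(k+1)L}\big)\,h_{k+1}(\cdot\mid J_n,\dots,J_{n-k+1})\ \le\ h_{n+1}(\cdot\mid J_n,\dots,J_1)\ \le\ \exp\big(e^{-c(k+1)L}\big)\,h_{k+1}(\cdot\mid J_n,\dots,J_{n-k+1}),$$ the inequalities holding simultaneously on all measurable sets of blocks. -/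

import Mathlib

open MeasureTheory ProbabilityTheory
open scoped ENNReal

namespace RWRE

noncomputable section

/-! ### The lattice and its nearest neighbour directions -/

/-- The lattice `ℤ^d`. -/
abbrev Site (d : ℕ) : Type := Fin d → ℤ

/-- The `2 d` nearest neighbour directions: `(i, true)` is `e_i` and `(i, false)` is `-e_i`. -/
abbrev Dir (d : ℕ) : Type := Fin d × Bool

/-- The unit vector of a direction. -/
def dirVec {d : ℕ} (e : Dir d) : Site d := Pi.single e.1 (if e.2 then 1 else -1)

/-- The `l¹` distance on `ℤ^d`. -/
def dist1 {d : ℕ} (x y : Site d) : ℕ := ∑ i, (x i - y i).natAbs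

/-- The level `x · e_1`. -/
def level {d : ℕ} [NeZero d] (x : Site d) : ℤ := x 0

/-- The vector `e_1`. -/
def e1 {d : ℕ} [NeZero d] : Site d := Pi.single 0 1

/-! ### Environments -/

/-- Probability measures on the set of unit vectors, as probability vectors. -/
abbrev ProbVec (d : ℕ) : Type := ↥(stdSimplex ℝ (Dir d))

instance instStandardBorelProbVec (d : ℕ) : StandardBorelSpace (ProbVec d) :=
  (isClosed_stdSimplex ℝ (Dir d)).measurableSet.standardBorel

/-- The uniform distribution on the unit vectors. -/
def uniformVec (d : ℕ) [NeZero d] : ProbVec d :=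
  ⟨fun _ => 1 / (2 * (d : ℝ)), fun _ => by positivity, by
    have hd : (d : ℝ) ≠ 0 := Nat.cast_ne_zero.mpr (NeZero.ne d)
    simp [Finset.sum_const]
    field_simp⟩

instance instNonemptyProbVec (d : ℕ) [NeZero d] : Nonempty (ProbVec d) := ⟨uniformVec d⟩

/-- Environments: `ω x e` is the probability `ω(x, e)` of stepping from `x` to `x + e`. -/
abbrev Env (d : ℕ) : Type := Site d → ProbVec d

/-- The spatial shift of an environment. -/
def shiftEnv {d : ℕ} (a : Site d) (ω : Env d) : Env d := fun x => ω (x + a)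

/-- `P` is stationary with respect to the shifts of `ℤ^d`. -/
def Stationary {d : ℕ} (P : Measure (Env d)) : Prop :=
  ∀ a : Site d, P.map (shiftEnv a) = P

/-- The configuration `(ω_x)_{x ∈ Λ}`. -/
def restr {d : ℕ} (Λ : Set (Site d)) (ω : Env d) : Λ → ProbVec d := fun x => ω x

/-- The σ-algebra `σ(ω_x : x ∈ Λ)`. -/
abbrev sigmaAlg {d : ℕ} (Λ : Set (Site d)) : MeasurableSpace (Env d) :=
  MeasurableSpace.comap (restr Λ) inferInstance

/-- The `r`-boundary of `V`. -/
def bdry {d : ℕ} (r : ℕ) (V : Set (Site d)) : Set (Site d) :=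
  {x | x ∉ V ∧ ∃ y ∈ V, dist1 x y ≤ r}

/-- The environment measure is `r`-Markov: given the configuration outside a finite set `V`, the
law of the configuration in `V` depends only on the configuration on the `r`-boundary of `V`. -/
def IsMarkovEnv {d : ℕ} (P : Measure (Env d)) (r : ℕ) : Prop :=
  ∀ (V : Finset (Site d)) (B : Set (↥(V : Set (Site d)) → ProbVec d)),
    MeasurableSet B →
    P⟦restr (V : Set (Site d)) ⁻¹' B | sigmaAlg ((V : Set (Site d))ᶜ)⟧
      =ᵐ[P] P⟦restr (V : Set (Site d)) ⁻¹' B | sigmaAlg (bdry r (V : Set (Site d)))⟧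

/-- The mixing condition `(*)`, with `γ` and `C` as parameters. The kernel `condDistrib` is a
regular version of `P((ω_x)_{x ∈ Δ} ∈ · | η)`, `η` a configuration on `V^c`; the inequality between
the two conditional laws holds on all measurable sets, i.e. for the density; "almost all pairs of
configurations" are the pairs taken from a set of full measure. -/
def MixingCond {d : ℕ} [NeZero d] (P : Measure (Env d)) [IsProbabilityMeasure P]
    (r : ℕ) (γ C : ℝ) : Prop :=
  ∀ (Δ V : Finset (Site d)) (A : Set (Site d)), Δ ⊆ V →
    (∀ x ∈ Δ, ∀ y ∉ V, r ≤ dist1 x y) → A ⊆ (V : Set (Site d))ᶜ →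
    ∃ G : Set (↥((V : Set (Site d))ᶜ) → ProbVec d),
      (∀ᵐ ω ∂P, restr ((V : Set (Site d))ᶜ) ω ∈ G) ∧
      ∀ η ∈ G, ∀ η' ∈ G, (∀ x : ↥((V : Set (Site d))ᶜ), (x : Site d) ∉ A → η x = η' x) →
        ∀ B : Set (↥(Δ : Set (Site d)) → ProbVec d), MeasurableSet B →
          condDistrib (restr (Δ : Set (Site d))) (restr ((V : Set (Site d))ᶜ)) P η B ≤
            ENNReal.ofReal (Real.exp
              (C * ∑' x : A, ∑ y ∈ Δ, Real.exp (-γ * (dist1 (x : Site d) y : ℝ)))) *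
            condDistrib (restr (Δ : Set (Site d))) (restr ((V : Set (Site d))ᶜ)) P η' B

/-- Condition `(*)`: it holds for some positive finite constants `γ`, `C`. -/
def SatisfiesMixing {d : ℕ} [NeZero d] (P : Measure (Env d)) [IsProbabilityMeasure P]
    (r : ℕ) : Prop :=
  ∃ γ C : ℝ, 0 < γ ∧ 0 < C ∧ MixingCond P r γ C

/-- The admissible ellipticity constants: `0 < κ < 1 / (2 d)`. -/
abbrev EllConst (d : ℕ) : Type := {κ : ℝ // 0 < κ ∧ κ < 1 / (2 * (d : ℝ))}

/-- `P` is uniformly elliptic with constant `κ`: almost surely, `ω(o, e) > κ` for all `e`. -/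
def UniformlyElliptic {d : ℕ} (P : Measure (Env d)) (κ : EllConst d) : Prop :=
  ∀ᵐ ω ∂P, ∀ e : Dir d, (κ : ℝ) < ω 0 e

/-! ### Markov chains on the lattice, with a parameter -/

/-- The one-step law from `z`: the law of `z + e`, where `e` is drawn from `p`. -/
def stepMeasure {d : ℕ} (p : ProbVec d) (z : Site d) : Measure (Site d) :=
  ∑ e : Dir d, ENNReal.ofReal (p e) • Measure.dirac (z + dirVec e)

lemma isProbabilityMeasure_stepMeasure {d : ℕ} (p : ProbVec d) (z : Site d) :
    IsProbabilityMeasure (stepMeasure p z) := by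
  constructor
  have h : ∑ e : Dir d, ENNReal.ofReal (p e) = 1 := by
    have h1 : ∑ e, p e = 1 := p.2.2
    rw [← ENNReal.ofReal_sum_of_nonneg (f := fun e => p e) (fun e _ => p.2.1 e), h1,
      ENNReal.ofReal_one]
  simpa [stepMeasure] using h

lemma measurable_stepMeasure {d : ℕ} {Θ : Type*} [MeasurableSpace Θ]
    {f : Θ × Site d → ProbVec d} (hf : Measurable f) :
    Measurable fun a : Θ × Site d => stepMeasure (f a) a.2 := by
  refine Measure.measurable_of_measurable_coe _ fun s hs => ?_
  simp only [stepMeasure, Measure.coe_finsetSum, Finset.sum_apply, Measure.smul_apply, smul_eq_mul]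
  refine Finset.measurable_sum _ fun e _ => Measurable.mul ?_ ?_
  · exact ENNReal.measurable_ofReal.comp ((measurable_pi_apply e).comp
      (measurable_subtype_coe.comp hf))
  · have h1 : Measurable fun z : Site d => (Measure.dirac (z + dirVec e)) s :=
      measurable_from_top.mono (fun t _ => MeasurableSet.of_discrete) le_rfl
    exact h1.comp measurable_snd

/-- The one-step kernel that from `(θ, z)` moves by a direction with law `f (θ, z)`. -/
def stepKernel {d : ℕ} {Θ : Type*} [MeasurableSpace Θ] (f : Θ × Site d → ProbVec d)
    (hf : Measurable f) : Kernel (Θ × Site d) (Site d) :=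
  ⟨fun a => stepMeasure (f a) a.2, measurable_stepMeasure hf⟩

instance instMarkovStepKernel {d : ℕ} {Θ : Type*} [MeasurableSpace Θ]
    (f : Θ × Site d → ProbVec d) (hf : Measurable f) : IsMarkovKernel (stepKernel f hf) :=
  ⟨fun a => isProbabilityMeasure_stepMeasure (f a) a.2⟩

/-- The kernel that extends a history of pairs `(θ, X_0), …, (θ, X_n)` by `(θ, X_{n+1})`, where
`X_{n+1}` has law `κ n (θ, X_n)`; the parameter `θ` is only carried along. -/
def extendKernel {d : ℕ} {Θ : Type*} [MeasurableSpace Θ] (κ : ℕ → Kernel (Θ × Site d) (Site d))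
    (n : ℕ) : Kernel (∀ _ : Finset.Iic n, Θ × Site d) (Θ × Site d) :=
  ((Kernel.deterministic (Prod.fst : Θ × Site d → Θ) measurable_fst) ×ₖ κ n).comap
    (fun h => h ⟨n, Finset.mem_Iic.mpr le_rfl⟩) (measurable_pi_apply _)

instance instMarkovExtendKernel {d : ℕ} {Θ : Type*} [MeasurableSpace Θ]
    (κ : ℕ → Kernel (Θ × Site d) (Site d)) [∀ n, IsMarkovKernel (κ n)] (n : ℕ) :
    IsMarkovKernel (extendKernel κ n) := by
  unfold extendKernel; infer_instance

/-- The law on path space of the Markov chain with `X_0 = x` and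
`P(X_{n+1} ∈ · | X_0, …, X_n) = κ n (θ, X_n)`, as a kernel in `(θ, x)` (Ionescu-Tulcea). -/
def chainKernel {d : ℕ} {Θ : Type*} [MeasurableSpace Θ] (κ : ℕ → Kernel (Θ × Site d) (Site d))
    [∀ n, IsMarkovKernel (κ n)] : Kernel (Θ × Site d) (ℕ → Site d) :=
  ((Kernel.traj (X := fun _ => Θ × Site d) (extendKernel κ) 0).comap (fun a _ => a)
    (measurable_pi_lambda _ fun _ => measurable_id)).map (fun t n => (t n).2)

instance instMarkovChainKernel {d : ℕ} {Θ : Type*} [MeasurableSpace Θ]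
    (κ : ℕ → Kernel (Θ × Site d) (Site d)) [∀ n, IsMarkovKernel (κ n)] :
    IsMarkovKernel (chainKernel κ) := by
  unfold chainKernel
  exact Kernel.IsMarkovKernel.map _
    (measurable_pi_lambda _ fun n => measurable_snd.comp (measurable_pi_apply n))

/-! ### The random walk in the environment -/

lemma measurable_envAt {d : ℕ} :
    Measurable fun a : Env d × Site d => a.1 a.2 :=
  measurable_from_prod_countable_left fun x => measurable_pi_apply x

/-- The quenched law `P_ω^x`, as a kernel in `(ω, x)`. -/
def quenched (d : ℕ) : Kernel (Env d × Site d) (ℕ → Site d) :=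
  chainKernel fun _ => stepKernel (fun a : Env d × Site d => a.1 a.2) measurable_envAt

instance instMarkovQuenched (d : ℕ) : IsMarkovKernel (quenched d) := by
  unfold quenched; infer_instance

/-- The joint law `𝐏 = P ⊗ P_ω^o` of the environment and of the walk started at the origin. -/
def annealed {d : ℕ} (P : Measure (Env d)) : Measure (Env d × (ℕ → Site d)) :=
  P ⊗ₘ ((quenched d).comap (fun ω => (ω, 0)) (measurable_id.prodMk measurable_const))

/-! ### The walk with `ε`-coins -/

/-- The coins `ε_{n, x}`, `n ∈ ℕ`, `x ∈ ℤ^d`; the value `1` is `true`. -/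
abbrev Coins (d : ℕ) : Type := ℕ × Site d → Bool

/-- The law of one coin: `1` with probability `d κ`, `0` with probability `1 - d κ`. -/
def coinLaw {d : ℕ} (κ : EllConst d) : Measure Bool :=
  ENNReal.ofReal (d * (κ : ℝ)) • Measure.dirac true +
    ENNReal.ofReal (1 - d * (κ : ℝ)) • Measure.dirac false

lemma EllConst.mul_lt {d : ℕ} [NeZero d] (κ : EllConst d) : (d : ℝ) * (κ : ℝ) < 1 / 2 := by
  have hd : (0 : ℝ) < d := Nat.cast_pos.mpr (NeZero.pos d)
  have h := mul_lt_mul_of_pos_left κ.2.2 hd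
  have h2 : (d : ℝ) * (1 / (2 * (d : ℝ))) = 1 / 2 := by field_simp
  linarith

instance instProbCoinLaw {d : ℕ} [NeZero d] (κ : EllConst d) :
    IsProbabilityMeasure (coinLaw κ) := by
  constructor
  have h0 : (0 : ℝ) ≤ d * (κ : ℝ) := mul_nonneg (Nat.cast_nonneg d) κ.2.1.le
  have h1 : (0 : ℝ) ≤ 1 - d * (κ : ℝ) := by linarith [EllConst.mul_lt κ]
  simp only [coinLaw, Measure.add_apply, Measure.smul_apply, measure_univ, smul_eq_mul, mul_one]
  rw [← ENNReal.ofReal_add h0 h1]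
  simp

/-- The law `Q` of the iid coins. -/
def coinsLaw {d : ℕ} (κ : EllConst d) : Measure (Coins d) :=
  Measure.infinitePi fun _ => coinLaw κ

instance instProbCoinsLaw {d : ℕ} [NeZero d] (κ : EllConst d) :
    IsProbabilityMeasure (coinsLaw κ) := by
  unfold coinsLaw; infer_instance

open Classical in
/-- The step distribution at a site whose coin is `b` and whose environment is `q`:
`1 / (2 d)` if the coin is `1`, and `(q(e) - κ / 2) / (1 - d κ)` if the coin is `0`. The second
formula is a probability vector when `q ≥ κ / 2`, as is the case almost surely for a uniformly
elliptic environment; elsewhere the definition falls back on `q`. -/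
def coinStep {d : ℕ} [NeZero d] (κ : EllConst d) (b : Bool) (q : ProbVec d) : ProbVec d :=
  if b = true then uniformVec d
  else if h : ∀ e, (κ : ℝ) / 2 ≤ q e then
    ⟨fun e => (q e - (κ : ℝ) / 2) / (1 - d * (κ : ℝ)),
      fun e => div_nonneg (sub_nonneg.mpr (h e)) (by linarith [EllConst.mul_lt κ]), by
        have h1 : (1 - d * (κ : ℝ)) ≠ 0 := by linarith [EllConst.mul_lt κ]
        have h2 : ∑ e, q e = 1 := q.2.2
        rw [← Finset.sum_div, Finset.sum_sub_distrib, h2]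
        simp only [Finset.sum_const, Finset.card_univ, Fintype.card_prod, Fintype.card_fin,
          Fintype.card_bool, nsmul_eq_mul]
        push_cast
        rw [div_eq_one_iff_eq h1]
        ring⟩
  else q

lemma measurable_coinStep {d : ℕ} [NeZero d] (κ : EllConst d) (b : Bool) :
    Measurable (coinStep κ b) := by
  classical
  cases b with
  | true =>
    have : coinStep κ true = fun _ => uniformVec d := by funext q; simp [coinStep]
    rw [this]; exact measurable_const
  | false =>
    have happ : ∀ e : Dir d, Measurable fun q : ProbVec d => q e := fun e =>
      (measurable_pi_apply e).comp measurable_subtype_coe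
    have hset : MeasurableSet {q : ProbVec d | ∀ e, (κ : ℝ) / 2 ≤ q e} := by
      rw [Set.ofPred_forall]
      exact MeasurableSet.iInter fun e => measurableSet_le measurable_const (happ e)
    refine Measurable.subtype_mk (f := fun q => (coinStep κ false q : Dir d → ℝ)) ?_
    refine measurable_pi_lambda _ fun e => ?_
    have : (fun q : ProbVec d => (coinStep κ false q : Dir d → ℝ) e) =
        fun q => if (∀ e, (κ : ℝ) / 2 ≤ q e) then (q e - (κ : ℝ) / 2) / (1 - d * (κ : ℝ))
          else q e := by
      funext q
      by_cases h : ∀ e, (κ : ℝ) / 2 ≤ q e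
      · simp only [coinStep, Bool.false_eq_true, if_false, dif_pos h, if_pos h]; rfl
      · simp only [coinStep, Bool.false_eq_true, if_false, dif_neg h, if_neg h]
    rw [this]
    exact Measurable.ite hset (((happ e).sub_const _).div_const _) (happ e)

lemma measurable_coinStepAt {d : ℕ} [NeZero d] (κ : EllConst d) (n : ℕ) :
    Measurable fun a : (Env d × Coins d) × Site d =>
      coinStep κ (a.1.2 (n, a.2)) (a.1.1 a.2) := by
  refine measurable_from_prod_countable_left fun x => ?_
  have h : Measurable fun a : Bool × ProbVec d => coinStep κ a.1 a.2 :=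
    measurable_from_prod_countable_right fun b => measurable_coinStep κ b
  have h2 : Measurable fun a : Env d × Coins d => (a.2 (n, x), a.1 x) :=
    ((measurable_pi_apply (n, x)).comp measurable_snd).prodMk
      ((measurable_pi_apply x).comp measurable_fst)
  exact h.comp h2

/-- The law `P_{ω,ε}^x`, as a kernel in `((ω, ε), x)`. At time `n` and site `z` the step
distribution is determined by the coin `ε_{n, z}` and by the environment `ω(z, ·)`. -/
def quenchedCoins {d : ℕ} [NeZero d] (κ : EllConst d) :
    Kernel ((Env d × Coins d) × Site d) (ℕ → Site d) :=
  chainKernel fun n => stepKernel _ (measurable_coinStepAt κ n)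

instance instMarkovQuenchedCoins {d : ℕ} [NeZero d] (κ : EllConst d) :
    IsMarkovKernel (quenchedCoins κ) := by
  unfold quenchedCoins; infer_instance

/-- The sample space of triples `(ω, ε, X)`, written `((ω, ε), X)`. -/
abbrev Triple (d : ℕ) : Type := (Env d × Coins d) × (ℕ → Site d)

/-- The law `P ⊗ Q ⊗ P_{ω,ε}^o` of the triple. -/
def annealedCoins {d : ℕ} [NeZero d] (P : Measure (Env d)) (κ : EllConst d) :
    Measure (Triple d) :=
  (P.prod (coinsLaw κ)) ⊗ₘ
    ((quenchedCoins κ).comap (fun p => (p, 0)) (measurable_id.prodMk measurable_const))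

instance instFiniteAnnealedCoins {d : ℕ} [NeZero d] (P : Measure (Env d))
    [IsProbabilityMeasure P] (κ : EllConst d) : IsProbabilityMeasure (annealedCoins P κ) := by
  unfold annealedCoins; infer_instance

/-! ### The stopping time `R` -/

/-- The first time at which `p` holds; `∞` if there is none. -/
def firstTime (p : ℕ → Prop) : ℕ∞ := sInf {t : ℕ∞ | ∃ n : ℕ, p n ∧ t = n}

open Classical in
/-- The number of visits, up to and including time `n`, to the `j`-th level above the starting
point. -/
def visits {d : ℕ} [NeZero d] (X : ℕ → Site d) (j n : ℕ) : ℕ :=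
  ((Finset.range (n + 1)).filter fun i => level (X i) = level (X 0) + j).card

/-- `D = inf {n ≥ 1 : X_n · e_1 ≤ X_0 · e_1}`. -/
def stopD {d : ℕ} [NeZero d] (X : ℕ → Site d) : ℕ∞ :=
  firstTime fun n => 1 ≤ n ∧ level (X n) ≤ level (X 0)

/-- `R = inf {n ≥ 0 : for some j ≥ 0 the j-th level is visited more than c₅ (j + 1)² times up to
time n} ∧ D`. -/
def stopR {d : ℕ} [NeZero d] (c₅ : ℝ) (X : ℕ → Site d) : ℕ∞ :=
  min (firstTime fun n => ∃ j : ℕ, c₅ * ((j : ℝ) + 1) ^ 2 < visits X j n) (stopD X)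

/-! ### Regeneration times -/

/-- The time shift of coins. -/
def shiftCoins {d : ℕ} (n : ℕ) (ε : Coins d) : Coins d := fun p => ε (n + p.1, p.2)

/-- The time shift of a path. -/
def shiftPath {d : ℕ} (n : ℕ) (X : ℕ → Site d) : ℕ → Site d := fun i => X (n + i)

/-- The event at time `n` in the definition of `S_{k+1}`: at time `n - L` the path is at a
strictly higher level than ever before, and in the `L` steps that follow all coins met are `1` and
all steps are `e_1`. -/
def StraightAt {d : ℕ} [NeZero d] (L : ℕ) (ε : Coins d) (X : ℕ → Site d) (n : ℕ) : Prop :=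
  L ≤ n ∧ (∀ m < n - L, level (X m) < level (X (n - L))) ∧
    ∀ i, 1 ≤ i → i ≤ L → ε (n - i, X (n - i)) = true ∧ X (n - i + 1) - X (n - i) = e1

/-- `S_{k+1}` as a function of `R_k = t`. -/
def nextS {d : ℕ} [NeZero d] (L : ℕ) (ε : Coins d) (X : ℕ → Site d) (t : ℕ∞) : ℕ∞ :=
  firstTime fun n => t ≤ n ∧ StraightAt L ε X n

/-- `T ∘ θ_s + s`, for a random time `T` and a time `s`; it is `∞` when `s = ∞`. -/
def addShifted {d : ℕ} (T : Coins d → (ℕ → Site d) → ℕ∞) (ε : Coins d) (X : ℕ → Site d) :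
    ℕ∞ → ℕ∞
  | ⊤ => ⊤
  | (s : ℕ) => T (shiftCoins s ε) (shiftPath s X) + s

/-- `R_k`. -/
def timeR {d : ℕ} [NeZero d] (c₅ : ℝ) (L : ℕ) (ε : Coins d) (X : ℕ → Site d) : ℕ → ℕ∞
  | 0 => 0
  | k + 1 => addShifted (fun _ Y => stopR c₅ Y) ε X (nextS L ε X (timeR c₅ L ε X k))

/-- `S_k` for `k ≥ 1` (the value at `k = 0` is not used). -/
def timeS {d : ℕ} [NeZero d] (c₅ : ℝ) (L : ℕ) (ε : Coins d) (X : ℕ → Site d) : ℕ → ℕ∞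
  | 0 => 0
  | k + 1 => nextS L ε X (timeR c₅ L ε X k)

open Classical in
/-- `τ_1 = S_K` with `K = inf {k ≥ 1 : S_k < ∞, R_k = ∞}`; it is `∞` if there is no such `k`. -/
def tauOne {d : ℕ} [NeZero d] (c₅ : ℝ) (L : ℕ) (ε : Coins d) (X : ℕ → Site d) : ℕ∞ :=
  if h : ∃ k, 1 ≤ k ∧ timeS c₅ L ε X k < ⊤ ∧ timeR c₅ L ε X k = ⊤ then
    timeS c₅ L ε X (Nat.find h)
  else ⊤

/-- The `L`-regeneration times: `τ_0 = 0` and `τ_{k+1} = τ_1 ∘ θ_{τ_k} + τ_k`. -/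
def tau {d : ℕ} [NeZero d] (c₅ : ℝ) (L : ℕ) (ε : Coins d) (X : ℕ → Site d) : ℕ → ℕ∞
  | 0 => 0
  | k + 1 => addShifted (tauOne c₅ L) ε X (tau c₅ L ε X k)

/-! ### Regeneration blocks -/

/-- The values of a regeneration block `(P, W, F, T)`: a finite path `P`, a family `W` of
environments at the sites of this path, a displacement `F` and a duration `T`. -/
abbrev Block (d : ℕ) : Type :=
  Σ p : List (Site d), ({x : Site d // x ∈ p} → ProbVec d) × Site d × ℕ

instance instNonemptyBlock (d : ℕ) : Nonempty (Block d) :=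
  ⟨⟨[], fun x => absurd x.2 (List.not_mem_nil), 0, 0⟩⟩

lemma standardBorelSpace_sigma {ι : Type} [Countable ι] {E : ι → Type}
    [m : ∀ i, MeasurableSpace (E i)] [∀ i, StandardBorelSpace (E i)] :
    StandardBorelSpace (Σ i, E i) := by
  choose t ht using fun i => StandardBorelSpace.polish (α := E i)
  have hB : ∀ i, BorelSpace (E i) := fun i => (ht i).1
  have hP : ∀ i, PolishSpace (E i) := fun i => (ht i).2
  refine ⟨inferInstance, ⟨le_antisymm ?_ ?_⟩, ?_⟩
  · intro s hs
    have h : ∀ i, MeasurableSet (Sigma.mk i ⁻¹' s) := fun i =>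
      MeasurableSpace.measurableSet_iInf.mp hs i
    have hs' : s = ⋃ i, Sigma.mk i '' (Sigma.mk i ⁻¹' s) := by
      ext ⟨i, x⟩
      simp only [Set.mem_iUnion, Set.mem_image, Set.mem_preimage]
      constructor
      · intro hx
        exact ⟨i, x, hx, rfl⟩
      · rintro ⟨j, y, hy, hyx⟩
        rw [← hyx]
        exact hy
    rw [hs']
    let m' : MeasurableSpace (Σ i, E i) := borel _
    have hB' : @BorelSpace (Σ i, E i) _ m' := @BorelSpace.mk _ _ m' rfl
    exact MeasurableSet.iUnion fun i =>
      Topology.IsOpenEmbedding.sigmaMk.measurableEmbedding.measurableSet_image.mpr (h i)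
  · refine MeasurableSpace.generateFrom_le fun s hs => ?_
    exact MeasurableSpace.measurableSet_iInf.mpr fun i =>
      ((continuous_sigmaMk (σ := E) (i := i)).isOpen_preimage s hs).measurableSet
  · infer_instance

instance instStandardBorelBlock (d : ℕ) : StandardBorelSpace (Block d) :=
  standardBorelSpace_sigma

/-- The block `J_{n+1} = (P_{n+1}, W_{n+1}, F_{n+1}, τ_{n+1} - τ_n)`. With `a = τ_n` and
`b = τ_{n+1}`, the path is `(X_{i+a} - X_a)_{0 ≤ i ≤ b - a - L}`, its environments are
`(ω_{x + X_a})_x`, and the displacement is `X_b - X_a`. (Infinite times are read as `0`.) -/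
def block {d : ℕ} [NeZero d] (c₅ : ℝ) (L : ℕ) (n : ℕ) (z : Triple d) : Block d :=
  let a : ℕ := (tau c₅ L z.1.2 z.2 n).toNat
  let b : ℕ := (tau c₅ L z.1.2 z.2 (n + 1)).toNat
  ⟨(List.range (b - a - L + 1)).map fun i => z.2 (i + a) - z.2 a,
    fun x => z.1.1 (x + z.2 a), z.2 b - z.2 a, b - a⟩

/-- The law of the triple conditioned on `{R = ∞}`. -/
def hatP {d : ℕ} [NeZero d] (P : Measure (Env d)) (κ : EllConst d) (c₅ : ℝ) :
    Measure (Triple d) :=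
  (annealedCoins P κ)[|{z | stopR c₅ z.2 = ⊤}]

instance instFiniteHatP {d : ℕ} [NeZero d] (P : Measure (Env d)) [IsProbabilityMeasure P]
    (κ : EllConst d) (c₅ : ℝ) : IsFiniteMeasure (hatP P κ c₅) := by
  unfold hatP; infer_instance

/-- The transition kernel `h_{i+1}(· | j_i, …, j_1)`: the regular conditional law of `J_{i+1}`
given `(J_1, …, J_i)` under the conditioned measure. The argument lists `j_1, …, j_i` in this
order; for `i = 0` it is the law of `J_1`. -/
def transKernel {d : ℕ} [NeZero d] (P : Measure (Env d)) [IsProbabilityMeasure P]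
    (κ : EllConst d) (c₅ : ℝ) (L i : ℕ) : Kernel (Fin i → Block d) (Block d) :=
  condDistrib (block c₅ L i) (fun z (m : Fin i) => block c₅ L (m : ℕ) z) (hatP P κ c₅)

end

end RWRE

namespace RWRE

/-! During the last `L` steps before a regeneration time all coins met are `1`, and such a step is
uniform whatever the environment. The walk up to `τ_n` therefore reads the environment only at the
sites recorded by its blocks (`Vis`). Moreover, on `R = ∞`, whether `u` is the `n`-th regeneration
time is decided by the marked path up to `u` together with `R ∘ θ_u = ∞`
(`regeneration_determined`). By the Markov property the probability of a history and of a next block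
in `B` is then an integral of three factors: a weight that is a function of the recorded
environment, an indicator of the past blocks, and the quenched probability, seen from `X_{τ_n}`,
that `R = ∞` and the first block is in `B`. The weight cancels, and the transition kernel is the
ratio of the conditional expectations, given the recorded environment, of the quenched probabilities
of `{first block in B, R = ∞}` and of `{R = ∞}` (`condE_firstBlockIn_eq`).

It remains to compare such a ratio for the last `k` blocks with the true conditional law given all
the blocks. Each block rises by at least `L` levels and the block preceding the last `k` ends with
`L` straight steps, so the sites recorded in addition lie at least `(k + 1) L` levels below the
start of the next block. On `R = ∞` the future walk stays at or above its start and meets at most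
`c₅ (j + 1)²` sites on its `j`-th level. The sum of `exp (-γ d(x, y))` over the additional sites `x`
and the future sites `y` is then at most a constant times `exp (-γ (k + 1) L / 2)`
(`tsum_exp_dist1_le`), and the mixing condition bounds the change of numerator and denominator by
the exponential of a multiple of this (`mix_firstBlockIn`, `mix_good`). Lowering the rate from `γ /
2` to `γ / 4` absorbs all constants for large `L`.

The mixing condition concerns finite sets, while `R = ∞` is an event of an infinite path.
`mix_Cyl_good` bridges the gap by writing `{R = ∞}` as a decreasing limit of the events `{R > N}`
and splitting these into finite paths. That all regeneration times are finite on `R = ∞` is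
`ae_T_ne_top`. -/

set_option linter.unusedSectionVars false

/-! ### Comparison of measures -/

/-- Two finite measures that are ordered on a generating set algebra are ordered. -/
lemma measure_le_of_le_on_setAlgebra {α : Type*} [mα : MeasurableSpace α] (μ ν : Measure α)
    [IsFiniteMeasure μ] [IsFiniteMeasure ν] (𝒜 : Set (Set α)) (hA : IsSetAlgebra 𝒜)
    (hgen : mα = MeasurableSpace.generateFrom 𝒜) (h : ∀ s ∈ 𝒜, μ s ≤ ν s) : μ ≤ ν := by
  -- Density with respect to the sum gives one approximating set that is good for both measures.
  have hd : (μ + ν).MeasureDense 𝒜 :=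
    Measure.MeasureDense.of_generateFrom_isSetAlgebra_finite _ hA hgen
  refine Measure.le_iff.mpr fun s hs => ?_
  refine le_of_forall_pos_le_add fun ε hε => ?_
  by_cases hεt : ε = ⊤
  · simp [hεt]
  have hε2 : 0 < ε.toReal / 2 := half_pos (ENNReal.toReal_pos hε.ne' hεt)
  obtain ⟨t, ht, hst⟩ := hd.approx s hs (measure_ne_top _ _) (ε.toReal / 2) hε2
  have h1 : ENNReal.ofReal (ε.toReal / 2) = ε / 2 := by
    rw [ENNReal.ofReal_div_of_pos two_pos, ENNReal.ofReal_toReal hεt]; simp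
  rw [h1] at hst
  have hμ : μ (symmDiff s t) ≤ ε / 2 := (Measure.le_add_right le_rfl _).trans hst.le
  have hν : ν (symmDiff s t) ≤ ε / 2 := (Measure.le_add_left le_rfl _).trans hst.le
  have a1 : μ s ≤ μ t + μ (symmDiff s t) := by
    refine (measure_mono ?_).trans (measure_union_le _ _)
    intro x hx
    by_cases hxt : x ∈ t
    · exact Or.inl hxt
    · exact Or.inr (Or.inl ⟨hx, hxt⟩)
  have a2 : ν t ≤ ν s + ν (symmDiff s t) := by
    refine (measure_mono ?_).trans (measure_union_le _ _)
    intro x hx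
    by_cases hxt : x ∈ s
    · exact Or.inl hxt
    · exact Or.inr (Or.inr ⟨hx, hxt⟩)
  calc μ s ≤ μ t + ε / 2 := a1.trans (by gcongr)
    _ ≤ ν t + ε / 2 := add_le_add (h t ht) le_rfl
    _ ≤ (ν s + ε / 2) + ε / 2 := by gcongr; exact a2.trans (by gcongr)
    _ = ν s + ε := by rw [add_assoc, ENNReal.add_halves]

/-- If, for every measurable `B`, almost surely `κ B ≤ c η B`, then almost surely the inequality
holds for all measurable `B` at once. -/
lemma ae_forall_measure_le {α β : Type*} [MeasurableSpace α] [mβ : MeasurableSpace β]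
    [MeasurableSpace.CountablyGenerated β] (μ : Measure α) (κ η : α → Measure β)
    [∀ a, IsFiniteMeasure (κ a)] [∀ a, IsFiniteMeasure (η a)] (c : ℝ≥0∞) (hc : c ≠ ⊤)
    (h : ∀ B, MeasurableSet B → ∀ᵐ a ∂μ, κ a B ≤ c * η a B) :
    ∀ᵐ a ∂μ, ∀ B, MeasurableSet B → κ a B ≤ c * η a B := by
  set 𝒢 := MeasurableSpace.countableGeneratingSet β with hG
  set 𝒜 := generateSetAlgebra 𝒢 with hA
  have hAc : 𝒜.Countable := countable_generateSetAlgebra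
    (MeasurableSpace.countable_countableGeneratingSet)
  have hgen : mβ = MeasurableSpace.generateFrom 𝒜 := by
    rw [hA, generateFrom_generateSetAlgebra_eq]
    exact (MeasurableSpace.generateFrom_countableGeneratingSet).symm
  have hm : ∀ s ∈ 𝒜, MeasurableSet s := fun s hs => by
    rw [hgen]; exact MeasurableSpace.measurableSet_generateFrom hs
  have hall : ∀ᵐ a ∂μ, ∀ s ∈ 𝒜, κ a s ≤ c * η a s :=
    (ae_ball_iff hAc).mpr fun s hs => h s (hm s hs)
  filter_upwards [hall] with a ha B hB
  have : IsFiniteMeasure (c • η a) := Measure.smul_finite _ hc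
  have := measure_le_of_le_on_setAlgebra (κ a) (c • η a) 𝒜 isSetAlgebra_generateSetAlgebra hgen
    (fun s hs => by simpa using ha s hs)
  simpa using this B

/-- Disintegration: the joint law of `(X, Y)` is the law of `X` composed with the kernel, and both
sides integrate the product `w ⊗ g` against it. -/
lemma lintegral_mul_condDistrib {α β Ω : Type*} [MeasurableSpace α] [MeasurableSpace β]
    [MeasurableSpace Ω] [StandardBorelSpace Ω] [Nonempty Ω] (μ : Measure α) [IsFiniteMeasure μ]
    {X : α → β} {Y : α → Ω} (hX : Measurable X) (hY : Measurable Y) {w : β → ℝ≥0∞}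
    (hw : Measurable w) {g : Ω → ℝ≥0∞} (hg : Measurable g) :
    ∫⁻ a, w (X a) * ∫⁻ y, g y ∂(condDistrib Y X μ (X a)) ∂μ = ∫⁻ a, w (X a) * g (Y a) ∂μ := by
  have key := compProd_map_condDistrib (mβ := ‹MeasurableSpace β›) (μ := μ) (X := X) (Y := Y)
    hY.aemeasurable
  have hF : Measurable fun p : β × Ω => w p.1 * g p.2 :=
    (hw.comp measurable_fst).mul (hg.comp measurable_snd)
  have h1 := congrArg (fun m => ∫⁻ p, w p.1 * g p.2 ∂m) key
  rw [Measure.lintegral_compProd hF, lintegral_map hF (hX.prodMk hY),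
    lintegral_map hF.lintegral_kernel_prod_right' hX] at h1
  refine Eq.trans (lintegral_congr fun ω => ?_) h1
  exact (lintegral_const_mul _ hg).symm

/-! ### Conditional expectations given the environment on a set of sites -/

/-- A version of the conditional expectation of `f` given `(ω_x)_{x ∈ U}`. -/
noncomputable def condE {d : ℕ} [NeZero d] (P : Measure (Env d)) [IsProbabilityMeasure P]
    (U : Set (Site d))
    (f : Env d → ℝ≥0∞) (ω : Env d) : ℝ≥0∞ :=
  ∫⁻ ω', f ω' ∂(condDistrib id (restr U) P (restr U ω))

lemma measurable_restr {d : ℕ} (U : Set (Site d)) : Measurable (restr U) :=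
  measurable_pi_lambda _ fun x => measurable_pi_apply (x : Site d)

lemma sigmaAlg_le {d : ℕ} (U : Set (Site d)) : sigmaAlg U ≤ MeasurableSpace.pi :=
  (measurable_restr U).comap_le

lemma sigmaAlg_mono {d : ℕ} {U V : Set (Site d)} (h : U ⊆ V) : sigmaAlg U ≤ sigmaAlg V := by
  have : restr U = (fun η : V → ProbVec d => fun x : U => η ⟨x, h x.2⟩) ∘ restr V := rfl
  rw [sigmaAlg, this, ← MeasurableSpace.comap_comp]
  refine MeasurableSpace.comap_mono ?_
  exact (measurable_pi_lambda _ fun x => measurable_pi_apply _).comap_le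

lemma measurable_sigmaAlg_apply {d : ℕ} {U : Set (Site d)} {x : Site d} (hx : x ∈ U) :
    Measurable[sigmaAlg U] (fun ω : Env d => ω x) := by
  have : (fun ω : Env d => ω x) = (fun η : U → ProbVec d => η ⟨x, hx⟩) ∘ restr U := rfl
  rw [this]
  exact (measurable_pi_apply _).comp (comap_measurable _)

/-- A function to a measurable space that is measurable with respect to all coordinates in `U`. -/
lemma measurable_sigmaAlg_iff_le {d : ℕ} {U : Set (Site d)} {m : MeasurableSpace (Env d)}
    (h : ∀ x ∈ U, Measurable[m] (fun ω : Env d => ω x)) : sigmaAlg U ≤ m := by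
  have : Measurable[m] (restr U) := by
    refine @measurable_pi_lambda _ _ _ m _ _ fun x => h x x.2
  exact this.comap_le

section condE
variable {d : ℕ} [NeZero d] (P : Measure (Env d)) [IsProbabilityMeasure P] (U : Set (Site d))

lemma measurable_condE {f : Env d → ℝ≥0∞} (hf : Measurable f) :
    Measurable[sigmaAlg U] (condE P U f) := by
  have h : Measurable fun η : U → ProbVec d => ∫⁻ ω', f ω' ∂(condDistrib id (restr U) P η) :=
    hf.lintegral_kernel
  exact h.comp (comap_measurable _)

lemma lintegral_mul_condE {f v : Env d → ℝ≥0∞} (hf : Measurable f)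
    (hv : Measurable[sigmaAlg U] v) :
    ∫⁻ ω, v ω * condE P U f ω ∂P = ∫⁻ ω, v ω * f ω ∂P := by
  obtain ⟨w, hw, rfl⟩ := hv.exists_eq_measurable_comp
  exact lintegral_mul_condDistrib P (measurable_restr U) measurable_id hw hf

/-- Indicators of `sigmaAlg U`-events already separate, after restricting the measure to that
σ-algebra. -/
lemma ae_eq_of_sigmaAlg {f g : Env d → ℝ≥0∞} (hf : Measurable[sigmaAlg U] f)
    (hg : Measurable[sigmaAlg U] g)
    (h : ∀ v : Env d → ℝ≥0∞, Measurable[sigmaAlg U] v → (∀ ω, v ω ≤ 1) →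
      ∫⁻ ω, v ω * f ω ∂P = ∫⁻ ω, v ω * g ω ∂P) : f =ᵐ[P] g := by
  have hm := sigmaAlg_le (d := d) U
  have h2 : f =ᵐ[P.trim hm] g := by
    have : IsFiniteMeasure (P.trim hm) := isFiniteMeasure_trim hm
    refine @ae_eq_of_forall_setLIntegral_eq_of_sigmaFinite _ (sigmaAlg U) (P.trim hm) _ f g hf hg
      fun s hs _ => ?_
    rw [setLIntegral_trim hm hf hs, setLIntegral_trim hm hg hs]
    have h3 := h (s.indicator (fun _ => 1)) (Measurable.indicator (@measurable_const _ _ _ (sigmaAlg U) (1 : ℝ≥0∞)) hs)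
      (fun ω => Set.indicator_le_self' (by simp) ω)
    rw [← lintegral_indicator (hm _ hs), ← lintegral_indicator (hm _ hs)]
    have e : ∀ f : Env d → ℝ≥0∞, (fun a => s.indicator f a) = fun ω => s.indicator (fun _ => 1) ω * f ω := by
      intro f; funext ω; by_cases hω : ω ∈ s <;> simp [hω]
    rw [e f, e g]; exact h3
  exact ae_eq_of_ae_eq_trim h2

lemma condE_ae_eq {f g : Env d → ℝ≥0∞} (hf : Measurable f) (hg : Measurable[sigmaAlg U] g)
    (h : ∀ v : Env d → ℝ≥0∞, Measurable[sigmaAlg U] v → (∀ ω, v ω ≤ 1) →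
      ∫⁻ ω, v ω * f ω ∂P = ∫⁻ ω, v ω * g ω ∂P) : condE P U f =ᵐ[P] g := by
  refine ae_eq_of_sigmaAlg P U (measurable_condE P U hf) hg fun v hv hv1 => ?_
  rw [lintegral_mul_condE P U hf hv, h v hv hv1]

/-- Almost surely, the regular conditional law is carried by any set of full measure and by the
configurations that agree on the conditioning set. -/
lemma ae_condDistrib_agree {T : Set (Env d)} (hT : ∀ᵐ ω ∂P, ω ∈ T) :
    ∀ᵐ ω ∂P, ∀ᵐ ω' ∂(condDistrib id (restr U) P (restr U ω)),
      ω' ∈ T ∧ restr U ω' = restr U ω := by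
  have hX := measurable_restr (d := d) U
  have key := compProd_map_condDistrib (μ := P) (X := restr U) (Y := (id : Env d → Env d))
    (mβ := MeasurableSpace.pi) measurable_id.aemeasurable
  have h1 : ∀ᵐ p ∂((P.map (restr U)) ⊗ₘ condDistrib id (restr U) P),
      p.2 ∈ T ∧ restr U p.2 = p.1 := by
    rw [key]
    have hT' : ∀ᵐ p ∂(P.map fun a => (restr U a, id a)), p.2 ∈ T := by
      -- `T` need not be measurable, so its complement is enlarged to a measurable null set.
      obtain ⟨T', hT's, hT'm, hT'0⟩ := exists_measurable_superset_of_null (ae_iff.mp hT)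
      rw [ae_iff]
      refine measure_mono_null (t := Prod.snd ⁻¹' T') (fun p hp => hT's hp) ?_
      rw [Measure.map_apply (hX.prodMk measurable_id) (measurable_snd hT'm)]
      exact hT'0
    refine hT'.and ?_
    rw [ae_map_iff (hX.prodMk measurable_id).aemeasurable]
    · simp
    · exact measurableSet_eq_fun (hX.comp measurable_snd) measurable_fst
  have h2 := Measure.ae_ae_of_ae_compProd h1
  exact ae_of_ae_map hX.aemeasurable h2

end condE

/-! ### First times -/

lemma firstTime_eq_coe_iff (p : ℕ → Prop) (n : ℕ) :
    firstTime p = n ↔ p n ∧ ∀ m < n, ¬ p m := by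
  classical
  unfold firstTime
  constructor
  · intro h
    have hne : {t : ℕ∞ | ∃ n : ℕ, p n ∧ t = n}.Nonempty := by
      by_contra hne
      rw [Set.not_nonempty_iff_eq_empty] at hne
      rw [hne, sInf_empty] at h
      exact ENat.natCast_ne_top n h.symm
    obtain ⟨m, hm, hmn⟩ := csInf_mem hne
    rw [h] at hmn
    have hmn' : n = m := by exact_mod_cast hmn
    subst hmn'
    refine ⟨hm, fun m hmn hpm => ?_⟩
    have : sInf {t : ℕ∞ | ∃ n : ℕ, p n ∧ t = n} ≤ m := sInf_le ⟨m, hpm, rfl⟩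
    rw [h] at this
    have : n ≤ m := by exact_mod_cast this
    omega
  · rintro ⟨hn, hlt⟩
    refine le_antisymm (sInf_le ⟨n, hn, rfl⟩) (le_sInf ?_)
    rintro t ⟨m, hm, rfl⟩
    have : n ≤ m := by
      by_contra hmn
      exact hlt m (by omega) hm
    exact_mod_cast this

lemma firstTime_eq_top_iff (p : ℕ → Prop) : firstTime p = ⊤ ↔ ∀ n, ¬ p n := by
  unfold firstTime
  rw [sInf_eq_top]
  constructor
  · intro h n hn
    exact ENat.natCast_ne_top n (h n ⟨n, hn, rfl⟩)
  · rintro h t ⟨n, hn, -⟩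
    exact absurd hn (h n)

lemma lt_firstTime_iff (p : ℕ → Prop) (N : ℕ) :
    (N : ℕ∞) < firstTime p ↔ ∀ n ≤ N, ¬ p n := by
  constructor
  · intro h n hn hp
    have h1 : firstTime p ≤ n := sInf_le ⟨n, hp, rfl⟩
    have : (N : ℕ∞) < n := h.trans_le h1
    have : N < n := by exact_mod_cast this
    omega
  · intro h
    have h1 : ((N + 1 : ℕ) : ℕ∞) ≤ firstTime p := by
      refine le_sInf ?_
      rintro t ⟨m, hm, rfl⟩
      have : N + 1 ≤ m := by
        by_contra hmn
        exact h m (by omega) hm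
      exact_mod_cast this
    exact lt_of_lt_of_le (by exact_mod_cast Nat.lt_succ_self N) h1

/-- Only comparisons with `N ≤ u` are asked for, which is what two paths agreeing up to time `u` can
provide. -/
lemma enat_eq_of_lt_iff {a b : ℕ∞} (u : ℕ) (ha : a = u)
    (h : ∀ N ≤ u, (N : ℕ∞) < a ↔ (N : ℕ∞) < b) : b = u := by
  subst ha
  have h1 : ¬ ((u : ℕ∞) < b) := fun hb => lt_irrefl _ ((h u le_rfl).mpr hb)
  refine le_antisymm (not_lt.mp h1) ?_
  rcases Nat.eq_zero_or_pos u with rfl | hu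
  · simp
  · have := (h (u - 1) (by omega)).mp (by exact_mod_cast (by omega : u - 1 < u))
    have h2 := Order.add_one_le_of_lt this
    have h3 : ((u - 1 : ℕ) : ℕ∞) + 1 = u := by
      exact_mod_cast (by omega : u - 1 + 1 = u)
    rwa [h3] at h2

lemma enat_eq_top_iff_forall_lt {a : ℕ∞} : a = ⊤ ↔ ∀ N : ℕ, (N : ℕ∞) < a := by
  constructor
  · rintro rfl N; exact ENat.natCast_lt_top N
  · intro h
    by_contra ha
    obtain ⟨n, rfl⟩ := ENat.ne_top_iff_exists.mp ha
    exact lt_irrefl _ (h n)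

/-! ### Marked paths -/

/-- A path together with the values of the coins that it meets. -/
abbrev Trk (d : ℕ) : Type := (ℕ → Site d) × (ℕ → Bool)

/-- Coins that depend on time only. -/
def liftCoins {d : ℕ} (b : ℕ → Bool) : Coins d := fun p => b p.1

/-- The path seen from its position at time `s`. -/
def shiftT {d : ℕ} (s : ℕ) (φ : Trk d) : Trk d :=
  (fun i => φ.1 (s + i) - φ.1 s, fun i => φ.2 (s + i))

/-- Two marked paths agree up to time `t`. -/
def AgreeTo {d : ℕ} (t : ℕ) (φ ψ : Trk d) : Prop :=
  (∀ i ≤ t, φ.1 i = ψ.1 i) ∧ ∀ i < t, φ.2 i = ψ.2 i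

lemma AgreeTo.symm {d : ℕ} {t : ℕ} {φ ψ : Trk d} (h : AgreeTo t φ ψ) : AgreeTo t ψ φ :=
  ⟨fun i hi => (h.1 i hi).symm, fun i hi => (h.2 i hi).symm⟩

lemma AgreeTo.trans {d : ℕ} {t : ℕ} {φ ψ χ : Trk d} (h : AgreeTo t φ ψ) (h' : AgreeTo t ψ χ) :
    AgreeTo t φ χ :=
  ⟨fun i hi => (h.1 i hi).trans (h'.1 i hi), fun i hi => (h.2 i hi).trans (h'.2 i hi)⟩

lemma AgreeTo.mono {d : ℕ} {s t : ℕ} {φ ψ : Trk d} (h : AgreeTo t φ ψ) (hst : s ≤ t) :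
    AgreeTo s φ ψ :=
  ⟨fun i hi => h.1 i (hi.trans hst), fun i hi => h.2 i (hi.trans_le hst)⟩

lemma AgreeTo.shift {d : ℕ} {s t : ℕ} {φ ψ : Trk d} (h : AgreeTo (t + s) φ ψ) :
    AgreeTo t (shiftT s φ) (shiftT s ψ) :=
  ⟨fun i hi => by simp only [shiftT]; rw [h.1 _ (by omega), h.1 s (by omega)],
    fun i hi => h.2 _ (by omega)⟩

lemma shiftT_shiftT {d : ℕ} (s t : ℕ) (φ : Trk d) :
    shiftT t (shiftT s φ) = shiftT (t + s) φ := by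
  have e : ∀ i, s + (t + i) = t + s + i := fun i => by omega
  have e' : s + t = t + s := by omega
  refine Prod.ext (funext fun i => ?_) (funext fun i => ?_)
  · simp only [shiftT, e, e']
    abel
  · simp only [shiftT, e]

section
variable {d : ℕ} [NeZero d]

lemma level_sub (x y : Site d) : level (x - y) = level x - level y := rfl
lemma level_add (x y : Site d) : level (x + y) = level x + level y := rfl
lemma level_zero : level (0 : Site d) = 0 := rfl

/-! ### The stopping time `R` -/

lemma visits_mono (X : ℕ → Site d) (j : ℕ) {m n : ℕ} (h : m ≤ n) :
    visits X j m ≤ visits X j n := by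
  unfold visits
  refine Finset.card_le_card (Finset.filter_subset_filter _ ?_)
  exact Finset.range_mono (by omega)

lemma visits_congr {X Y : ℕ → Site d} (j n : ℕ)
    (h : ∀ i ≤ n, level (X i) - level (X 0) = level (Y i) - level (Y 0)) :
    visits X j n = visits Y j n := by
  unfold visits
  congr 1
  refine Finset.filter_congr fun i hi => ?_
  have := h i (by simpa [Nat.lt_succ_iff] using hi)
  constructor <;> intro h' <;> linarith

/-- Visit counts increase in time, so not having exceeded a bound up to time `N` is a condition on
the counts at time `N` alone. In this form `{N < R}` is visibly decided by the path up to `N`. -/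
lemma lt_stopR_iff (c₅ : ℝ) (X : ℕ → Site d) (N : ℕ) :
    (N : ℕ∞) < stopR c₅ X ↔ (∀ j : ℕ, (visits X j N : ℝ) ≤ c₅ * ((j : ℝ) + 1) ^ 2) ∧
      ∀ n, 1 ≤ n → n ≤ N → level (X 0) < level (X n) := by
  unfold stopR stopD
  rw [lt_min_iff, lt_firstTime_iff, lt_firstTime_iff]
  refine and_congr ?_ ?_
  · constructor
    · intro h j
      have := h N le_rfl
      push Not at this
      exact this j
    · intro h n hn
      push Not
      intro j
      refine le_trans ?_ (h j)
      exact_mod_cast visits_mono X j hn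
  · constructor
    · intro h n h1 hn
      have := h n hn
      push Not at this
      exact this h1
    · intro h n hn
      push Not
      intro h1
      exact h n h1 hn

lemma lt_stopR_congr (c₅ : ℝ) {X Y : ℕ → Site d} (N : ℕ)
    (h : ∀ i ≤ N, level (X i) - level (X 0) = level (Y i) - level (Y 0)) :
    (N : ℕ∞) < stopR c₅ X ↔ (N : ℕ∞) < stopR c₅ Y := by
  rw [lt_stopR_iff, lt_stopR_iff]
  refine and_congr (forall_congr' fun j => by rw [visits_congr j N h]) ?_
  refine forall_congr' fun n => forall_congr' fun _ => forall_congr' fun hn => ?_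
  have := h n hn
  constructor <;> intro h' <;> linarith

lemma stopR_congr (c₅ : ℝ) {X Y : ℕ → Site d}
    (h : ∀ i, level (X i) - level (X 0) = level (Y i) - level (Y 0)) :
    stopR c₅ X = stopR c₅ Y := by
  refine eq_of_forall_lt_iff fun c => ?_
  cases c with
  | top => simp
  | coe c => exact lt_stopR_congr c₅ c fun i _ => h i

lemma stopR_shiftPath (c₅ : ℝ) (s : ℕ) (φ : Trk d) :
    stopR c₅ (shiftPath s φ.1) = stopR c₅ (shiftT s φ).1 :=
  stopR_congr c₅ fun i => by simp [shiftPath, shiftT, level_sub, level_zero]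

/-- The marked paths with `R = ∞`. -/
def good (c₅ : ℝ) : Set (Trk d) := {φ | stopR c₅ φ.1 = ⊤}

lemma mem_good_iff (c₅ : ℝ) (φ : Trk d) : φ ∈ good c₅ ↔ ∀ N : ℕ, (N : ℕ∞) < stopR c₅ φ.1 :=
  enat_eq_top_iff_forall_lt

lemma shiftT_zero_mem_good {c₅ : ℝ} {φ : Trk d} : shiftT 0 φ ∈ good c₅ ↔ φ ∈ good c₅ := by
  have : stopR c₅ (shiftT 0 φ).1 = stopR c₅ φ.1 :=
    stopR_congr c₅ fun i => by simp [shiftT, level_sub, level_zero]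
  simp [good, this]

/-- Past a strict record, the condition `R > ·` for the whole path follows from that for the two
parts of the path. -/
lemma lt_stopR_concat {c₅ : ℝ} {φ : Trk d} {u N : ℕ}
    (hrec : ∀ i < u, level (φ.1 i) < level (φ.1 u)) (h1 : (u : ℕ∞) < stopR c₅ φ.1)
    (h2 : (N : ℕ∞) < stopR c₅ (shiftT u φ).1) : ((u + N : ℕ) : ℕ∞) < stopR c₅ φ.1 := by
  classical
  rw [lt_stopR_iff] at h1 h2 ⊢
  have hlate : ∀ i, 1 ≤ i → i ≤ N → level (φ.1 u) < level (φ.1 (u + i)) := by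
    intro i hi hiN
    have := h2.2 i hi hiN
    simp only [shiftT, level_sub, add_zero] at this
    linarith
  have h0 : level (φ.1 0) ≤ level (φ.1 u) := by
    rcases Nat.eq_zero_or_pos u with hu | hu
    · rw [hu]
    · exact (hrec 0 hu).le
  -- The bound at `j = 0` dominates a count and so fixes the sign of `c₅`, which the monotonicity in
  -- `j` at the end requires.
  have hc : 0 ≤ c₅ := by
    have := h1.1 0
    simp only [Nat.cast_zero, zero_add, one_pow, mul_one] at this
    exact le_trans (Nat.cast_nonneg _) this
  refine ⟨fun j => ?_, fun n hn hnu => ?_⟩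
  -- Levels up to that of the record are not visited after `u`. Higher levels are not visited before
  -- `u`, and counted from the record they have an index `j' ≤ j`, hence an even smaller bound.
  · by_cases hj : level (φ.1 0) + j ≤ level (φ.1 u)
    · have : visits φ.1 j (u + N) = visits φ.1 j u := by
        unfold visits
        congr 1
        ext i
        simp only [Finset.mem_filter, Finset.mem_range]
        constructor
        · rintro ⟨hi, hl⟩
          refine ⟨?_, hl⟩
          by_contra hiu
          have := hlate (i - u) (by omega) (by omega)
          rw [show u + (i - u) = i by omega] at this
          linarith
        · rintro ⟨hi, hl⟩
          exact ⟨by omega, hl⟩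
      rw [this]; exact h1.1 j
    · push Not at hj
      obtain ⟨j', hj'⟩ : ∃ j' : ℕ, level (φ.1 0) + j - level (φ.1 u) = j' :=
        ⟨_, (Int.toNat_of_nonneg (by linarith)).symm⟩
      have hle : visits φ.1 j (u + N) ≤ visits (shiftT u φ).1 j' N := by
        unfold visits
        refine le_trans (Finset.card_le_card (t := Finset.image (fun i => u + i)
          ((Finset.range (N + 1)).filter fun i => level ((shiftT u φ).1 i) =
            level ((shiftT u φ).1 0) + j')) ?_) Finset.card_image_le
        intro i hi
        simp only [Finset.mem_filter, Finset.mem_range] at hi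
        have hiu : u ≤ i := by
          by_contra hiu
          have := hrec i (by omega)
          linarith [hi.2]
        refine Finset.mem_image.mpr ⟨i - u, ?_, by omega⟩
        simp only [Finset.mem_filter, Finset.mem_range, shiftT, level_sub, add_zero]
        refine ⟨by omega, ?_⟩
        rw [show u + (i - u) = i by omega]
        linarith [hi.2]
      have hjj : (j' : ℝ) ≤ j := by
        have : (j' : ℤ) ≤ j := by linarith
        exact_mod_cast this
      calc (visits φ.1 j (u + N) : ℝ) ≤ visits (shiftT u φ).1 j' N := by exact_mod_cast hle
        _ ≤ c₅ * ((j' : ℝ) + 1) ^ 2 := h2.1 j'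
        _ ≤ c₅ * ((j : ℝ) + 1) ^ 2 := by gcongr
  · by_cases hnu' : n ≤ u
    · exact h1.2 n hn hnu'
    · have := hlate (n - u) (by omega) (by omega)
      rw [show u + (n - u) = n by omega] at this
      linarith

/-! ### Dependence of the times on the marked path -/

lemma straightAt_congr {L n t : ℕ} {φ ψ : Trk d} (h : AgreeTo t φ ψ) (hn : n ≤ t) :
    StraightAt L (liftCoins φ.2) φ.1 n ↔ StraightAt L (liftCoins ψ.2) ψ.1 n := by
  suffices H : ∀ φ ψ : Trk d, AgreeTo t φ ψ → StraightAt L (liftCoins φ.2) φ.1 n →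
      StraightAt L (liftCoins ψ.2) ψ.1 n from ⟨H φ ψ h, H ψ φ h.symm⟩
  rintro φ ψ h ⟨h1, h2, h3⟩
  refine ⟨h1, fun m hm => ?_, fun i hi hiL => ?_⟩
  · rw [← h.1 m (by omega), ← h.1 (n - L) (by omega)]; exact h2 m hm
  · have := h3 i hi hiL
    simp only [liftCoins] at this ⊢
    rw [← h.1 (n - i) (by omega), ← h.1 (n - i + 1) (by omega), ← h.2 (n - i) (by omega)]
    exact this

lemma straightAt_shift {L n s : ℕ} {φ : Trk d} :
    StraightAt L (shiftCoins s (liftCoins φ.2)) (shiftPath s φ.1) n ↔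
      StraightAt L (liftCoins (shiftT s φ).2) (shiftT s φ).1 n := by
  simp only [StraightAt, shiftCoins, liftCoins, shiftPath, shiftT, level_sub, sub_lt_sub_iff_right,
    sub_sub_sub_cancel_right]

lemma nextS_congr {L : ℕ} {ε ε' : Coins d} {X Y : ℕ → Site d}
    (h : ∀ n, StraightAt L ε X n ↔ StraightAt L ε' Y n) (t : ℕ∞) :
    nextS L ε X t = nextS L ε' Y t := by
  unfold nextS; simp only [h]

/-- The times are determined by the events `StraightAt` and by the time `R` of the shifted paths. -/
lemma times_congr (c₅ : ℝ) {L : ℕ} {ε ε' : Coins d} {X Y : ℕ → Site d}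
    (h : ∀ n, StraightAt L ε X n ↔ StraightAt L ε' Y n)
    (hR : ∀ s, stopR c₅ (shiftPath s X) = stopR c₅ (shiftPath s Y)) (k : ℕ) :
    timeR c₅ L ε X k = timeR c₅ L ε' Y k ∧ timeS c₅ L ε X k = timeS c₅ L ε' Y k := by
  induction k with
  | zero => exact ⟨rfl, rfl⟩
  | succ k ih =>
    simp only [timeR, timeS, ih.1, nextS_congr h]
    refine ⟨?_, trivial⟩
    generalize nextS L ε' Y (timeR c₅ L ε' Y k) = s
    cases s with
    | top => rfl
    | coe s => show stopR c₅ (shiftPath s X) + _ = stopR c₅ (shiftPath s Y) + _; rw [hR]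

lemma tauOne_congr (c₅ : ℝ) {L : ℕ} {ε ε' : Coins d} {X Y : ℕ → Site d}
    (h : ∀ n, StraightAt L ε X n ↔ StraightAt L ε' Y n)
    (hR : ∀ s, stopR c₅ (shiftPath s X) = stopR c₅ (shiftPath s Y)) :
    tauOne c₅ L ε X = tauOne c₅ L ε' Y := by
  unfold tauOne
  have h1 : timeR c₅ L ε X = timeR c₅ L ε' Y := funext fun k => (times_congr c₅ h hR k).1
  have h2 : timeS c₅ L ε X = timeS c₅ L ε' Y := funext fun k => (times_congr c₅ h hR k).2
  rw [h1, h2]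

/-- The regeneration times of a marked path. -/
noncomputable def T (c₅ : ℝ) (L n : ℕ) (φ : Trk d) : ℕ∞ := tau c₅ L (liftCoins φ.2) φ.1 n

/-- The times `S_k` of a marked path. -/
noncomputable def S (c₅ : ℝ) (L k : ℕ) (φ : Trk d) : ℕ∞ := timeS c₅ L (liftCoins φ.2) φ.1 k

/-- The regeneration times read a coin only at a time and site where the walk is. The coin field can
therefore be replaced by the sequence of coins met. -/
lemma tau_eq_T (c₅ : ℝ) (L n : ℕ) (ε : Coins d) (X : ℕ → Site d) :
    tau c₅ L ε X n = T c₅ L n (X, fun i => ε (i, X i)) := by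
  unfold T
  induction n with
  | zero => rfl
  | succ n ih =>
    simp only [tau, ih]
    generalize tau c₅ L (liftCoins fun i => ε (i, X i)) X n = s
    cases s with
    | top => rfl
    | coe s =>
      show tauOne c₅ L (shiftCoins s ε) (shiftPath s X) + _ = tauOne c₅ L _ _ + _
      rw [tauOne_congr c₅ (ε := shiftCoins s ε)
        (ε' := shiftCoins s (liftCoins fun i => ε (i, X i))) (X := shiftPath s X)
        (Y := shiftPath s X) (fun n => Iff.rfl) (fun _ => rfl)]

lemma tauOne_shift (c₅ : ℝ) (L s : ℕ) (φ : Trk d) :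
    tauOne c₅ L (shiftCoins s (liftCoins φ.2)) (shiftPath s φ.1) =
      tauOne c₅ L (liftCoins (shiftT s φ).2) (shiftT s φ).1 := by
  refine tauOne_congr c₅ (fun n => straightAt_shift) fun t => stopR_congr c₅ fun i => ?_
  simp [shiftPath, shiftT, level_sub]

lemma T_zero (c₅ : ℝ) (L : ℕ) (φ : Trk d) : T c₅ L 0 φ = 0 := rfl

lemma T_one (c₅ : ℝ) (L : ℕ) (φ : Trk d) :
    T c₅ L 1 φ = tauOne c₅ L (liftCoins φ.2) φ.1 := by
  show tauOne c₅ L (shiftCoins 0 _) (shiftPath 0 _) + ((0 : ℕ) : ℕ∞) = _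
  rw [Nat.cast_zero, add_zero]
  congr 1
  · funext p; simp [shiftCoins]
  · funext i; simp [shiftPath]

lemma T_succ {c₅ : ℝ} {L n s : ℕ} {φ : Trk d} (h : T c₅ L n φ = s) :
    T c₅ L (n + 1) φ = T c₅ L 1 (shiftT s φ) + s := by
  rw [T_one, ← tauOne_shift]
  unfold T at h ⊢
  simp only [tau, h]
  rfl

lemma T_succ_top {c₅ : ℝ} {L n : ℕ} {φ : Trk d} (h : T c₅ L n φ = ⊤) :
    T c₅ L (n + 1) φ = ⊤ := by
  unfold T at h ⊢
  simp only [tau, h]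
  rfl

lemma T_add {c₅ : ℝ} {L m s : ℕ} {φ : Trk d} (h : T c₅ L m φ = s) (k : ℕ) :
    T c₅ L (m + k) φ = T c₅ L k (shiftT s φ) + s := by
  induction k with
  | zero => simp [T_zero, h]
  | succ k ih =>
    cases hk : T c₅ L k (shiftT s φ) with
    | top =>
      rw [hk, top_add] at ih
      rw [← add_assoc, T_succ_top ih, T_succ_top hk, top_add]
    | coe u =>
      rw [hk] at ih
      have ih' : T c₅ L (m + k) φ = ((u + s : ℕ) : ℕ∞) := by rw [ih]; push_cast; rfl
      rw [← add_assoc, T_succ ih', T_succ hk, shiftT_shiftT]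
      push_cast; ring

lemma T_lt_top_of_le {c₅ : ℝ} {L m n : ℕ} {φ : Trk d} (hmn : m ≤ n) (h : T c₅ L n φ ≠ ⊤) :
    T c₅ L m φ ≠ ⊤ := by
  induction n, hmn using Nat.le_induction with
  | base => exact h
  | succ n hmn ih => exact ih fun h' => h (T_succ_top h')

/-! ### The times `S_k`, `R_k` are stopping times -/

lemma lt_stopR_agree {c₅ : ℝ} {N : ℕ} {φ ψ : Trk d} (h : AgreeTo N φ ψ) :
    (N : ℕ∞) < stopR c₅ φ.1 ↔ (N : ℕ∞) < stopR c₅ ψ.1 :=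
  lt_stopR_congr c₅ N fun i hi => by rw [h.1 i hi, h.1 0 (Nat.zero_le _)]

lemma stopR_agree {c₅ : ℝ} {u : ℕ} {φ ψ : Trk d} (h : AgreeTo u φ ψ) (hu : stopR c₅ φ.1 = u) :
    stopR c₅ ψ.1 = u :=
  enat_eq_of_lt_iff u hu fun _ hN => lt_stopR_agree (h.mono hN)

lemma nextS_agree {L t m : ℕ} {φ ψ : Trk d} (h : AgreeTo t φ ψ) {s : ℕ∞} (hm : m ≤ t)
    (hS : nextS L (liftCoins φ.2) φ.1 s = m) : nextS L (liftCoins ψ.2) ψ.1 s = m := by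
  unfold nextS at hS ⊢
  rw [firstTime_eq_coe_iff] at hS ⊢
  refine ⟨⟨hS.1.1, (straightAt_congr h hm).mp hS.1.2⟩, fun n hn hp => hS.2 n hn ⟨hp.1, ?_⟩⟩
  exact (straightAt_congr h (by omega)).mpr hp.2

lemma le_nextS {L m : ℕ} {ε : Coins d} {X : ℕ → Site d} {s : ℕ∞} (h : nextS L ε X s = m) :
    s ≤ m := ((firstTime_eq_coe_iff _ _).mp h).1.1

/-- The induction is joint: `S_{k+1}` is searched for from `R_k` on, and `R_{k+1}` is `R` restarted
at `S_{k+1}`. Only values at most `t` are claimed to carry over, since later ones depend on the path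
beyond `t`. -/
lemma times_agree {c₅ : ℝ} {L t : ℕ} {φ ψ : Trk d} (h : AgreeTo t φ ψ) (k : ℕ) :
    (∀ m ≤ t, timeR c₅ L (liftCoins φ.2) φ.1 k = m → timeR c₅ L (liftCoins ψ.2) ψ.1 k = m) ∧
    (∀ m ≤ t, S c₅ L k φ = m → S c₅ L k ψ = m) := by
  unfold S
  induction k with
  | zero => exact ⟨fun m _ hm => hm, fun m _ hm => hm⟩
  | succ k ih =>
    have hS : ∀ m ≤ t, timeS c₅ L (liftCoins φ.2) φ.1 (k + 1) = m →
        timeS c₅ L (liftCoins ψ.2) ψ.1 (k + 1) = m := by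
      intro m hm hSm
      simp only [timeS] at hSm ⊢
      have hle := le_nextS hSm
      obtain ⟨a, ha⟩ := ENat.ne_top_iff_exists.mp (ne_top_of_le_ne_top (ENat.natCast_ne_top m) hle)
      rw [← ha] at hle hSm
      have hle' : a ≤ m := by exact_mod_cast hle
      rw [ih.1 a (by omega) ha.symm]
      exact nextS_agree h hm hSm
    refine ⟨fun m hm hRm => ?_, hS⟩
    simp only [timeR] at hRm ⊢
    cases hs : nextS L (liftCoins φ.2) φ.1 (timeR c₅ L (liftCoins φ.2) φ.1 k) with
    | top => rw [hs] at hRm; exact absurd hRm.symm (ENat.natCast_ne_top m)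
    | coe s =>
      rw [hs] at hRm
      have e1 : stopR c₅ (shiftPath s φ.1) + s = (m : ℕ∞) := hRm
      rw [stopR_shiftPath] at e1
      obtain ⟨u, hu⟩ : ∃ u : ℕ, stopR c₅ (shiftT s φ).1 = u := by
        refine (ENat.ne_top_iff_exists.mp fun htop => ?_).imp fun _ h => h.symm
        rw [htop, top_add] at e1
        exact ENat.natCast_ne_top m e1.symm
      rw [hu] at e1
      have e2 : u + s = m := by exact_mod_cast e1
      have hs' := hS s (by omega) hs
      simp only [timeS] at hs'
      rw [hs']
      show stopR c₅ (shiftPath s ψ.1) + s = (m : ℕ∞)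
      rw [stopR_shiftPath, stopR_agree (φ := shiftT s φ) (h.mono (by omega : u + s ≤ t)).shift hu]
      exact_mod_cast e2

lemma S_agree {c₅ : ℝ} {L t k : ℕ} {φ ψ : Trk d} (h : AgreeTo t φ ψ) :
    S c₅ L k φ = t ↔ S c₅ L k ψ = t :=
  ⟨(times_agree h k).2 t le_rfl, (times_agree h.symm k).2 t le_rfl⟩

lemma timeR_succ_eq_top_iff {c₅ : ℝ} {L k t : ℕ} {φ : Trk d} (h : S c₅ L (k + 1) φ = t) :
    timeR c₅ L (liftCoins φ.2) φ.1 (k + 1) = ⊤ ↔ shiftT t φ ∈ good c₅ := by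
  simp only [S, timeS] at h
  simp only [timeR, h]
  show stopR c₅ (shiftPath t φ.1) + t = (⊤ : ℕ∞) ↔ stopR c₅ (shiftT t φ).1 = ⊤
  rw [stopR_shiftPath]
  simp

lemma nextS_top {L : ℕ} {ε : Coins d} {X : ℕ → Site d} : nextS L ε X ⊤ = ⊤ := by
  unfold nextS
  rw [firstTime_eq_top_iff]
  rintro n ⟨h, -⟩
  exact ENat.natCast_ne_top n (top_le_iff.mp h)

lemma timeR_succ_of_top {c₅ : ℝ} {L k : ℕ} {ε : Coins d} {X : ℕ → Site d}
    (h : timeR c₅ L ε X k = ⊤) : timeR c₅ L ε X (k + 1) = ⊤ := by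
  simp only [timeR, h, nextS_top]
  rfl

lemma timeR_top_of_le {c₅ : ℝ} {L k l : ℕ} {ε : Coins d} {X : ℕ → Site d} (hkl : k ≤ l)
    (h : timeR c₅ L ε X k = ⊤) : timeR c₅ L ε X l = ⊤ := by
  induction l, hkl using Nat.le_induction with
  | base => exact h
  | succ n hmn ih => exact timeR_succ_of_top ih

lemma S_top_of_lt {c₅ : ℝ} {L k l : ℕ} {φ : Trk d} (hkl : k < l)
    (h : timeR c₅ L (liftCoins φ.2) φ.1 k = ⊤) : S c₅ L l φ = ⊤ := by
  obtain ⟨l, rfl⟩ : ∃ l', l = l' + 1 := ⟨l - 1, by omega⟩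
  simp only [S, timeS, timeR_top_of_le (by omega : k ≤ l) h, nextS_top]

/-- `τ_1 = t` if and only if `t` is one of the times `S_k` and `R ∘ θ_t = ∞`. -/
lemma T_one_eq_iff {c₅ : ℝ} {L t : ℕ} {φ : Trk d} :
    T c₅ L 1 φ = t ↔ (∃ k, S c₅ L (k + 1) φ = t) ∧ shiftT t φ ∈ good c₅ := by
  classical
  rw [T_one]
  unfold tauOne
  constructor
  · intro h
    split_ifs at h with hex
    · obtain ⟨h1, h2, h3⟩ := Nat.find_spec hex
      obtain ⟨k, hk⟩ : ∃ k, Nat.find hex = k + 1 := ⟨Nat.find hex - 1, by omega⟩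
      rw [hk] at h h3
      exact ⟨⟨k, h⟩, (timeR_succ_eq_top_iff h).mp h3⟩
    · exact absurd h.symm (ENat.natCast_ne_top t)
  · rintro ⟨⟨k, hk⟩, hg⟩
    have hR := (timeR_succ_eq_top_iff hk).mpr hg
    have hex : ∃ k, 1 ≤ k ∧ timeS c₅ L (liftCoins φ.2) φ.1 k < ⊤ ∧
        timeR c₅ L (liftCoins φ.2) φ.1 k = ⊤ := by
      refine ⟨k + 1, by omega, ?_, hR⟩
      have : timeS c₅ L (liftCoins φ.2) φ.1 (k + 1) = t := hk
      rw [this]; exact ENat.natCast_lt_top t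
    rw [dif_pos hex]
    have hle : Nat.find hex ≤ k + 1 := by
      refine Nat.find_min' hex ⟨by omega, ?_, hR⟩
      have : timeS c₅ L (liftCoins φ.2) φ.1 (k + 1) = t := hk
      rw [this]; exact ENat.natCast_lt_top t
    obtain ⟨h1, h2, h3⟩ := Nat.find_spec hex
    -- An infinite `R_j` makes all later `S` infinite, so no smaller index can qualify while
    -- `S_{k+1}` is finite.
    have heq : Nat.find hex = k + 1 := by
      by_contra hne
      have := S_top_of_lt (lt_of_le_of_ne hle hne) h3
      rw [hk] at this
      exact ENat.natCast_ne_top t this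
    rw [heq]; exact hk

lemma S_straightAt {c₅ : ℝ} {L k t : ℕ} {φ : Trk d} (h : S c₅ L (k + 1) φ = t) :
    StraightAt L (liftCoins φ.2) φ.1 t :=
  ((firstTime_eq_coe_iff _ _).mp h).1.2

lemma T_one_straightAt {c₅ : ℝ} {L t : ℕ} {φ : Trk d} (h : T c₅ L 1 φ = t) :
    StraightAt L (liftCoins φ.2) φ.1 t := by
  obtain ⟨⟨k, hk⟩, -⟩ := T_one_eq_iff.mp h
  exact S_straightAt hk

/-! ### Geometry of straight pieces -/

lemma StraightAt.pos {L n : ℕ} {φ : Trk d} (h : StraightAt L (liftCoins φ.2) φ.1 n) :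
    ∀ i ≤ L, φ.1 (n - L + i) = φ.1 (n - L) + i • e1 := by
  intro i hi
  induction i with
  | zero => simp
  | succ i ih =>
    have h3 := (h.2.2 (L - i) (by omega) (by omega)).2
    have hn := h.1
    rw [show n - (L - i) = n - L + i by omega] at h3
    have h4 := ih (by omega)
    rw [← add_assoc, eq_add_of_sub_eq h3, h4, succ_nsmul]
    abel

lemma StraightAt.level_eq {L n : ℕ} {φ : Trk d} (h : StraightAt L (liftCoins φ.2) φ.1 n)
    {i : ℕ} (hi : i ≤ L) : level (φ.1 (n - L + i)) = level (φ.1 (n - L)) + i := by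
  rw [h.pos i hi, level_add]
  simp [level, e1]

lemma StraightAt.level_end {L n : ℕ} {φ : Trk d} (h : StraightAt L (liftCoins φ.2) φ.1 n) :
    level (φ.1 n) = level (φ.1 (n - L)) + L := by
  have := h.level_eq le_rfl
  rwa [Nat.sub_add_cancel h.1] at this

lemma StraightAt.level_le {L n : ℕ} {φ : Trk d} (h : StraightAt L (liftCoins φ.2) φ.1 n)
    {i : ℕ} (hi : i ≤ n - L) : level (φ.1 i) ≤ level (φ.1 n) - L := by
  rw [h.level_end]
  rcases hi.lt_or_eq with hi | rfl
  · have := h.2.1 i hi; linarith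
  · linarith

lemma StraightAt.record {L n : ℕ} {φ : Trk d} (h : StraightAt L (liftCoins φ.2) φ.1 n) :
    ∀ i < n, level (φ.1 i) < level (φ.1 n) := by
  intro i hi
  rw [h.level_end]
  have hn := h.1
  rcases lt_or_ge i (n - L) with h1 | h1
  · have := h.2.1 i h1; linarith
  · have := h.level_eq (i := i - (n - L)) (by omega)
    rw [show n - L + (i - (n - L)) = i by omega] at this
    rw [this]
    have : i - (n - L) < L := by omega
    have : ((i - (n - L) : ℕ) : ℤ) < L := by exact_mod_cast this
    linarith

/-! ### Determination of the regeneration structure by a finite piece of the path -/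

lemma good_shift_of_T {c₅ : ℝ} {L n s : ℕ} {φ : Trk d} (hg : φ ∈ good c₅)
    (h : T c₅ L n φ = s) : shiftT s φ ∈ good c₅ := by
  cases n with
  | zero =>
    rw [T_zero] at h
    have : s = 0 := by exact_mod_cast h.symm
    subst this
    exact shiftT_zero_mem_good.mpr hg
  | succ n =>
    obtain ⟨a, ha⟩ := ENat.ne_top_iff_exists.mp
      (T_lt_top_of_le (Nat.le_succ n) (h ▸ ENat.natCast_ne_top s : T c₅ L (n + 1) φ ≠ ⊤))
    rw [T_succ ha.symm] at h
    obtain ⟨w, hw⟩ : ∃ w : ℕ, T c₅ L 1 (shiftT a φ) = w := by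
      refine (ENat.ne_top_iff_exists.mp fun htop => ?_).imp fun _ h => h.symm
      rw [htop, top_add] at h
      exact ENat.natCast_ne_top s h.symm
    rw [hw] at h
    have : w + a = s := by exact_mod_cast h
    subst this
    rw [← shiftT_shiftT]
    exact (T_one_eq_iff.mp hw).2

lemma T_split {c₅ : ℝ} {L m n s : ℕ} {φ : Trk d} (hmn : m ≤ n) (h : T c₅ L n φ = s) :
    ∃ a w : ℕ, T c₅ L m φ = a ∧ T c₅ L (n - m) (shiftT a φ) = w ∧ w + a = s := by
  obtain ⟨a, ha⟩ := ENat.ne_top_iff_exists.mp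
    (T_lt_top_of_le hmn (h ▸ ENat.natCast_ne_top s : T c₅ L n φ ≠ ⊤))
  have h1 := T_add ha.symm (n - m)
  rw [show m + (n - m) = n by omega, h] at h1
  obtain ⟨w, hw⟩ : ∃ w : ℕ, T c₅ L (n - m) (shiftT a φ) = w := by
    refine (ENat.ne_top_iff_exists.mp fun htop => ?_).imp fun _ h => h.symm
    rw [htop, top_add] at h1
    exact ENat.natCast_ne_top s h1
  rw [hw] at h1
  exact ⟨a, w, ha.symm, hw, by exact_mod_cast h1.symm⟩

/-- That `u` is one of the times `S_k` is decided before `u`. Since `u` is then a strict record, `R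
> u` and `R ∘ θ_u = ∞` combine to `R = ∞` by `lt_stopR_concat`. -/
lemma regeneration_determined_one {c₅ : ℝ} {L u : ℕ} {φ ψ : Trk d} (hψ : ψ ∈ good c₅)
    (hT : T c₅ L 1 ψ = u) (h : AgreeTo u φ ψ) (hg : shiftT u φ ∈ good c₅) :
    φ ∈ good c₅ ∧ T c₅ L 1 φ = u := by
  obtain ⟨⟨k, hk⟩, -⟩ := T_one_eq_iff.mp hT
  have hk' : S c₅ L (k + 1) φ = u := (S_agree h).mpr hk
  refine ⟨?_, T_one_eq_iff.mpr ⟨⟨k, hk'⟩, hg⟩⟩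
  rw [mem_good_iff] at hψ hg ⊢
  intro N
  by_cases hN : N ≤ u
  · exact (lt_stopR_agree (h.mono hN)).mpr (hψ N)
  · have := lt_stopR_concat (S_straightAt hk').record ((lt_stopR_agree h).mpr (hψ u)) (hg (N - u))
    rwa [show u + (N - u) = N by omega] at this

/-- A path that follows a good path up to its `n`-th regeneration time, and is good afterwards, is
good and has the same first `n` regeneration times. -/
lemma regeneration_determined {c₅ : ℝ} {L n u : ℕ} {φ ψ : Trk d} (hψ : ψ ∈ good c₅)
    (hT : T c₅ L n ψ = u) (h : AgreeTo u φ ψ) (hg : shiftT u φ ∈ good c₅) :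
    φ ∈ good c₅ ∧ ∀ i ≤ n, T c₅ L i φ = T c₅ L i ψ := by
  induction n generalizing u with
  | zero =>
    rw [T_zero] at hT
    have : u = 0 := by exact_mod_cast hT.symm
    subst this
    refine ⟨shiftT_zero_mem_good.mp hg, fun i hi => ?_⟩
    rw [Nat.le_zero.mp hi, T_zero, T_zero]
  | succ n ih =>
    obtain ⟨a, w, ha, hw, hu⟩ := T_split (Nat.le_succ n) hT
    rw [show n.succ - n = 1 by omega] at hw
    subst hu
    rw [← shiftT_shiftT] at hg
    have h1 := regeneration_determined_one (good_shift_of_T hψ ha) hw h.shift hg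
    have h2 := ih ha (h.mono (by omega)) h1.1
    refine ⟨h2.1, fun i hi => ?_⟩
    rcases Nat.lt_or_eq_of_le hi with hi | rfl
    · exact h2.2 i (by omega)
    · have ha' : T c₅ L n φ = a := (h2.2 n le_rfl).trans ha
      rw [T_succ ha', T_succ ha, h1.2, hw]

end

/-! ### Cylinder probabilities of the chains -/

section chain
variable {d : ℕ} {Θ : Type*} [MeasurableSpace Θ] [MeasurableSingletonClass Θ]
  (κ : ℕ → Kernel (Θ × Site d) (Site d)) [∀ n, IsMarkovKernel (κ n)]

lemma extendKernel_apply_prod (n : ℕ) (h : ∀ _ : Finset.Iic n, Θ × Site d) {A : Set Θ}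
    {B : Set (Site d)} (hA : MeasurableSet A) :
    extendKernel κ n h (A ×ˢ B) =
      A.indicator 1 (h ⟨n, Finset.mem_Iic.mpr le_rfl⟩).1 *
        κ n (h ⟨n, Finset.mem_Iic.mpr le_rfl⟩) B := by
  unfold extendKernel
  rw [Kernel.comap_apply, Kernel.prod_apply_prod, Kernel.deterministic_apply' _ _ hA]
  rfl

lemma traj_succ_apply (x₀ : ∀ _ : Finset.Iic 0, Θ × Site d) (t : ℕ)
    {A : Set (∀ _ : Finset.Iic t, Θ × Site d)} {B : Set (Θ × Site d)} (hA : MeasurableSet A)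
    (hB : MeasurableSet B) :
    Kernel.traj (X := fun _ => Θ × Site d) (extendKernel κ) 0 x₀
        {h | Preorder.frestrictLe t h ∈ A ∧ h (t + 1) ∈ B} =
      ∫⁻ h in {h | Preorder.frestrictLe t h ∈ A}, extendKernel κ t (Preorder.frestrictLe t h) B
        ∂(Kernel.traj (X := fun _ => Θ × Site d) (extendKernel κ) 0 x₀) := by
  have key := Kernel.partialTraj_compProd_eq_map_traj (X := fun _ => Θ × Site d)
    (κ := extendKernel κ) (Nat.zero_le t) (x₀ := x₀)
  rw [← Kernel.traj_map_frestrictLe_apply] at key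
  have h1 := congrArg (fun m => m (A ×ˢ B)) key
  have hm : Measurable (Preorder.frestrictLe (π := fun _ : ℕ => Θ × Site d) t) := by fun_prop
  rw [Measure.map_apply (by fun_prop) (hA.prod hB), Measure.compProd_apply_prod hA hB,
    setLIntegral_map hA (Kernel.measurable_coe _ hB) hm] at h1
  exact h1.symm

lemma traj_ae_zero (x₀ : ∀ _ : Finset.Iic 0, Θ × Site d)
    {A : Set (Θ × Site d)} (hA : MeasurableSet A) :
    Kernel.traj (X := fun _ => Θ × Site d) (extendKernel κ) 0 x₀ {h | h 0 ∈ A} =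
      A.indicator 1 (x₀ ⟨0, Finset.mem_Iic.mpr le_rfl⟩) := by
  have h1 := Kernel.traj_map_frestrictLe_apply (X := fun _ => Θ × Site d)
    (κ := extendKernel κ) 0 0 x₀
  have hm : Measurable (Preorder.frestrictLe (π := fun _ : ℕ => Θ × Site d) 0) := by fun_prop
  rw [Kernel.partialTraj_self, Kernel.id_apply] at h1
  have hA' : MeasurableSet {h : ∀ _ : Finset.Iic 0, Θ × Site d |
      h ⟨0, Finset.mem_Iic.mpr le_rfl⟩ ∈ A} := measurable_pi_apply _ hA
  have h2 := congrArg (fun m => m {h : ∀ _ : Finset.Iic 0, Θ × Site d |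
      h ⟨0, Finset.mem_Iic.mpr le_rfl⟩ ∈ A}) h1
  rw [Measure.map_apply hm hA', Measure.dirac_apply' _ hA'] at h2
  exact h2

/-- The trajectory carries a copy of the parameter at each time and the one-step kernel reads the
current copy. Replacing it by `θ` requires that the copies never change. -/
lemma traj_param (θ : Θ) (x : Site d) (n : ℕ) :
    ∀ᵐ h ∂(Kernel.traj (X := fun _ => Θ × Site d) (extendKernel κ) 0 fun _ => (θ, x)),
      (h n).1 = θ := by
  have hθ : MeasurableSet ({θ}ᶜ : Set Θ) := (measurableSet_singleton θ).compl
  have e : ∀ n, {h : ℕ → Θ × Site d | ¬ (h n).1 = θ} = {h | h n ∈ ({θ}ᶜ : Set Θ) ×ˢ Set.univ} := by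
    intro n; ext h; simp
  induction n with
  | zero =>
    rw [ae_iff, e, traj_ae_zero κ _ (hθ.prod MeasurableSet.univ)]
    simp
  | succ n ih =>
    rw [ae_iff, e]
    have h1 := traj_succ_apply κ (fun _ => (θ, x)) n (A := Set.univ) MeasurableSet.univ
      (hθ.prod MeasurableSet.univ)
    simp only [Set.mem_univ, true_and] at h1
    rw [h1]
    simp only [Set.ofPred_true, Measure.restrict_univ]
    rw [lintegral_eq_zero_iff' (by
      refine Measurable.aemeasurable ?_
      exact (Kernel.measurable_coe _ (hθ.prod MeasurableSet.univ)).comp (by fun_prop))]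
    filter_upwards [ih] with h hh
    rw [extendKernel_apply_prod κ n _ hθ]
    simp [Preorder.frestrictLe, hh]

-- Induction on `t`: given a history that has followed `y`, the pair at time `t` is almost surely
-- `(θ, y t)`, so the next step contributes the constant factor `κ t (θ, y t) {y (t + 1)}`.
open Classical in
lemma chainKernel_cylinder (θ : Θ) (x : Site d) (y : ℕ → Site d) (t : ℕ) :
    chainKernel κ (θ, x) {X | ∀ i ≤ t, X i = y i} =
      (if y 0 = x then 1 else 0) * ∏ i ∈ Finset.range t, κ i (θ, y i) {y (i + 1)} := by
  have hm2 : Measurable fun (h : ℕ → Θ × Site d) (n : ℕ) => (h n).2 :=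
    measurable_pi_lambda _ fun n => measurable_snd.comp (measurable_pi_apply n)
  have hcyl : ∀ t, MeasurableSet {X : ℕ → Site d | ∀ i ≤ t, X i = y i} := by
    intro t
    have : {X : ℕ → Site d | ∀ i ≤ t, X i = y i} = ⋂ i, ⋂ _ : i ≤ t, {X | X i = y i} := by
      ext X; simp
    rw [this]
    exact MeasurableSet.iInter fun i => MeasurableSet.iInter fun _ =>
      measurableSet_eq_fun (measurable_pi_apply i) measurable_const
  have hred : ∀ t, chainKernel κ (θ, x) {X | ∀ i ≤ t, X i = y i} =
      Kernel.traj (X := fun _ => Θ × Site d) (extendKernel κ) 0 (fun _ => (θ, x))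
        {h | ∀ i ≤ t, (h i).2 = y i} := by
    intro t
    unfold chainKernel
    rw [Kernel.map_apply _ hm2, Measure.map_apply hm2 (hcyl t)]
    rfl
  rw [hred]
  induction t with
  | zero =>
    have e : {h : ℕ → Θ × Site d | ∀ i ≤ 0, (h i).2 = y i} =
        {h | h 0 ∈ (Set.univ : Set Θ) ×ˢ ({y 0} : Set (Site d))} := by ext h; simp
    rw [e, traj_ae_zero κ _ (MeasurableSet.univ.prod (measurableSet_singleton _))]
    by_cases hx : y 0 = x
    · simp [hx]
    · simp [hx, Ne.symm hx]
  | succ t ih =>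
    have e : {h : ℕ → Θ × Site d | ∀ i ≤ t + 1, (h i).2 = y i} =
        {h | Preorder.frestrictLe (π := fun _ : ℕ => Θ × Site d) t h ∈
            {g | ∀ i : Finset.Iic t, (g i).2 = y i} ∧
          h (t + 1) ∈ (Set.univ : Set Θ) ×ˢ ({y (t + 1)} : Set (Site d))} := by
      ext h
      simp only [Set.mem_ofPred_eq, Set.mem_prod, Set.mem_univ, true_and,
        Set.mem_singleton_iff]
      constructor
      · intro hh
        exact ⟨fun i => hh i ((Finset.mem_Iic.mp i.2).trans (Nat.le_succ t)), hh _ le_rfl⟩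
      · rintro ⟨h1, h2⟩ i hi
        rcases Nat.lt_or_eq_of_le hi with hi | rfl
        · exact h1 ⟨i, Finset.mem_Iic.mpr (by omega)⟩
        · exact h2
    have e' : {h : ℕ → Θ × Site d | Preorder.frestrictLe (π := fun _ : ℕ => Θ × Site d) t h ∈
            {g | ∀ i : Finset.Iic t, (g i).2 = y i}} = {h | ∀ i ≤ t, (h i).2 = y i} := by
      ext h
      exact ⟨fun h1 i hi => h1 ⟨i, Finset.mem_Iic.mpr hi⟩,
        fun h1 i => h1 i (Finset.mem_Iic.mp i.2)⟩
    have hA : MeasurableSet {g : ∀ _ : Finset.Iic t, Θ × Site d |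
        ∀ i : Finset.Iic t, (g i).2 = y i} := by
      rw [Set.ofPred_forall]
      exact MeasurableSet.iInter fun i =>
        (measurable_snd.comp (measurable_pi_apply i)) (measurableSet_singleton _)
    rw [e, traj_succ_apply κ _ t hA (MeasurableSet.univ.prod (measurableSet_singleton _)), e',
      Finset.prod_range_succ, ← mul_assoc, ← ih]
    have hS : MeasurableSet {h : ℕ → Θ × Site d | ∀ i ≤ t, (h i).2 = y i} := hm2 (hcyl t)
    rw [setLIntegral_congr_fun_ae (g := fun _ => κ t (θ, y t) {y (t + 1)}) hS,
      setLIntegral_const, mul_comm]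
    filter_upwards [traj_param κ θ x t] with h hh hmem
    rw [extendKernel_apply_prod κ t _ MeasurableSet.univ]
    have h2 : (h t).2 = y t := hmem t le_rfl
    have h3 : h t = (θ, y t) := Prod.ext hh h2
    simp [Preorder.frestrictLe, h3]

end chain

/-! ### The law of the marked path -/

section marked
variable {d : ℕ} [NeZero d]

/-- The marked path of a path among coins. -/
def marks (p : Coins d × (ℕ → Site d)) : Trk d := (p.2, fun n => p.1 (n, p.2 n))

lemma measurable_marks : Measurable (marks (d := d)) := by
  refine measurable_snd.prodMk (measurable_pi_lambda _ fun n => ?_)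
  have h : Measurable fun a : Coins d × Site d => a.1 (n, a.2) :=
    measurable_from_prod_countable_left fun x => measurable_pi_apply (n, x)
  exact h.comp (measurable_fst.prodMk ((measurable_pi_apply n).comp measurable_snd))

/-- The law of the marked path of the walk with coins started at the origin, given the
environment. -/
noncomputable def markedKernel (κ : EllConst d) : Kernel (Env d) (Trk d) :=
  ((Kernel.const (Env d) (coinsLaw κ)) ⊗ₖ
    ((quenchedCoins κ).comap (fun p : Env d × Coins d => (p, (0 : Site d)))
      (measurable_id.prodMk measurable_const))).map marks

instance instMarkovMarkedKernel (κ : EllConst d) : IsMarkovKernel (markedKernel κ) := by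
  unfold markedKernel
  exact Kernel.IsMarkovKernel.map _ measurable_marks

lemma lintegral_annealedCoins (P : Measure (Env d)) [IsProbabilityMeasure P] (κ : EllConst d)
    {f : Env d × Trk d → ℝ≥0∞} (hf : Measurable f) :
    ∫⁻ z, f (z.1.1, marks (z.1.2, z.2)) ∂(annealedCoins P κ) =
      ∫⁻ ω, ∫⁻ φ, f (ω, φ) ∂(markedKernel κ ω) ∂P := by
  have hg : Measurable fun z : Triple d => f (z.1.1, marks (z.1.2, z.2)) :=
    hf.comp ((measurable_fst.comp measurable_fst).prodMk
      (measurable_marks.comp ((measurable_snd.comp measurable_fst).prodMk measurable_snd)))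
  unfold annealedCoins
  rw [Measure.lintegral_compProd hg, lintegral_prod _
    (Measurable.aemeasurable (by exact hg.lintegral_kernel_prod_right'))]
  refine lintegral_congr fun ω => ?_
  have hfω : Measurable fun φ : Trk d => f (ω, φ) := hf.comp measurable_prodMk_left
  unfold markedKernel
  rw [Kernel.lintegral_map _ measurable_marks _ hfω]
  have hc := Kernel.lintegral_compProd (Kernel.const (Env d) (coinsLaw κ))
    ((quenchedCoins κ).comap (fun p : Env d × Coins d => (p, (0 : Site d)))
      (measurable_id.prodMk measurable_const)) ω (hfω.comp measurable_marks)
  exact hc.symm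

/-- The marked paths that agree with `ψ` up to time `t`. -/
def Cyl (t : ℕ) (ψ : Trk d) : Set (Trk d) := {φ | AgreeTo t φ ψ}

lemma measurableSet_Cyl (t : ℕ) (ψ : Trk d) : MeasurableSet (Cyl t ψ) := by
  have : Cyl t ψ = (⋂ i, ⋂ _ : i ≤ t, {φ | φ.1 i = ψ.1 i}) ∩
      ⋂ i, ⋂ _ : i < t, {φ | φ.2 i = ψ.2 i} := by
    ext φ; simp [Cyl, AgreeTo]
  rw [this]
  refine MeasurableSet.inter ?_ ?_
  · exact MeasurableSet.iInter fun i => MeasurableSet.iInter fun _ =>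
      measurableSet_eq_fun ((measurable_pi_apply i).comp measurable_fst) measurable_const
  · exact MeasurableSet.iInter fun i => MeasurableSet.iInter fun _ =>
      measurableSet_eq_fun ((measurable_pi_apply i).comp measurable_snd) measurable_const

/-- The probability, given the environment, of following the path of `ψ` up to time `t` while
meeting the coins of `ψ`. -/
noncomputable def wt (κ : EllConst d) (ω : Env d) (t : ℕ) (ψ : Trk d) : ℝ≥0∞ :=
  ∏ i ∈ Finset.range t, (coinLaw κ {ψ.2 i} *
    stepMeasure (coinStep κ (ψ.2 i) (ω (ψ.1 i))) (ψ.1 i) {ψ.1 (i + 1)})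

/-- Coins met at different times carry different time indices, even when the path returns to a site,
hence they are independent. -/
lemma coinsLaw_cylinder (κ : EllConst d) (t : ℕ) (ψ : Trk d) :
    coinsLaw κ {ε | ∀ i < t, ε (i, ψ.1 i) = ψ.2 i} =
      ∏ i ∈ Finset.range t, coinLaw κ {ψ.2 i} := by
  classical
  set s : Finset (ℕ × Site d) := (Finset.range t).image fun i => (i, ψ.1 i)
  have e : {ε : Coins d | ∀ i < t, ε (i, ψ.1 i) = ψ.2 i} =
      Set.pi s fun p => {ψ.2 p.1} := by
    ext ε
    simp [s, Set.mem_pi]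
  rw [e, coinsLaw, Measure.infinitePi_pi _ (fun p _ => measurableSet_singleton _),
    Finset.prod_image]
  intro i _ j _ hij
  exact (Prod.ext_iff.mp hij).1

-- On the cylinder the chain reads exactly the coins prescribed by `ψ`. Given those coins the path
-- probability is a constant, and averaging over the coins multiplies it by their probability.
open Classical in
lemma markedKernel_Cyl (κ : EllConst d) (ω : Env d) (t : ℕ) (ψ : Trk d) :
    markedKernel κ ω (Cyl t ψ) = if ψ.1 0 = 0 then wt κ ω t ψ else 0 := by
  unfold markedKernel
  rw [Kernel.map_apply' _ measurable_marks _ (measurableSet_Cyl t ψ),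
    Kernel.compProd_apply (measurable_marks (measurableSet_Cyl t ψ))]
  have hE : MeasurableSet {ε : Coins d | ∀ i < t, ε (i, ψ.1 i) = ψ.2 i} := by
    have : {ε : Coins d | ∀ i < t, ε (i, ψ.1 i) = ψ.2 i} =
        ⋂ i, ⋂ _ : i < t, {ε | ε (i, ψ.1 i) = ψ.2 i} := by ext; simp
    rw [this]
    exact MeasurableSet.iInter fun i => MeasurableSet.iInter fun _ =>
      measurableSet_eq_fun (measurable_pi_apply _) measurable_const
  set c : ℝ≥0∞ := (if ψ.1 0 = 0 then 1 else 0) * ∏ i ∈ Finset.range t,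
    stepMeasure (coinStep κ (ψ.2 i) (ω (ψ.1 i))) (ψ.1 i) {ψ.1 (i + 1)} with hc
  have hval : ∀ ε : Coins d, (quenchedCoins κ).comap (fun p : Env d × Coins d => (p, (0 : Site d)))
      (measurable_id.prodMk measurable_const) (ω, ε)
        (Prod.mk ε ⁻¹' (marks ⁻¹' (Cyl t ψ))) =
      {ε : Coins d | ∀ i < t, ε (i, ψ.1 i) = ψ.2 i}.indicator (fun _ => c) ε := by
    intro ε
    rw [Kernel.comap_apply]
    by_cases hε : ∀ i < t, ε (i, ψ.1 i) = ψ.2 i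
    · rw [Set.indicator_of_mem (by exact hε)]
      have e : Prod.mk ε ⁻¹' (marks ⁻¹' (Cyl t ψ)) = {X | ∀ i ≤ t, X i = ψ.1 i} := by
        ext X
        simp only [Cyl, AgreeTo, marks, Set.mem_preimage, Set.mem_ofPred_eq]
        refine ⟨fun h => h.1, fun h => ⟨h, fun i hi => ?_⟩⟩
        rw [h i hi.le, hε i hi]
      rw [e]
      unfold quenchedCoins
      rw [chainKernel_cylinder, hc]
      congr 1
      refine Finset.prod_congr rfl fun i hi => ?_
      rw [← hε i (Finset.mem_range.mp hi)]
      rfl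
    · rw [Set.indicator_of_notMem (by exact hε)]
      have e : Prod.mk ε ⁻¹' (marks ⁻¹' (Cyl t ψ)) = ∅ := by
        ext X
        simp only [Cyl, AgreeTo, marks, Set.mem_preimage, Set.mem_ofPred_eq,
          Set.mem_empty_iff_false, iff_false]
        rintro ⟨h1, h2⟩
        refine hε fun i hi => ?_
        rw [← h2 i hi, h1 i hi.le]
      rw [e, measure_empty]
  rw [lintegral_congr hval, lintegral_indicator hE, setLIntegral_const, Kernel.const_apply,
    coinsLaw_cylinder, hc, wt, Finset.prod_mul_distrib]
  split_ifs <;> ring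

end marked

/-! ### Finite pieces of marked paths -/

/-- The data of a marked path up to time `t`. -/
abbrev Dat (d t : ℕ) : Type := (Fin (t + 1) → Site d) × (Fin t → Bool)

/-- The data up to time `t` of a marked path. -/
def proj {d : ℕ} (t : ℕ) (φ : Trk d) : Dat d t := (fun i => φ.1 i, fun i => φ.2 i)

/-- A marked path with given data up to time `t`. -/
def extend {d t : ℕ} (D : Dat d t) : Trk d :=
  (fun i => if h : i < t + 1 then D.1 ⟨i, h⟩ else 0,
    fun i => if h : i < t then D.2 ⟨i, h⟩ else false)

section
variable {d : ℕ} [NeZero d]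

lemma agreeTo_iff_proj {t : ℕ} {φ ψ : Trk d} : AgreeTo t φ ψ ↔ proj t φ = proj t ψ := by
  constructor
  · rintro ⟨h1, h2⟩
    exact Prod.ext (funext fun i => h1 i (by omega)) (funext fun i => h2 i i.2)
  · intro h
    have h1 := congrArg Prod.fst h
    have h2 := congrArg Prod.snd h
    exact ⟨fun i hi => congrFun h1 ⟨i, by omega⟩, fun i hi => congrFun h2 ⟨i, hi⟩⟩

lemma proj_extend {t : ℕ} (D : Dat d t) : proj t (extend D) = D := by
  refine Prod.ext (funext fun i => ?_) (funext fun i => ?_)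
  · simp only [proj, extend, dif_pos i.2]
  · simp only [proj, extend, dif_pos i.2]

lemma Cyl_eq_preimage {t : ℕ} (ψ : Trk d) : Cyl t ψ = proj t ⁻¹' {proj t ψ} := by
  ext φ
  exact agreeTo_iff_proj

lemma Cyl_congr {t : ℕ} {φ ψ : Trk d} (h : AgreeTo t φ ψ) : Cyl t φ = Cyl t ψ := by
  rw [Cyl_eq_preimage, Cyl_eq_preimage, agreeTo_iff_proj.mp h]

lemma iUnion_Cyl (t : ℕ) : ⋃ D : Dat d t, Cyl t (extend D) = Set.univ := by
  refine Set.eq_univ_of_forall fun φ => Set.mem_iUnion.mpr ⟨proj t φ, ?_⟩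
  exact agreeTo_iff_proj.mpr (proj_extend _).symm

lemma pairwise_disjoint_Cyl (t : ℕ) :
    Pairwise (Function.onFun Disjoint fun D : Dat d t => Cyl t (extend D)) := by
  intro D D' hD
  refine Set.disjoint_left.mpr fun φ h h' => hD ?_
  have h1 := agreeTo_iff_proj.mp h
  have h2 := agreeTo_iff_proj.mp h'
  rw [proj_extend] at h1 h2
  exact h1.symm.trans h2

lemma lintegral_eq_tsum_Cyl (t : ℕ) (μ : Measure (Trk d)) (f : Trk d → ℝ≥0∞) :
    ∫⁻ φ, f φ ∂μ = ∑' D : Dat d t, ∫⁻ φ in Cyl t (extend D), f φ ∂μ := by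
  rw [← lintegral_iUnion (fun D => measurableSet_Cyl t _) (pairwise_disjoint_Cyl t),
    iUnion_Cyl, Measure.restrict_univ]

lemma measure_eq_tsum_Cyl (t : ℕ) (μ : Measure (Trk d))
    (E : Set (Trk d)) : μ E = ∑' D : Dat d t, μ (E ∩ Cyl t (extend D)) := by
  have := lintegral_eq_tsum_Cyl t (μ.restrict E) (fun _ => 1)
  simp only [lintegral_one, Measure.restrict_apply_univ] at this
  rw [this]
  refine tsum_congr fun D => ?_
  rw [Measure.restrict_apply (measurableSet_Cyl t _), Set.inter_comm]

/-- Events that are determined by the data up to time `t`. -/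
def DetBy (t : ℕ) (E : Set (Trk d)) : Prop := ∀ φ ψ, AgreeTo t φ ψ → φ ∈ E → ψ ∈ E

lemma DetBy.mono {s t : ℕ} {E : Set (Trk d)} (h : DetBy s E) (hst : s ≤ t) : DetBy t E :=
  fun φ ψ ha => h φ ψ (ha.mono hst)

lemma measurable_proj (t : ℕ) : Measurable (proj (d := d) t) :=
  Measurable.prodMk
    (measurable_pi_lambda (fun (φ : Trk d) (i : Fin (t + 1)) => φ.1 i)
      fun i => (measurable_pi_apply (i : ℕ)).comp measurable_fst)
    (measurable_pi_lambda (fun (φ : Trk d) (i : Fin t) => φ.2 i)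
      fun i => (measurable_pi_apply (i : ℕ)).comp measurable_snd)

lemma DetBy.measurableSet {t : ℕ} {E : Set (Trk d)} (h : DetBy t E) : MeasurableSet E := by
  have : E = proj t ⁻¹' (proj t '' E) := by
    refine Set.Subset.antisymm (Set.subset_preimage_image _ _) ?_
    rintro φ ⟨ψ, hψ, he⟩
    exact h ψ φ (agreeTo_iff_proj.mpr he) hψ
  rw [this]
  exact measurable_proj t (Set.to_countable _).measurableSet

lemma DetBy.inter_Cyl {t : ℕ} {E : Set (Trk d)} (h : DetBy t E) (ψ : Trk d) [Decidable (ψ ∈ E)] :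
    E ∩ Cyl t ψ = if ψ ∈ E then Cyl t ψ else ∅ := by
  split_ifs with hψ
  · exact Set.inter_eq_right.mpr fun φ hφ => h ψ φ (AgreeTo.symm hφ) hψ
  · exact Set.eq_empty_of_forall_notMem fun φ hφ => hψ (h φ ψ hφ.2 hφ.1)

/-- Finite measures on marked paths are ordered if they are so on long cylinders. -/
lemma measure_le_of_Cyl_le {μ ν : Measure (Trk d)} [IsFiniteMeasure μ] [IsFiniteMeasure ν]
    (t₀ : ℕ) (h : ∀ t, t₀ ≤ t → ∀ ψ, μ (Cyl t ψ) ≤ ν (Cyl t ψ)) : μ ≤ ν := by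
  classical
  -- The events decided at some finite time form a generating algebra, and each is a countable
  -- disjoint union of cylinders.
  refine measure_le_of_le_on_setAlgebra μ ν {E | ∃ t, t₀ ≤ t ∧ DetBy t E} ?_ ?_ ?_
  · constructor
    · exact ⟨t₀, le_rfl, fun _ _ _ h => h⟩
    · rintro E ⟨t, ht, hE⟩
      exact ⟨t, ht, fun φ ψ ha hφ hψ => hφ (hE ψ φ ha.symm hψ)⟩
    · rintro E F ⟨t, ht, hE⟩ ⟨s, hs, hF⟩
      refine ⟨max t s, le_max_of_le_left ht, fun φ ψ ha hφ => ?_⟩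
      exact hφ.imp (hE φ ψ (ha.mono (le_max_left _ _))) (hF φ ψ (ha.mono (le_max_right _ _)))
  · refine le_antisymm ?_ (MeasurableSpace.generateFrom_le ?_)
    · set m' := MeasurableSpace.generateFrom {E : Set (Trk d) | ∃ t, t₀ ≤ t ∧ DetBy t E}
      have hid : @Measurable (Trk d) (Trk d) m' Prod.instMeasurableSpace
          (fun φ => (φ.1, φ.2)) := by
        refine @Measurable.prodMk _ m' _ _ _ _ _ _ ?_ ?_
        · refine @measurable_pi_lambda _ _ _ m' _ _ fun i => fun s _ => ?_
          refine MeasurableSpace.measurableSet_generateFrom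
            ⟨max t₀ i, le_max_left _ _, fun φ ψ ha hφ => ?_⟩
          show ψ.1 i ∈ s
          rw [← ha.1 i (le_max_right _ _)]; exact hφ
        · refine @measurable_pi_lambda _ _ _ m' _ _ fun i => fun s _ => ?_
          refine MeasurableSpace.measurableSet_generateFrom
            ⟨max t₀ (i + 1), le_max_left _ _, fun φ ψ ha hφ => ?_⟩
          show ψ.2 i ∈ s
          rw [← ha.2 i (lt_of_lt_of_le (Nat.lt_succ_self i) (le_max_right _ _))]; exact hφ
      exact fun s hs => hid hs
    · rintro E ⟨t, ht, hE⟩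
      exact hE.measurableSet
  · rintro E ⟨t, ht, hE⟩
    rw [measure_eq_tsum_Cyl t μ, measure_eq_tsum_Cyl t ν]
    refine ENNReal.tsum_le_tsum fun D => ?_
    rw [hE.inter_Cyl]
    split_ifs
    · exact h t ht _
    · simp

lemma measure_eq_of_Cyl_eq {μ ν : Measure (Trk d)} [IsFiniteMeasure μ] [IsFiniteMeasure ν]
    (t₀ : ℕ) (h : ∀ t, t₀ ≤ t → ∀ ψ, μ (Cyl t ψ) = ν (Cyl t ψ)) : μ = ν :=
  le_antisymm (measure_le_of_Cyl_le t₀ fun t ht ψ => (h t ht ψ).le)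
    (measure_le_of_Cyl_le t₀ fun t ht ψ => (h t ht ψ).ge)

/-! ### The Markov property -/

/-- The path that follows `ψ` up to time `t` and then `φ`. -/
def cat (t : ℕ) (ψ φ : Trk d) : Trk d :=
  (fun i => if i < t then ψ.1 i else ψ.1 t + φ.1 (i - t),
    fun i => if i < t then ψ.2 i else φ.2 (i - t))

lemma measurable_cat (t : ℕ) (ψ : Trk d) : Measurable (cat t ψ) := by
  refine Measurable.prodMk (measurable_pi_lambda _ fun i => ?_) (measurable_pi_lambda _ fun i => ?_)
  · by_cases hi : i < t
    · simp [hi]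
    · simp only [hi, if_false]
      exact (Measurable.of_discrete (f := fun x : Site d => ψ.1 t + x)).comp
        ((measurable_pi_apply (i - t)).comp measurable_fst)
  · by_cases hi : i < t
    · simp [hi]
    · simp only [hi, if_false]
      exact (measurable_pi_apply (i - t)).comp measurable_snd

lemma cat_agreeTo {t : ℕ} {ψ φ : Trk d} (h : φ.1 0 = 0) : AgreeTo t (cat t ψ φ) ψ := by
  refine ⟨fun i hi => ?_, fun i hi => by simp [cat, hi]⟩
  rcases hi.lt_or_eq with hi | rfl
  · simp [cat, hi]
  · simp [cat, h]

lemma shiftT_cat {t : ℕ} {ψ φ : Trk d} (h : φ.1 0 = 0) : shiftT t (cat t ψ φ) = φ := by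
  refine Prod.ext (funext fun i => ?_) (funext fun i => ?_)
  · simp [shiftT, cat, h]
  · simp [shiftT, cat]

lemma stepMeasure_translate (p : ProbVec d) (z w a : Site d) :
    stepMeasure p (z - a) {w - a} = stepMeasure p z {w} := by
  classical
  simp only [stepMeasure, Measure.coe_finsetSum, Finset.sum_apply, Measure.smul_apply, smul_eq_mul]
  refine Finset.sum_congr rfl fun e _ => ?_
  rw [Measure.dirac_apply' _ (measurableSet_singleton _),
    Measure.dirac_apply' _ (measurableSet_singleton _)]
  congr 1
  have : z - a + dirVec e = w - a ↔ z + dirVec e = w := by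
    constructor <;> intro h
    · have := congrArg (· + a) h
      simp only [sub_add_cancel] at this
      rw [← this]; abel
    · rw [← h]; abel
  simp only [Set.indicator, Set.mem_singleton_iff, this, Pi.one_apply]

lemma wt_congr (κ : EllConst d) (ω : Env d) {t : ℕ} {φ ψ : Trk d} (h : AgreeTo t φ ψ) :
    wt κ ω t φ = wt κ ω t ψ := by
  refine Finset.prod_congr rfl fun i hi => ?_
  have hi := Finset.mem_range.mp hi
  rw [h.1 i hi.le, h.1 (i + 1) hi, h.2 i hi]

/-- The law of a coin depends neither on time nor on site, so the remainder of the path weighs as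
much as the shifted path in the shifted environment. -/
lemma wt_add (κ : EllConst d) (ω : Env d) (s t : ℕ) (ψ : Trk d) :
    wt κ ω (s + t) ψ = wt κ ω s ψ * wt κ (shiftEnv (ψ.1 s) ω) t (shiftT s ψ) := by
  unfold wt
  rw [Finset.prod_range_add]
  congr 1
  refine Finset.prod_congr rfl fun i _ => ?_
  simp only [shiftT, shiftEnv, sub_add_cancel]
  rw [stepMeasure_translate, add_assoc]

lemma ae_start (κ : EllConst d) (ω : Env d) : ∀ᵐ φ ∂(markedKernel κ ω), φ.1 0 = 0 := by
  classical
  have h := markedKernel_Cyl κ ω 0 ((fun _ => 0, fun _ => false) : Trk d)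
  have e : Cyl 0 ((fun _ => 0, fun _ => false) : Trk d) = {φ : Trk d | φ.1 0 = 0} := by
    ext φ; simp [Cyl, AgreeTo]
  rw [e] at h
  simp only [if_true, wt, Finset.range_zero, Finset.prod_empty] at h
  rw [← prob_compl_eq_zero_iff (e ▸ measurableSet_Cyl 0 _)] at h
  exact h

/-- The Markov property: given the first `t` steps, the walk starts afresh. -/
lemma restrict_Cyl (κ : EllConst d) (ω : Env d) (t : ℕ) {ψ : Trk d} (h0 : ψ.1 0 = 0) :
    (markedKernel κ ω).restrict (Cyl t ψ) =
      wt κ ω t ψ • (markedKernel κ (shiftEnv (ψ.1 t) ω)).map (cat t ψ) := by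
  classical
  have hw : wt κ ω t ψ ≠ ⊤ := by
    have := markedKernel_Cyl κ ω t ψ
    rw [if_pos h0] at this
    rw [← this]; exact measure_ne_top _ _
  have : IsFiniteMeasure (wt κ ω t ψ • (markedKernel κ (shiftEnv (ψ.1 t) ω)).map (cat t ψ)) :=
    Measure.smul_finite _ hw
  -- A cylinder of length at least `t` either refines that of `ψ`, where `wt_add` applies, or has
  -- mass `0` on both sides.
  refine measure_eq_of_Cyl_eq t fun t' ht χ => ?_
  rw [Measure.restrict_apply (measurableSet_Cyl _ _), Measure.smul_apply, smul_eq_mul,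
    Measure.map_apply (measurable_cat t ψ) (measurableSet_Cyl _ _)]
  by_cases ha : AgreeTo t χ ψ
  · have e1 : Cyl t' χ ∩ Cyl t ψ = Cyl t' χ :=
      Set.inter_eq_left.mpr fun φ hφ => (AgreeTo.mono hφ ht).trans ha
    have e2 : cat t ψ ⁻¹' (Cyl t' χ) = Cyl (t' - t) (shiftT t χ) := by
      ext φ
      constructor
      · rintro ⟨h1, h2⟩
        refine ⟨fun i hi => ?_, fun i hi => ?_⟩
        · have := h1 (t + i) (by omega)
          simp only [cat, add_tsub_cancel_left, if_neg (by omega : ¬ t + i < t)] at this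
          simp only [shiftT]
          rw [← this, ha.1 t le_rfl]; abel
        · have := h2 (t + i) (by omega)
          simpa [cat, shiftT] using this
      · rintro ⟨h1, h2⟩
        refine ⟨fun i hi => ?_, fun i hi => ?_⟩
        · by_cases hit : i < t
          · simp only [cat, hit, if_true]; exact (ha.1 i hit.le).symm
          · have := h1 (i - t) (by omega)
            simp only [cat, hit, if_false, this, shiftT]
            rw [show t + (i - t) = i by omega, ha.1 t le_rfl]; abel
        · by_cases hit : i < t
          · simp only [cat, hit, if_true]; exact (ha.2 i hit).symm
          · have := h2 (i - t) (by omega)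
            simp only [cat, hit, if_false, this, shiftT]
            rw [show t + (i - t) = i by omega]
    have h0' : χ.1 0 = 0 := (ha.1 0 (Nat.zero_le _)).trans h0
    have h0'' : (shiftT t χ).1 0 = 0 := by simp [shiftT]
    rw [e1, e2, markedKernel_Cyl, markedKernel_Cyl, if_pos h0', if_pos h0'', ← wt_congr κ ω ha,
      ← ha.1 t le_rfl, ← wt_add, show t + (t' - t) = t' by omega]
  · have e1 : Cyl t' χ ∩ Cyl t ψ = ∅ := Set.eq_empty_of_forall_notMem fun φ hφ =>
      ha ((AgreeTo.mono hφ.1 ht).symm.trans hφ.2)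
    have e2 : markedKernel κ (shiftEnv (ψ.1 t) ω) (cat t ψ ⁻¹' (Cyl t' χ)) = 0 := by
      refine measure_mono_null (t := {φ : Trk d | ¬ φ.1 0 = 0}) (fun φ hφ hφ0 => ha ?_)
        (ae_start κ _)
      exact (AgreeTo.mono (AgreeTo.symm hφ) ht).trans (cat_agreeTo hφ0)
    rw [e1, e2]; simp

lemma wt_le_one (κ : EllConst d) (ω : Env d) (t : ℕ) {ψ : Trk d} (h0 : ψ.1 0 = 0) :
    wt κ ω t ψ ≤ 1 := by
  classical
  have := markedKernel_Cyl κ ω t ψ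
  rw [if_pos h0] at this
  rw [← this]; exact prob_le_one

end

/-! ### Exponential sums on the lattice -/

lemma summable_pi_prod {n : ℕ} {q : ℤ → ℝ} (hq : Summable q) (h0 : ∀ z, 0 ≤ q z) :
    Summable fun x : Fin n → ℤ => ∏ i, q (x i) := by
  induction n with
  | zero => exact (hasSum_fintype _).summable
  | succ n ih =>
    have h1 : Summable fun p : ℤ × (Fin n → ℤ) => q p.1 * ∏ i, q (p.2 i) :=
      Summable.mul_of_nonneg (f := q) (g := fun x : Fin n → ℤ => ∏ i, q (x i)) hq ih
        (fun z => h0 z) fun x => Finset.prod_nonneg fun i _ => h0 _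
    rw [← (Fin.consEquiv fun _ : Fin (n + 1) => ℤ).summable_iff]
    refine h1.congr fun p => ?_
    simp [Fin.consEquiv, Fin.prod_univ_succ]

lemma summable_exp_natAbs {a : ℝ} (ha : 0 < a) :
    Summable fun z : ℤ => Real.exp (-a * (z.natAbs : ℝ)) := by
  have h : Summable fun n : ℕ => Real.exp (-a * (n : ℝ)) := by
    have := Real.summable_exp_nat_mul_iff.mpr (neg_lt_zero.mpr ha)
    exact this.congr fun n => by rw [mul_comm]
  refine Summable.of_nat_of_neg ?_ ?_
  · simpa using h
  · simpa using h

section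
variable {d : ℕ} [NeZero d]

lemma dist1_sub (x y : Site d) : dist1 (x - y) 0 = dist1 x y := by simp [dist1]

lemma exp_dist1_eq_prod (a : ℝ) (x : Site d) :
    Real.exp (-a * (dist1 x 0 : ℝ)) = ∏ i, Real.exp (-a * ((x i).natAbs : ℝ)) := by
  rw [← Real.exp_sum, ← Finset.mul_sum]
  simp [dist1]

lemma summable_exp_dist1 {a : ℝ} (ha : 0 < a) (y : Site d) :
    Summable fun x : Site d => Real.exp (-a * (dist1 x y : ℝ)) := by
  have h : Summable fun x : Site d => Real.exp (-a * (dist1 x 0 : ℝ)) := by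
    refine (summable_pi_prod (summable_exp_natAbs ha) fun z => (Real.exp_pos _).le).congr
      fun x => ?_
    rw [exp_dist1_eq_prod]
  rw [← (Equiv.subRight y).summable_iff] at h
  refine h.congr fun x => ?_
  simp [dist1_sub]

lemma tsum_exp_dist1 (a : ℝ) (y : Site d) :
    ∑' x : Site d, Real.exp (-a * (dist1 x y : ℝ)) =
      ∑' x : Site d, Real.exp (-a * (dist1 x 0 : ℝ)) := by
  rw [← (Equiv.subRight y).tsum_eq fun x : Site d => Real.exp (-a * (dist1 x 0 : ℝ))]
  refine tsum_congr fun x => ?_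
  simp [dist1_sub]

lemma level_le_dist1 (x y : Site d) : level y - level x ≤ dist1 x y := by
  have h1 : (x 0 - y 0).natAbs ≤ dist1 x y :=
    Finset.single_le_sum (f := fun i => (x i - y i).natAbs) (fun i _ => Nat.zero_le _)
      (Finset.mem_univ 0)
  have h2 : ((x 0 - y 0).natAbs : ℤ) ≤ dist1 x y := by exact_mod_cast h1
  simp only [level]
  omega

lemma dist1_comm (x y : Site d) : dist1 x y = dist1 y x := by
  unfold dist1
  exact Finset.sum_congr rfl fun i _ => by omega

/-- The sum of `exp (-a |x|)` over the lattice. -/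
noncomputable def latticeSum (d : ℕ) (a : ℝ) : ℝ :=
  ∑' x : Site d, Real.exp (-a * (dist1 x 0 : ℝ))

/-- The sum of `c₅ (j + 1)² exp (-a j)`. -/
noncomputable def levelSum (c₅ a : ℝ) : ℝ :=
  ∑' j : ℕ, c₅ * ((j : ℝ) + 1) ^ 2 * Real.exp (-a * (j : ℝ))

lemma summable_levelSum (c₅ : ℝ) {a : ℝ} (ha : 0 < a) :
    Summable fun j : ℕ => c₅ * ((j : ℝ) + 1) ^ 2 * Real.exp (-a * (j : ℝ)) := by
  have h2 := Real.summable_pow_mul_exp_neg_nat_mul 2 ha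
  have h1 := Real.summable_pow_mul_exp_neg_nat_mul 1 ha
  have h0 := Real.summable_pow_mul_exp_neg_nat_mul 0 ha
  refine (((h2.add (h1.mul_left 2)).add h0).mul_left c₅).congr fun j => ?_
  ring

/-- The interaction between a set that meets every level above `y₀` in a bounded number of sites,
and the sites that are at least `M` levels below `y₀`. -/
lemma tsum_exp_dist1_le {c₅ γ : ℝ} (hγ : 0 < γ) (y₀ : Site d) (M : ℕ) (Δ : Finset (Site d))
    (hlev : ∀ y ∈ Δ, level y₀ ≤ level y)
    (hcount : ∀ j : ℕ, (((Δ.filter fun y => level y = level y₀ + j).card : ℕ) : ℝ) ≤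
      c₅ * ((j : ℝ) + 1) ^ 2) (A : Set (Site d)) (hA : ∀ x ∈ A, level x ≤ level y₀ - M) :
    ∑' x : A, ∑ y ∈ Δ, Real.exp (-γ * (dist1 (x : Site d) y : ℝ)) ≤
      latticeSum d (γ / 2) * levelSum c₅ (γ / 2) * Real.exp (-(γ / 2) * M) := by
  classical
  have hγ2 : 0 < γ / 2 := half_pos hγ
  have hZ0 : 0 ≤ latticeSum d (γ / 2) := tsum_nonneg fun x => (Real.exp_pos _).le
  have hsum : ∀ y : Site d, Summable fun x : A => Real.exp (-γ * (dist1 (x : Site d) y : ℝ)) :=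
    fun y => (summable_exp_dist1 hγ y).subtype A
  rw [Summable.tsum_finsetSum fun y _ => hsum y]
  have hone : ∀ y ∈ Δ, ∑' x : A, Real.exp (-γ * (dist1 (x : Site d) y : ℝ)) ≤
      latticeSum d (γ / 2) * Real.exp (-(γ / 2) * M) *
        Real.exp (-(γ / 2) * ((level y - level y₀).toNat : ℝ)) := by
    intro y hy
    have hj : (((level y - level y₀).toNat : ℕ) : ℤ) = level y - level y₀ :=
      Int.toNat_of_nonneg (by linarith [hlev y hy])
    set j := (level y - level y₀).toNat
    -- The distance from `x` to `y` is at least `M + j`. Half of the exponent is spent on this and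
    -- the other half keeps the sum over `x` convergent.
    have hterm : ∀ x : A, Real.exp (-γ * (dist1 (x : Site d) y : ℝ)) ≤
        Real.exp (-(γ / 2) * M) * Real.exp (-(γ / 2) * j) *
          Real.exp (-(γ / 2) * (dist1 (x : Site d) y : ℝ)) := by
      intro x
      rw [← Real.exp_add, ← Real.exp_add, Real.exp_le_exp]
      have h1 := level_le_dist1 (x : Site d) y
      have h2 := hA x x.2
      have h3 : ((M + j : ℕ) : ℤ) ≤ dist1 (x : Site d) y := by push_cast; linarith
      have h4 : ((M : ℝ) + j) ≤ dist1 (x : Site d) y := by exact_mod_cast h3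
      nlinarith
    have hs2 : Summable fun x : A => Real.exp (-(γ / 2) * (dist1 (x : Site d) y : ℝ)) :=
      (summable_exp_dist1 hγ2 y).subtype A
    calc ∑' x : A, Real.exp (-γ * (dist1 (x : Site d) y : ℝ))
        ≤ ∑' x : A, Real.exp (-(γ / 2) * M) * Real.exp (-(γ / 2) * j) *
          Real.exp (-(γ / 2) * (dist1 (x : Site d) y : ℝ)) :=
          (hsum y).tsum_le_tsum hterm (hs2.mul_left _)
      _ = Real.exp (-(γ / 2) * M) * Real.exp (-(γ / 2) * j) *
          ∑' x : A, Real.exp (-(γ / 2) * (dist1 (x : Site d) y : ℝ)) := tsum_mul_left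
      _ ≤ Real.exp (-(γ / 2) * M) * Real.exp (-(γ / 2) * j) * latticeSum d (γ / 2) := by
          refine mul_le_mul_of_nonneg_left ?_ (by positivity)
          rw [latticeSum, ← tsum_exp_dist1 (γ / 2) y]
          exact (summable_exp_dist1 hγ2 y).tsum_subtype_le _ A fun x => (Real.exp_pos _).le
      _ = _ := by ring
  refine (Finset.sum_le_sum hone).trans ?_
  rw [← Finset.mul_sum]
  have hlevel : ∑ y ∈ Δ, Real.exp (-(γ / 2) * ((level y - level y₀).toNat : ℝ)) ≤
      levelSum c₅ (γ / 2) := by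
    set s := Δ.image fun y => (level y - level y₀).toNat
    rw [← Finset.sum_fiberwise_of_maps_to (t := s) (g := fun y => (level y - level y₀).toNat)
      fun y hy => Finset.mem_image_of_mem _ hy]
    have hc : ∀ j : ℕ, 0 ≤ c₅ * ((j : ℝ) + 1) ^ 2 := fun j =>
      le_trans (Nat.cast_nonneg _) (hcount j)
    refine le_trans (Finset.sum_le_sum (g := fun j : ℕ =>
      c₅ * ((j : ℝ) + 1) ^ 2 * Real.exp (-(γ / 2) * (j : ℝ))) fun j _ => ?_)
      ((summable_levelSum c₅ hγ2).sum_le_tsum s fun j _ =>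
        mul_nonneg (hc j) (Real.exp_pos _).le)
    rw [Finset.sum_congr rfl (g := fun _ => Real.exp (-(γ / 2) * (j : ℝ))) fun y hy => by
      rw [(Finset.mem_filter.mp hy).2], Finset.sum_const, nsmul_eq_mul]
    refine mul_le_mul_of_nonneg_right (le_trans ?_ (hcount j)) (Real.exp_pos _).le
    have : (Δ.filter fun y => (level y - level y₀).toNat = j) ⊆
        Δ.filter fun y => level y = level y₀ + j := by
      intro y hy
      rw [Finset.mem_filter] at hy ⊢
      have := hlev y hy.1
      exact ⟨hy.1, by omega⟩
    exact_mod_cast Finset.card_le_card this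
  calc _ ≤ latticeSum d (γ / 2) * Real.exp (-(γ / 2) * M) * levelSum c₅ (γ / 2) := by gcongr
    _ = _ := by ring

/-! ### Consequences of the mixing condition -/

variable (P : Measure (Env d)) [IsProbabilityMeasure P]

/-- As `v` sees only the sites outside `V`, `f` may be replaced by `h`, its conditional expectation
given those sites. Two configurations outside `V` that agree on `U` can differ only on `Vᶜ \ U`, so
the mixing condition bounds the ratio of their values of `h` by `e`. Averaging one of the two over
the conditional law given `U` compares `h` with the conditional expectation given `U`. -/
lemma mixing_condE {r : ℕ} {γ C : ℝ} (hmix : MixingCond P r γ C) (Δ V : Finset (Site d))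
    (U : Set (Site d)) (hΔV : Δ ⊆ V) (hdist : ∀ x ∈ Δ, ∀ y ∉ V, r ≤ dist1 x y)
    (hU : U ⊆ (V : Set (Site d))ᶜ) {f v : Env d → ℝ≥0∞}
    (hf : Measurable[sigmaAlg (Δ : Set (Site d))] f)
    (hv : Measurable[sigmaAlg (V : Set (Site d))ᶜ] v) (e : ℝ≥0∞)
    (he : ENNReal.ofReal (Real.exp (C * ∑' x : ↥((V : Set (Site d))ᶜ \ U),
      ∑ y ∈ Δ, Real.exp (-γ * (dist1 (x : Site d) y : ℝ)))) ≤ e) :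
    ∫⁻ ω, v ω * f ω ∂P ≤ e * ∫⁻ ω, v ω * condE P U f ω ∂P ∧
      ∫⁻ ω, v ω * condE P U f ω ∂P ≤ e * ∫⁻ ω, v ω * f ω ∂P := by
  set W : Set (Site d) := (V : Set (Site d))ᶜ with hW
  obtain ⟨G, hG, hGle⟩ := hmix Δ V (W \ U) hΔV hdist Set.sdiff_subset
  have hfm : Measurable f := hf.mono (sigmaAlg_le _) le_rfl
  obtain ⟨g, hg, rfl⟩ := hf.exists_eq_measurable_comp
  set h : Env d → ℝ≥0∞ := fun ω =>
    ∫⁻ y, g y ∂(condDistrib (restr (Δ : Set (Site d))) (restr W) P (restr W ω)) with hh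
  have hhm' : Measurable fun η : W → ProbVec d =>
      ∫⁻ y, g y ∂(condDistrib (restr (Δ : Set (Site d))) (restr W) P η) := hg.lintegral_kernel
  have hhm : Measurable h := hhm'.comp (measurable_restr W)
  have hint : ∀ v : Env d → ℝ≥0∞, Measurable[sigmaAlg W] v →
      ∫⁻ ω, v ω * h ω ∂P = ∫⁻ ω, v ω * g (restr (Δ : Set (Site d)) ω) ∂P := by
    intro v hv
    obtain ⟨w, hw, rfl⟩ := hv.exists_eq_measurable_comp
    exact lintegral_mul_condDistrib P (measurable_restr W) (measurable_restr _) hw hg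
  -- Tower property, as `U` lies outside `V`.
  have hcond : condE P U h =ᵐ[P] condE P U (g ∘ restr (Δ : Set (Site d))) := by
    refine condE_ae_eq P U hhm (measurable_condE P U hfm) fun v hv _ => ?_
    rw [lintegral_mul_condE P U hfm hv]
    exact hint v (hv.mono (sigmaAlg_mono hU) le_rfl)
  have hcmp : ∀ ω, restr W ω ∈ G → ∀ ω', restr W ω' ∈ G → restr U ω' = restr U ω →
      h ω ≤ e * h ω' := by
    intro ω hω ω' hω' heq
    have h1 := hGle _ hω _ hω' (fun x hx => by
      have hxU : (x : Site d) ∈ U := by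
        by_contra hxU
        exact hx ⟨x.2, hxU⟩
      exact (congrFun heq ⟨x, hxU⟩).symm)
    have h2 : condDistrib (restr (Δ : Set (Site d))) (restr W) P (restr W ω) ≤
        e • condDistrib (restr (Δ : Set (Site d))) (restr W) P (restr W ω') :=
      Measure.le_iff.mpr fun B hB => (h1 B hB).trans (by
        rw [Measure.smul_apply, smul_eq_mul]; gcongr)
    calc h ω ≤ ∫⁻ y, g y ∂(e • condDistrib (restr (Δ : Set (Site d))) (restr W) P
          (restr W ω')) := lintegral_mono' h2 le_rfl
      _ = e * h ω' := by rw [lintegral_smul_measure, smul_eq_mul]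
  have hae : ∀ᵐ ω ∂P, h ω ≤ e * condE P U (g ∘ restr (Δ : Set (Site d))) ω ∧
      condE P U (g ∘ restr (Δ : Set (Site d))) ω ≤ e * h ω := by
    filter_upwards [ae_condDistrib_agree P U (T := {ω | restr W ω ∈ G}) hG, hG, hcond]
      with ω hω hωG hωe
    rw [← hωe]
    constructor
    · calc h ω = ∫⁻ _, h ω ∂(condDistrib id (restr U) P (restr U ω)) := by simp
        _ ≤ ∫⁻ ω', e * h ω' ∂(condDistrib id (restr U) P (restr U ω)) :=
          lintegral_mono_ae (hω.mono fun ω' h' => hcmp ω hωG ω' h'.1 h'.2)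
        _ = e * condE P U h ω := lintegral_const_mul _ hhm
    · calc condE P U h ω ≤ ∫⁻ _, e * h ω ∂(condDistrib id (restr U) P (restr U ω)) :=
          lintegral_mono_ae (hω.mono fun ω' h' => hcmp ω' h'.1 ω hωG h'.2.symm)
        _ = e * h ω := by simp
  have hvm : Measurable v := hv.mono (sigmaAlg_le _) le_rfl
  have hcm : Measurable (condE P U (g ∘ restr (Δ : Set (Site d)))) :=
    (measurable_condE P U hfm).mono (sigmaAlg_le _) le_rfl
  simp only [Function.comp_apply]
  rw [← hint v hv, ← lintegral_const_mul e (show Measurable fun ω => v ω *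
    condE P U (g ∘ restr (Δ : Set (Site d))) ω from hvm.mul hcm),
    ← lintegral_const_mul e (show Measurable fun ω => v ω * h ω from hvm.mul hhm)]
  constructor
  · refine lintegral_mono_ae (hae.mono fun ω hω => ?_)
    calc v ω * h ω ≤ v ω * (e * condE P U (g ∘ restr (Δ : Set (Site d))) ω) := by
          gcongr; exact hω.1
      _ = _ := by ring
  · refine lintegral_mono_ae (hae.mono fun ω hω => ?_)
    calc v ω * condE P U (g ∘ restr (Δ : Set (Site d))) ω ≤ v ω * (e * h ω) := by
          gcongr; exact hω.2
      _ = _ := by ring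

end

section
variable {d : ℕ} [NeZero d] (P : Measure (Env d)) [IsProbabilityMeasure P]

/-! ### Functions whose conditional expectation is insensitive to far away sites -/

/-- The exponent in the comparison of conditional laws at distance `M`. -/
noncomputable def mixExp (d : ℕ) (γ C c₅ : ℝ) (M : ℕ) : ℝ :=
  C * ((latticeSum d (γ / 2) * levelSum c₅ (γ / 2) + 1) * Real.exp (-(γ / 2) * M))

/-- Up to the factor `e`, the conditional expectation of `f` given the environment on `Λ` is the
conditional expectation given the environment on `U`. -/
def Mix (U Λ : Set (Site d)) (e : ℝ≥0∞) (f : Env d → ℝ≥0∞) : Prop :=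
  Measurable f ∧ ∀ v : Env d → ℝ≥0∞, Measurable[sigmaAlg Λ] v → (∀ ω, v ω ≤ 1) →
    ∫⁻ ω, v ω * f ω ∂P ≤ e * ∫⁻ ω, v ω * condE P U f ω ∂P ∧
      ∫⁻ ω, v ω * condE P U f ω ∂P ≤ e * ∫⁻ ω, v ω * f ω ∂P

lemma finite_dist1_lt (y : Site d) (r : ℕ) : {x : Site d | dist1 y x < r}.Finite := by
  refine Set.Finite.subset (Set.finite_Icc (y - fun _ => (r : ℤ)) (y + fun _ => (r : ℤ)))
    fun x hx => ?_
  have h : ∀ i, (y i - x i).natAbs < r := fun i =>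
    lt_of_le_of_lt (Finset.single_le_sum (f := fun i => (y i - x i).natAbs)
      (fun i _ => Nat.zero_le _) (Finset.mem_univ i)) hx
  constructor
  · intro i
    have := h i
    simp only [Pi.sub_apply]
    omega
  · intro i
    have := h i
    simp only [Pi.add_apply]
    omega

/-- The finite set `V` of the mixing condition consists of the sites of a large finite set `F` that
are neither in `U` nor in the far half-space `A`. What lies outside `V` and `U` is then in `A`,
which `tsum_exp_dist1_le` controls, or outside `F`, where the interaction with `Δ` is as small as
desired. -/
lemma mix_local {r : ℕ} {γ C c₅ : ℝ} (hγ : 0 < γ) (hC : 0 < C) (hmix : MixingCond P r γ C)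
    {L M : ℕ} (hL : 1 ≤ L) (hrL : r ≤ L) (hLM : L ≤ M) (y₀ : Site d) {U Λ : Set (Site d)}
    (hU : ∀ x ∈ U, level x ≤ level y₀ - L)
    (hΛ : ∀ x ∈ Λ, x ∈ U ∨ level x ≤ level y₀ - M) (Δ : Finset (Site d))
    (hlev : ∀ y ∈ Δ, level y₀ ≤ level y)
    (hcount : ∀ j : ℕ, (((Δ.filter fun y => level y = level y₀ + j).card : ℕ) : ℝ) ≤
      c₅ * ((j : ℝ) + 1) ^ 2) {f : Env d → ℝ≥0∞}
    (hf : Measurable[sigmaAlg (Δ : Set (Site d))] f) :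
    Mix P U Λ (ENNReal.ofReal (Real.exp (mixExp d γ C c₅ M))) f := by
  classical
  refine ⟨hf.mono (sigmaAlg_le _) le_rfl, fun v hv _ => ?_⟩
  set A : Set (Site d) := {x | level x ≤ level y₀ - M} with hA
  set g : Site d → ℝ := fun x => ∑ y ∈ Δ, Real.exp (-γ * (dist1 x y : ℝ)) with hg
  have hgs : Summable g := summable_sum fun y _ => summable_exp_dist1 hγ y
  have hg0 : ∀ x, 0 ≤ g x := fun x => Finset.sum_nonneg fun y _ => (Real.exp_pos _).le
  -- This tail of the interaction is the source of the `+ 1` in `mixExp`.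
  obtain ⟨F₀, hF₀⟩ : ∃ F₀ : Finset (Site d), ∀ F, F₀ ⊆ F →
      ∑' x : {x // x ∉ F}, g x < Real.exp (-(γ / 2) * M) := by
    have := (tendsto_order.mp (tendsto_tsum_compl_atTop_zero g)).2 _
      (Real.exp_pos (-(γ / 2) * (M : ℝ)))
    exact Filter.eventually_atTop.mp this
  have hNfin : (⋃ y ∈ Δ, {x : Site d | dist1 y x < r}).Finite :=
    Set.Finite.biUnion Δ.finite_toSet fun y _ => finite_dist1_lt y r
  set F : Finset (Site d) := F₀ ∪ Δ ∪ hNfin.toFinset with hFdef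
  -- A site outside `V` is at distance at least `r` from `Δ`: if outside `F`, because `F` contains
  -- the sites closer than `r`; if in `U` or `A`, because it lies `L ≥ r` levels below.
  set V : Finset (Site d) := F.filter fun x => x ∉ U ∧ x ∉ A with hV
  have hUA : ∀ x ∈ U ∪ A, level x ≤ level y₀ - L := by
    rintro x (hx | hx)
    · exact hU x hx
    · have h1 : level x ≤ level y₀ - M := hx
      have : (L : ℤ) ≤ M := by exact_mod_cast hLM
      linarith
  have hL' : (1 : ℤ) ≤ L := by exact_mod_cast hL
  have hΔV : Δ ⊆ V := by
    intro y hy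
    have hnot : y ∉ U ∪ A := fun h => by
      have h1 := hUA y h
      have h2 := hlev y hy
      linarith
    refine Finset.mem_filter.mpr ⟨by simp [F, hy], fun h => hnot (Or.inl h), fun h => hnot (Or.inr h)⟩
  have hdist : ∀ x ∈ Δ, ∀ y ∉ V, r ≤ dist1 x y := by
    intro x hx y hy
    by_cases hyF : y ∈ F
    · have hyUA : y ∈ U ∪ A := by
        by_contra h
        exact hy (Finset.mem_filter.mpr ⟨hyF, fun h' => h (Or.inl h'), fun h' => h (Or.inr h')⟩)
      have h1 := hUA y hyUA
      have h2 := hlev x hx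
      have h3 := level_le_dist1 y x
      rw [dist1_comm] at h3
      have : (L : ℤ) ≤ dist1 x y := by linarith
      have : L ≤ dist1 x y := by exact_mod_cast this
      omega
    · by_contra hlt
      refine hyF (Finset.mem_union_right _ (hNfin.mem_toFinset.mpr ?_))
      exact Set.mem_biUnion (s := (Δ : Set (Site d))) hx (not_le.mp hlt)
  have hUV : U ⊆ (V : Set (Site d))ᶜ := fun x hx hxV => (Finset.mem_filter.mp hxV).2.1 hx
  have hΛV : Λ ⊆ (V : Set (Site d))ᶜ := fun x hx hxV => by
    rcases hΛ x hx with h | h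
    · exact (Finset.mem_filter.mp hxV).2.1 h
    · exact (Finset.mem_filter.mp hxV).2.2 h
  refine mixing_condE P hmix Δ V U hΔV hdist hUV hf (hv.mono (sigmaAlg_mono hΛV) le_rfl) _ ?_
  refine ENNReal.ofReal_le_ofReal (Real.exp_le_exp.mpr ?_)
  unfold mixExp
  refine mul_le_mul_of_nonneg_left ?_ hC.le
  have h1 : ∑' x : ↥((V : Set (Site d))ᶜ \ U), g x ≤
      ∑' x : A, g x + ∑' x : {x // x ∉ F}, g x := by
    have e1 : ∑' x : ↥((V : Set (Site d))ᶜ \ U), g x =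
        ∑' x, ((V : Set (Site d))ᶜ \ U).indicator g x := tsum_subtype _ g
    have e2 : ∑' x : A, g x = ∑' x, A.indicator g x := tsum_subtype _ g
    have e3 : ∑' x : {x // x ∉ F}, g x = ∑' x, {x | x ∉ F}.indicator g x :=
      tsum_subtype {x | x ∉ F} g
    rw [e1, e2, e3, ← (hgs.indicator _).tsum_add (hgs.indicator _)]
    refine (hgs.indicator _).tsum_le_tsum (fun x => ?_) ((hgs.indicator _).add (hgs.indicator _))
    have i1 : 0 ≤ A.indicator g x := Set.indicator_nonneg (fun x _ => hg0 x) x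
    have i2 : 0 ≤ {x | x ∉ F}.indicator g x := Set.indicator_nonneg (fun x _ => hg0 x) x
    by_cases hx : x ∈ (V : Set (Site d))ᶜ \ U
    · rw [Set.indicator_of_mem hx]
      by_cases hxF : x ∈ F
      · have hxA : x ∈ A := by
          by_contra hxA
          exact hx.1 (Finset.mem_coe.mpr (Finset.mem_filter.mpr ⟨hxF, hx.2, hxA⟩))
        rw [Set.indicator_of_mem hxA]; linarith
      · rw [Set.indicator_of_mem (s := {x | x ∉ F}) hxF]; linarith
    · rw [Set.indicator_of_notMem hx]; positivity
  have h2 := tsum_exp_dist1_le hγ y₀ M Δ hlev hcount A fun x hx => hx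
  have h3 := (hF₀ F (by intro x hx; simp [F, hx])).le
  calc ∑' x : ↥((V : Set (Site d))ᶜ \ U), g x
      ≤ ∑' x : A, g x + ∑' x : {x // x ∉ F}, g x := h1
    _ ≤ latticeSum d (γ / 2) * levelSum c₅ (γ / 2) * Real.exp (-(γ / 2) * M) +
        Real.exp (-(γ / 2) * M) := add_le_add h2 h3
    _ = _ := by ring

lemma Mix.tsum {ι : Type*} [Countable ι] {U Λ : Set (Site d)} {e : ℝ≥0∞}
    {f : ι → Env d → ℝ≥0∞} (h : ∀ i, Mix P U Λ e (f i)) :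
    Mix P U Λ e fun ω => ∑' i, f i ω := by
  have hm : ∀ i, Measurable (f i) := fun i => (h i).1
  have hc : ∀ i, Measurable (condE P U (f i)) := fun i =>
    (measurable_condE P U (hm i)).mono (sigmaAlg_le _) le_rfl
  refine ⟨Measurable.tsum hm, fun v hv hv1 => ?_⟩
  have hvm : Measurable v := hv.mono (sigmaAlg_le _) le_rfl
  have e1 : ∫⁻ ω, v ω * ∑' i, f i ω ∂P = ∑' i, ∫⁻ ω, v ω * f i ω ∂P := by
    simp_rw [← ENNReal.tsum_mul_left]
    exact lintegral_tsum fun i => (hvm.mul (hm i)).aemeasurable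
  have e0 : ∀ ω, condE P U (fun ω => ∑' i, f i ω) ω = ∑' i, condE P U (f i) ω := fun ω =>
    lintegral_tsum fun i => (hm i).aemeasurable
  have e2 : ∫⁻ ω, v ω * condE P U (fun ω => ∑' i, f i ω) ω ∂P =
      ∑' i, ∫⁻ ω, v ω * condE P U (f i) ω ∂P := by
    simp_rw [e0, ← ENNReal.tsum_mul_left]
    exact lintegral_tsum fun i => (hvm.mul (hc i)).aemeasurable
  rw [e1, e2, ← ENNReal.tsum_mul_left, ← ENNReal.tsum_mul_left]
  exact ⟨ENNReal.tsum_le_tsum fun i => ((h i).2 v hv hv1).1,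
    ENNReal.tsum_le_tsum fun i => ((h i).2 v hv hv1).2⟩

lemma mix_zero (U Λ : Set (Site d)) (e : ℝ≥0∞) : Mix P U Λ e fun _ => 0 :=
  ⟨measurable_const, fun v _ _ => by simp [condE]⟩

/-- The bound by `1` allows decreasing limits to pass through the integral against `P` and through
the conditional expectation. A finite `e` is what lets it commute with the infimum. -/
lemma Mix.iInf {U Λ : Set (Site d)} {e : ℝ≥0∞} (he : e ≠ ⊤) {f : ℕ → Env d → ℝ≥0∞}
    (h : ∀ i, Mix P U Λ e (f i)) (hanti : Antitone f) (h1 : ∀ i ω, f i ω ≤ 1) :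
    Mix P U Λ e fun ω => ⨅ i, f i ω := by
  have hm : ∀ i, Measurable (f i) := fun i => (h i).1
  have hc : ∀ i, Measurable (condE P U (f i)) := fun i =>
    (measurable_condE P U (hm i)).mono (sigmaAlg_le _) le_rfl
  have hc1 : ∀ i ω, condE P U (f i) ω ≤ 1 := fun i ω => by
    refine (lintegral_mono fun ω' => h1 i ω').trans ?_
    simp
  refine ⟨Measurable.iInf hm, fun v hv hv1 => ?_⟩
  have hvm : Measurable v := hv.mono (sigmaAlg_le _) le_rfl
  have hvt : ∀ ω, v ω ≠ ⊤ := fun ω => ne_top_of_le_ne_top ENNReal.one_ne_top (hv1 ω)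
  have aux : ∀ F : ℕ → Env d → ℝ≥0∞, (∀ i, Measurable (F i)) → Antitone F →
      (∀ i ω, F i ω ≤ 1) → ∫⁻ ω, v ω * ⨅ i, F i ω ∂P = ⨅ i, ∫⁻ ω, v ω * F i ω ∂P := by
    intro F hF hFa hF1
    have : ∀ ω, v ω * ⨅ i, F i ω = ⨅ i, v ω * F i ω := fun ω =>
      ENNReal.mul_iInf fun h => absurd h (hvt ω)
    simp_rw [this]
    refine lintegral_iInf (fun i => hvm.mul (hF i))
      (fun i j hij ω => mul_le_mul_right (hFa hij ω) _) ?_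
    refine ne_top_of_le_ne_top ENNReal.one_ne_top ?_
    calc ∫⁻ ω, v ω * F 0 ω ∂P ≤ ∫⁻ _, 1 ∂P :=
          lintegral_mono fun ω => mul_le_one' (hv1 ω) (hF1 0 ω)
      _ = 1 := by simp
  have e0 : ∀ ω, condE P U (fun ω => ⨅ i, f i ω) ω = ⨅ i, condE P U (f i) ω := fun ω =>
    lintegral_iInf hm hanti (ne_top_of_le_ne_top ENNReal.one_ne_top (hc1 0 ω))
  simp_rw [e0]
  rw [aux f hm hanti h1, aux (fun i => condE P U (f i)) hc
    (fun i j hij ω => lintegral_mono fun ω' => hanti hij ω') hc1,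
    ENNReal.mul_iInf fun h => absurd h he, ENNReal.mul_iInf fun h => absurd h he]
  exact ⟨iInf_mono fun i => ((h i).2 v hv hv1).1, iInf_mono fun i => ((h i).2 v hv hv1).2⟩

/-! ### Measurability of the weights -/

lemma measurable_stepMeasure_singleton (z w : Site d) :
    Measurable fun p : ProbVec d => stepMeasure p z {w} := by
  simp only [stepMeasure, Measure.coe_finsetSum, Finset.sum_apply, Measure.smul_apply, smul_eq_mul]
  refine Finset.measurable_sum _ fun e _ => Measurable.mul_const ?_ _
  exact ENNReal.measurable_ofReal.comp ((measurable_pi_apply e).comp measurable_subtype_coe)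

/-- A step whose coin is `1` is uniform and does not read the environment, so only the sites where
the coin is `0` matter. This is the reason for introducing the coins. -/
lemma measurable_wt_shift (κ : EllConst d) {Λ : Set (Site d)} (a : Site d) (t : ℕ) (ψ : Trk d)
    (h : ∀ i < t, ψ.2 i = false → ψ.1 i + a ∈ Λ) :
    Measurable[sigmaAlg Λ] fun ω => wt κ (shiftEnv a ω) t ψ := by
  unfold wt
  refine Finset.measurable_prod (m := sigmaAlg Λ) _ fun i hi => ?_
  have hi := Finset.mem_range.mp hi
  refine (@measurable_const _ _ _ (sigmaAlg Λ) _).mul ?_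
  cases hb : ψ.2 i with
  | true =>
    have : ∀ q : ProbVec d, coinStep κ true q = uniformVec d := fun q => by simp [coinStep]
    simp_rw [this]
    exact @measurable_const _ _ _ (sigmaAlg Λ) _
  | false =>
    exact (measurable_stepMeasure_singleton _ _).comp ((measurable_coinStep κ false).comp
      (measurable_sigmaAlg_apply (h i hi hb)))

lemma measurable_shiftEnv (a : Site d) : Measurable (shiftEnv (d := d) a) :=
  measurable_pi_lambda _ fun x => measurable_pi_apply (x + a)

end

section
variable {d : ℕ} [NeZero d]

/-! ### Measurability of the regeneration structure -/

lemma detBy_lt_stopR (c₅ : ℝ) (N : ℕ) : DetBy N {φ : Trk d | (N : ℕ∞) < stopR c₅ φ.1} :=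
  fun _ _ h hφ => (lt_stopR_agree h).mp hφ

lemma good_eq_iInter (c₅ : ℝ) :
    (good c₅ : Set (Trk d)) = ⋂ N : ℕ, {φ | (N : ℕ∞) < stopR c₅ φ.1} := by
  ext φ
  rw [mem_good_iff, Set.mem_iInter]
  rfl

lemma measurableSet_good (c₅ : ℝ) : MeasurableSet (good c₅ : Set (Trk d)) := by
  rw [good_eq_iInter]
  exact MeasurableSet.iInter fun N => (detBy_lt_stopR c₅ N).measurableSet

lemma measurable_site_sub {α : Type*} [MeasurableSpace α] {f g : α → Site d} (hf : Measurable f)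
    (hg : Measurable g) : Measurable fun a => f a - g a := by
  have h : Measurable fun p : Site d × Site d => p.1 - p.2 := Measurable.of_discrete
  exact h.comp (hf.prodMk hg)

lemma measurable_shiftT (s : ℕ) : Measurable (shiftT (d := d) s) := by
  refine Measurable.prodMk (f := fun φ : Trk d => fun i => φ.1 (s + i) - φ.1 s)
    (g := fun φ : Trk d => fun i => φ.2 (s + i)) (measurable_pi_lambda _ fun i => ?_)
    (measurable_pi_lambda _ fun i => (measurable_pi_apply (s + i)).comp measurable_snd)
  exact measurable_site_sub ((measurable_pi_apply (s + i)).comp measurable_fst)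
    ((measurable_pi_apply s).comp measurable_fst)

lemma detBy_S (c₅ : ℝ) (L k t : ℕ) : DetBy t {φ : Trk d | S c₅ L k φ = t} :=
  fun _ _ h hφ => (S_agree h).mp hφ

lemma measurableSet_T_eq (c₅ : ℝ) (L n t : ℕ) : MeasurableSet {φ : Trk d | T c₅ L n φ = t} := by
  induction n generalizing t with
  | zero => simp [T_zero]
  | succ n ih =>
    have h1 : ∀ t : ℕ, MeasurableSet {φ : Trk d | T c₅ L 1 φ = t} := by
      intro t
      have : {φ : Trk d | T c₅ L 1 φ = t} =
          (⋃ k, {φ | S c₅ L (k + 1) φ = t}) ∩ shiftT t ⁻¹' good c₅ := by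
        ext φ
        simp only [Set.mem_ofPred_eq, T_one_eq_iff, Set.mem_inter_iff, Set.mem_iUnion,
          Set.mem_preimage]
      rw [this]
      exact (MeasurableSet.iUnion fun k => (detBy_S c₅ L (k + 1) t).measurableSet).inter
        (measurable_shiftT t (measurableSet_good c₅))
    have : {φ : Trk d | T c₅ L (n + 1) φ = t} =
        ⋃ s, ⋃ w, ⋃ _ : w + s = t, {φ | T c₅ L n φ = s} ∩ shiftT s ⁻¹' {φ | T c₅ L 1 φ = w} := by
      ext φ
      simp only [Set.mem_ofPred_eq, Set.mem_iUnion, Set.mem_inter_iff, Set.mem_preimage]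
      constructor
      · intro h
        obtain ⟨a, w, ha, hw, hs⟩ := T_split (Nat.le_succ n) h
        rw [show n.succ - n = 1 by omega] at hw
        exact ⟨a, w, hs, ha, hw⟩
      · rintro ⟨s, w, hs, ha, hw⟩
        rw [T_succ ha, hw, ← hs]; push_cast; rfl
    rw [this]
    exact MeasurableSet.iUnion fun s => MeasurableSet.iUnion fun w => MeasurableSet.iUnion fun _ =>
      (ih s).inter (measurable_shiftT s (h1 w))

lemma T_ne_top_iff {c₅ : ℝ} {L n : ℕ} {φ : Trk d} : T c₅ L n φ ≠ ⊤ ↔ ∃ t : ℕ, T c₅ L n φ = t :=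
  ENat.ne_top_iff_exists.trans (exists_congr fun _ => eq_comm)

lemma measurableSet_T_top (c₅ : ℝ) (L n : ℕ) : MeasurableSet {φ : Trk d | T c₅ L n φ = ⊤} := by
  have : {φ : Trk d | T c₅ L n φ = ⊤} = (⋃ t : ℕ, {φ | T c₅ L n φ = t})ᶜ := by
    ext φ
    have := T_ne_top_iff (c₅ := c₅) (L := L) (n := n) (φ := φ)
    simp only [Set.mem_ofPred_eq, Set.mem_compl_iff, Set.mem_iUnion]
    tauto
  rw [this]
  exact (MeasurableSet.iUnion fun t => measurableSet_T_eq c₅ L n t).compl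

lemma measurable_T_toNat (c₅ : ℝ) (L n : ℕ) : Measurable fun φ : Trk d => (T c₅ L n φ).toNat := by
  refine measurable_to_countable' fun t => ?_
  have : (fun φ : Trk d => (T c₅ L n φ).toNat) ⁻¹' {t} =
      {φ | T c₅ L n φ = t} ∪ ({φ | T c₅ L n φ = ⊤} ∩ {_φ | t = 0}) := by
    ext φ
    simp only [Set.mem_preimage, Set.mem_singleton_iff, Set.mem_union, Set.mem_ofPred_eq,
      Set.mem_inter_iff]
    cases h : T c₅ L n φ with
    | top => simp [eq_comm]
    | coe u => simp
  rw [this]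
  exact (measurableSet_T_eq c₅ L n t).union ((measurableSet_T_top c₅ L n).inter (by simp))

/-! ### Blocks of marked paths -/

/-- The block with path `p`, environment read off from `ω`, displacement `F` and duration `t`. -/
def mkBlock (p : List (Site d)) (ω : Env d) (F : Site d) (t : ℕ) : Block d :=
  ⟨p, fun x => ω x, F, t⟩

lemma measurableSet_block_iff {s : Set (Block d)} :
    MeasurableSet s ↔ ∀ p, MeasurableSet (Sigma.mk p ⁻¹' s) :=
  MeasurableSpace.measurableSet_iInf

lemma measurable_mkBlock {α : Type*} [MeasurableSpace α] {p : α → List (Site d)}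
    {ω : α → Env d} {F : α → Site d} {t : α → ℕ} (hp : ∀ l, MeasurableSet {a | p a = l})
    (hω : Measurable ω) (hF : Measurable F) (ht : Measurable t) :
    Measurable fun a => mkBlock (p a) (ω a) (F a) (t a) := by
  intro s hs
  have : (fun a => mkBlock (p a) (ω a) (F a) (t a)) ⁻¹' s =
      ⋃ l, {a | p a = l} ∩
        (fun a => ((fun x : {x // x ∈ l} => ω a x), F a, t a)) ⁻¹'
          ((fun w => (⟨l, w⟩ : Block d)) ⁻¹' s) := by
    ext a
    simp only [Set.mem_preimage, Set.mem_iUnion, Set.mem_inter_iff, Set.mem_ofPred_eq]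
    constructor
    · intro h; exact ⟨p a, rfl, h⟩
    · rintro ⟨l, rfl, h⟩; exact h
  rw [this]
  refine MeasurableSet.iUnion fun l => (hp l).inter ?_
  refine Measurable.prodMk (measurable_pi_lambda _ fun x => ?_) (hF.prodMk ht)
    (measurableSet_block_iff.mp hs l)
  exact (measurable_pi_apply (x : Site d)).comp hω

/-- The block of an environment and a marked path. -/
noncomputable def blk (c₅ : ℝ) (L n : ℕ) (ω : Env d) (φ : Trk d) : Block d :=
  block c₅ L n ((ω, liftCoins φ.2), φ.1)

/-- The block of a piece of a path, between the times `a` and `b`. -/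
def pieceBlock (L a b : ℕ) (ω : Env d) (φ : Trk d) : Block d :=
  mkBlock ((List.range (b - a - L + 1)).map fun i => φ.1 (i + a) - φ.1 a)
    (shiftEnv (φ.1 a) ω) (φ.1 b - φ.1 a) (b - a)

lemma blk_eq_pieceBlock (c₅ : ℝ) (L n : ℕ) (ω : Env d) (φ : Trk d) :
    blk c₅ L n ω φ = pieceBlock L (T c₅ L n φ).toNat (T c₅ L (n + 1) φ).toNat ω φ := rfl

lemma block_eq_blk (c₅ : ℝ) (L n : ℕ) (z : Triple d) :
    block c₅ L n z = blk c₅ L n z.1.1 (marks (z.1.2, z.2)) := by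
  have h : block c₅ L n z = pieceBlock L (tau c₅ L z.1.2 z.2 n).toNat
      (tau c₅ L z.1.2 z.2 (n + 1)).toNat z.1.1 (marks (z.1.2, z.2)) := rfl
  rw [h, blk_eq_pieceBlock, tau_eq_T, tau_eq_T]
  rfl

lemma measurable_pieceBlock (L a b : ℕ) :
    Measurable fun p : Env d × Trk d => pieceBlock L a b p.1 p.2 := by
  have hX : ∀ i, Measurable fun p : Env d × Trk d => p.2.1 i := fun i =>
    (measurable_pi_apply i).comp (measurable_fst.comp measurable_snd)
  have hsub : ∀ i j, Measurable fun p : Env d × Trk d => p.2.1 i - p.2.1 j := fun i j =>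
    measurable_site_sub (hX i) (hX j)
  refine measurable_mkBlock (fun l => ?_) ?_ (hsub b a) measurable_const
  · have : {p : Env d × Trk d |
        ((List.range (b - a - L + 1)).map fun i => p.2.1 (i + a) - p.2.1 a) = l} =
        Prod.snd ⁻¹' {φ | ((List.range (b - a - L + 1)).map fun i => φ.1 (i + a) - φ.1 a) = l} :=
      rfl
    rw [this]
    refine measurable_snd (DetBy.measurableSet (t := b + a) fun φ ψ h hφ => ?_)
    refine Eq.trans (List.map_congr_left fun i hi => ?_) hφ
    have := List.mem_range.mp hi
    rw [h.1 _ (by omega), h.1 a (by omega)]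
  · have : Measurable fun q : Env d × Site d => shiftEnv q.2 q.1 :=
      measurable_from_prod_countable_left fun x => measurable_shiftEnv x
    exact this.comp (measurable_fst.prodMk (hX a))

lemma measurable_blk (c₅ : ℝ) (L n : ℕ) :
    Measurable fun p : Env d × Trk d => blk c₅ L n p.1 p.2 := by
  have h : Measurable fun q : (Env d × Trk d) × (ℕ × ℕ) =>
      pieceBlock L q.2.1 q.2.2 q.1.1 q.1.2 :=
    measurable_from_prod_countable_left fun x => measurable_pieceBlock L x.1 x.2
  exact h.comp (measurable_id.prodMk (((measurable_T_toNat c₅ L n).comp measurable_snd).prodMk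
    ((measurable_T_toNat c₅ L (n + 1)).comp measurable_snd)))

lemma pieceBlock_congr {L a b : ℕ} (hab : a ≤ b) (ω : Env d) {φ ψ : Trk d} (h : AgreeTo b φ ψ) :
    pieceBlock L a b ω φ = pieceBlock L a b ω ψ := by
  unfold pieceBlock
  rw [h.1 a hab, h.1 b le_rfl]
  congr 1
  refine List.map_congr_left fun i hi => ?_
  have := List.mem_range.mp hi
  rw [h.1 _ (by omega)]

lemma pieceBlock_shift (L a b s : ℕ) (ω : Env d) (φ : Trk d) :
    pieceBlock L (a + s) (b + s) ω φ = pieceBlock L a b (shiftEnv (φ.1 s) ω) (shiftT s φ) := by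
  unfold pieceBlock
  have e1 : b + s - (a + s) = b - a := by omega
  have e2 : shiftEnv (φ.1 (a + s)) ω = shiftEnv ((shiftT s φ).1 a) (shiftEnv (φ.1 s) ω) := by
    funext x
    simp only [shiftEnv, shiftT]
    congr 1
    rw [add_comm s a]; abel
  have e3 : ∀ i, (shiftT s φ).1 i - (shiftT s φ).1 a = φ.1 (i + s) - φ.1 (a + s) := by
    intro i
    simp only [shiftT]
    rw [add_comm s a, add_comm s i]; abel
  rw [e1, e2, e3]
  congr 1
  refine List.map_congr_left fun i _ => ?_
  rw [e3, add_assoc]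

lemma T_mono {c₅ : ℝ} {L m n a b : ℕ} {φ : Trk d} (hmn : m ≤ n) (ha : T c₅ L m φ = a)
    (hb : T c₅ L n φ = b) : a ≤ b := by
  obtain ⟨a', w, ha', -, h⟩ := T_split hmn hb
  have : a = a' := by
    have := ha.symm.trans ha'
    exact_mod_cast this
  omega

lemma blk_congr {c₅ : ℝ} {L n b : ℕ} (ω : Env d) {φ ψ : Trk d}
    (h0 : T c₅ L n φ = T c₅ L n ψ) (h1 : T c₅ L (n + 1) φ = T c₅ L (n + 1) ψ)
    (hb : T c₅ L (n + 1) ψ = b) (h : AgreeTo b φ ψ) : blk c₅ L n ω φ = blk c₅ L n ω ψ := by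
  rw [blk_eq_pieceBlock, blk_eq_pieceBlock, h0, h1, hb]
  obtain ⟨a, w, ha, -, hab⟩ := T_split (Nat.le_succ n) hb
  rw [ha]
  exact pieceBlock_congr (by simp; omega) ω h

lemma blk_shift {c₅ : ℝ} {L m i s b : ℕ} (ω : Env d) {φ : Trk d} (hs : T c₅ L m φ = s)
    (hb : T c₅ L (i + 1) (shiftT s φ) = b) :
    blk c₅ L (m + i) ω φ = blk c₅ L i (shiftEnv (φ.1 s) ω) (shiftT s φ) := by
  obtain ⟨a, w, ha, -, hab⟩ := T_split (Nat.le_succ i) hb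
  rw [blk_eq_pieceBlock, blk_eq_pieceBlock, add_assoc, T_add hs, T_add hs, ha, hb,
    ← pieceBlock_shift]
  rfl

/-! ### Comparison for the good continuations of a finite path -/

variable (P : Measure (Env d)) [IsProbabilityMeasure P]

lemma detBy_shift {u N : ℕ} {E : Set (Trk d)} (h : DetBy N E) : DetBy (u + N) (shiftT u ⁻¹' E) :=
  fun φ ψ ha hφ => h _ _ (AgreeTo.shift (by rwa [add_comm N u])) hφ

lemma detBy_Cyl (u : ℕ) (ψ : Trk d) : DetBy u (Cyl u ψ) :=
  fun _ _ h hφ => h.symm.trans hφ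

lemma DetBy.inter {t : ℕ} {E F : Set (Trk d)} (hE : DetBy t E) (hF : DetBy t F) :
    DetBy t (E ∩ F) := fun φ ψ h hφ => ⟨hE φ ψ h hφ.1, hF φ ψ h hφ.2⟩

/-- Goodness after `u` is the decreasing limit of `R > N`, and each such event splits into cylinders
of length `u + N`. Along one cylinder the quenched probability reads the environment on the finite
set `Δ` of visited sites. As `u` is a record, `R > u + N` for the whole path, which keeps `Δ` at or
above the starting level and bounds the number of its sites on each level, as `mix_local` demands.
-/
lemma mix_Cyl_good {r : ℕ} {γ C c₅ : ℝ} (hγ : 0 < γ) (hC : 0 < C) (hmix : MixingCond P r γ C)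
    {L M : ℕ} (hL : 1 ≤ L) (hrL : r ≤ L) (hLM : L ≤ M) (y : Site d) {U Λ : Set (Site d)}
    (hU : ∀ x ∈ U, level x ≤ level y - L)
    (hΛ : ∀ x ∈ Λ, x ∈ U ∨ level x ≤ level y - M) (κ : EllConst d) {u : ℕ} {ψ : Trk d}
    (hrec : ∀ i < u, level (ψ.1 i) < level (ψ.1 u)) (hu : (u : ℕ∞) < stopR c₅ ψ.1)
    {a : Env d → ℝ≥0∞} (ha : Measurable[sigmaAlg {x | ∃ i ≤ u, x = ψ.1 i + y}] a)
    (ha1 : ∀ ω, a ω ≤ 1) :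
    Mix P U Λ (ENNReal.ofReal (Real.exp (mixExp d γ C c₅ M))) fun ω =>
      a ω * markedKernel κ (shiftEnv y ω) (Cyl u ψ ∩ shiftT u ⁻¹' good c₅) := by
  classical
  set e := ENNReal.ofReal (Real.exp (mixExp d γ C c₅ M)) with he
  set E : ℕ → Set (Trk d) := fun N => Cyl u ψ ∩ shiftT u ⁻¹' {φ | (N : ℕ∞) < stopR c₅ φ.1} with hE
  have hdet : ∀ N, DetBy (u + N) (E N) := fun N =>
    ((detBy_Cyl u ψ).mono (Nat.le_add_right u N)).inter (detBy_shift (detBy_lt_stopR c₅ N))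
  have hEanti : Antitone E := by
    intro N N' h φ hφ
    refine ⟨hφ.1, ?_⟩
    have h1 : (N' : ℕ∞) < stopR c₅ (shiftT u φ).1 := hφ.2
    exact lt_of_le_of_lt (by exact_mod_cast h) h1
  have hEInter : Cyl u ψ ∩ shiftT u ⁻¹' good c₅ = ⋂ N, E N := by
    rw [good_eq_iInter, Set.preimage_iInter, Set.inter_iInter]
  have hat : ∀ ω, a ω ≠ ⊤ := fun ω => ne_top_of_le_ne_top ENNReal.one_ne_top (ha1 ω)
  have hinf : (fun ω => a ω * markedKernel κ (shiftEnv y ω) (Cyl u ψ ∩ shiftT u ⁻¹' good c₅)) =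
      fun ω => ⨅ N, a ω * markedKernel κ (shiftEnv y ω) (E N) := by
    funext ω
    rw [hEInter, hEanti.measure_iInter (fun N => (hdet N).measurableSet.nullMeasurableSet)
      ⟨0, measure_ne_top _ _⟩, ENNReal.mul_iInf fun h => absurd h (hat ω)]
  rw [hinf]
  refine Mix.iInf P ENNReal.ofReal_ne_top (fun N => ?_)
    (fun N N' h ω => mul_le_mul_right (measure_mono (hEanti h)) _)
    (fun N ω => mul_le_one' (ha1 ω) prob_le_one)
  have hsum : (fun ω => a ω * markedKernel κ (shiftEnv y ω) (E N)) =
      fun ω => ∑' D : Dat d (u + N),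
        a ω * markedKernel κ (shiftEnv y ω) (E N ∩ Cyl (u + N) (extend D)) := by
    funext ω
    rw [ENNReal.tsum_mul_left, ← measure_eq_tsum_Cyl]
  rw [hsum]
  refine Mix.tsum P fun D => ?_
  set X := extend D
  simp only [(hdet N).inter_Cyl, ]
  by_cases hX : X ∈ E N ∧ X.1 0 = 0
  swap
  · have : (fun ω => a ω * markedKernel κ (shiftEnv y ω)
        (if X ∈ E N then Cyl (u + N) X else ∅)) = fun _ => 0 := by
      funext ω
      split_ifs with h
      · rw [markedKernel_Cyl, if_neg fun h0 => hX ⟨h, h0⟩, mul_zero]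
      · simp
    rw [this]
    exact mix_zero P U Λ e
  obtain ⟨hXE, hX0⟩ := hX
  have hfun : (fun ω => a ω * markedKernel κ (shiftEnv y ω)
      (if X ∈ E N then Cyl (u + N) X else ∅)) =
      fun ω => a ω * wt κ (shiftEnv y ω) (u + N) X := by
    funext ω
    rw [if_pos hXE, markedKernel_Cyl, if_pos hX0]
  rw [hfun]
  have hagree : AgreeTo u X ψ := hXE.1
  have hXR : ((u + N : ℕ) : ℕ∞) < stopR c₅ X.1 := by
    refine lt_stopR_concat (fun i hi => ?_) ((lt_stopR_agree hagree).mpr hu) hXE.2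
    rw [hagree.1 i hi.le, hagree.1 u le_rfl]
    exact hrec i hi
  have hXR' := (lt_stopR_iff _ _ _).mp hXR
  set Δ : Finset (Site d) := (Finset.range (u + N + 1)).image fun i => X.1 i + y with hΔ
  refine mix_local P hγ hC hmix hL hrL hLM y hU hΛ Δ ?_ ?_ ?_
  · intro z hz
    obtain ⟨i, hi, rfl⟩ := Finset.mem_image.mp hz
    rw [level_add]
    rcases Nat.eq_zero_or_pos i with rfl | hi0
    · rw [hX0, level_zero]; linarith
    · have := hXR'.2 i hi0 (by have := Finset.mem_range.mp hi; omega)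
      rw [hX0, level_zero] at this
      linarith
  · intro j
    refine le_trans ?_ (hXR'.1 j)
    have : (Δ.filter fun z => level z = level y + j) ⊆
        ((Finset.range (u + N + 1)).filter fun i => level (X.1 i) = level (X.1 0) + j).image
          fun i => X.1 i + y := by
      intro z hz
      obtain ⟨hz1, hz2⟩ := Finset.mem_filter.mp hz
      obtain ⟨i, hi, rfl⟩ := Finset.mem_image.mp hz1
      refine Finset.mem_image.mpr ⟨i, Finset.mem_filter.mpr ⟨hi, ?_⟩, rfl⟩
      rw [level_add] at hz2
      rw [hX0, level_zero]
      linarith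
    have h2 := (Finset.card_le_card this).trans Finset.card_image_le
    unfold visits
    exact_mod_cast h2
  · have hmem : ∀ i ≤ u + N, X.1 i + y ∈ (Δ : Set (Site d)) := fun i hi =>
      Finset.mem_coe.mpr (Finset.mem_image_of_mem _ (Finset.mem_range.mpr (by omega)))
    refine (ha.mono (sigmaAlg_mono ?_) le_rfl).mul
      (measurable_wt_shift κ y (u + N) X fun i hi _ => hmem i hi.le)
    rintro x ⟨i, hi, rfl⟩
    rw [← hagree.1 i hi]
    exact hmem i (by omega)

end

section
variable {d : ℕ} [NeZero d]

/-! ### The Markov property for events of the shifted path. -/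

lemma markedKernel_Cyl_inter_shift (κ : EllConst d) (ω : Env d) (t : ℕ) {ψ : Trk d}
    (h0 : ψ.1 0 = 0) {E : Set (Trk d)} (hE : MeasurableSet E) :
    markedKernel κ ω (Cyl t ψ ∩ shiftT t ⁻¹' E) =
      wt κ ω t ψ * markedKernel κ (shiftEnv (ψ.1 t) ω) E := by
  have hs := measurable_shiftT (d := d) t hE
  have h1 : markedKernel κ (shiftEnv (ψ.1 t) ω) (cat t ψ ⁻¹' (shiftT t ⁻¹' E)) =
      markedKernel κ (shiftEnv (ψ.1 t) ω) E := by
    refine measure_congr (Filter.eventuallyEq_set.mpr ?_)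
    filter_upwards [ae_start κ (shiftEnv (ψ.1 t) ω)] with φ hφ
    rw [Set.mem_preimage, Set.mem_preimage, shiftT_cat hφ]
  rw [Set.inter_comm, ← Measure.restrict_apply hs, restrict_Cyl κ ω t h0, Measure.smul_apply,
    smul_eq_mul, Measure.map_apply (measurable_cat t ψ) hs, h1]

/-! ### Straight pieces occur infinitely often -/

/-- A path of bounded level could visit only finitely many levels, each a bounded number of times,
which is impossible for all times. The first passage above the maximum of the first `t` steps is a
strict record. -/
lemma exists_record {c₅ : ℝ} {φ : Trk d} (hφ : φ ∈ good c₅) (t : ℕ) :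
    ∃ n, t ≤ n ∧ ∀ m < n, level (φ.1 m) < level (φ.1 n) := by
  classical
  rw [mem_good_iff] at hφ
  have hunb : ∀ l : ℤ, ∃ n, l < level (φ.1 n) := by
    intro l
    by_contra hcon
    push Not at hcon
    set J : ℕ := (l - level (φ.1 0)).toNat with hJ
    -- `N` exceeds the number of visits that `R = ∞` allows to all accessible levels together.
    obtain ⟨N, hN⟩ := exists_nat_gt (∑ j ∈ Finset.range (J + 1), c₅ * ((j : ℝ) + 1) ^ 2)
    have h := (lt_stopR_iff _ _ _).mp (hφ N)
    have hlow : ∀ i ≤ N, level (φ.1 0) ≤ level (φ.1 i) := by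
      intro i hi
      rcases Nat.eq_zero_or_pos i with rfl | hi0
      · exact le_rfl
      · exact (h.2 i hi0 hi).le
    have hcard := Finset.card_eq_sum_card_fiberwise (s := Finset.range (N + 1))
      (t := Finset.range (J + 1)) (f := fun i => (level (φ.1 i) - level (φ.1 0)).toNat)
      (fun i hi => by
        have := hcon i
        simp only [Finset.coe_range, Set.mem_Iio]
        omega)
    have hle : ((N + 1 : ℕ) : ℝ) ≤ ∑ j ∈ Finset.range (J + 1), c₅ * ((j : ℝ) + 1) ^ 2 := by
      rw [Finset.card_range] at hcard
      rw [hcard]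
      push_cast
      refine Finset.sum_le_sum fun j _ => le_trans ?_ (h.1 j)
      unfold visits
      exact_mod_cast Finset.card_le_card fun i hi => by
        rw [Finset.mem_filter] at hi ⊢
        have := hlow i (by have := Finset.mem_range.mp hi.1; omega)
        exact ⟨hi.1, by omega⟩
    push_cast at hle
    linarith
  obtain ⟨m, hm⟩ : ∃ m : ℤ, ∀ i ≤ t, level (φ.1 i) ≤ m := by
    obtain ⟨m, hm⟩ := ((Set.finite_Iic t).image fun i => level (φ.1 i)).bddAbove
    exact ⟨m, fun i hi => hm (Set.mem_image_of_mem _ hi)⟩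
  refine ⟨Nat.find (hunb m), ?_, fun i hi => ?_⟩
  · by_contra hlt
    have := hm _ (not_le.mp hlt).le
    exact absurd (Nat.find_spec (hunb m)) (not_lt.mpr this)
  · exact lt_of_le_of_lt (not_lt.mp (Nat.find_min (hunb m) hi)) (Nat.find_spec (hunb m))

/-- The path that moves straight in direction `e_1`, all coins being `1`. -/
def straightPath (d : ℕ) [NeZero d] : Trk d := (fun i => i • e1, fun _ => true)

lemma straightAt_add_iff {L n : ℕ} {φ : Trk d} :
    StraightAt L (liftCoins φ.2) φ.1 (n + L) ↔
      (∀ m < n, level (φ.1 m) < level (φ.1 n)) ∧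
        ∀ i < L, φ.2 (n + i) = true ∧ φ.1 (n + i + 1) - φ.1 (n + i) = e1 := by
  unfold StraightAt
  rw [Nat.add_sub_cancel]
  constructor
  · rintro ⟨-, h2, h3⟩
    refine ⟨h2, fun i hi => ?_⟩
    have := h3 (L - i) (by omega) (by omega)
    rwa [show n + L - (L - i) = n + i by omega] at this
  · rintro ⟨h2, h3⟩
    refine ⟨Nat.le_add_left _ _, h2, fun i hi hiL => ?_⟩
    have := h3 (L - i) (by omega)
    rwa [show n + (L - i) = n + L - i by omega] at this

/-- With all coins equal to `1` every step is uniform on the directions, so the weight is positive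
and the same in all environments. -/
lemma wt_straightPath_pos (κ : EllConst d) (L : ℕ) :
    ∃ p : ℝ≥0∞, p ≠ 0 ∧ ∀ ω, wt κ ω L (straightPath d) = p := by
  refine ⟨wt κ (fun _ => uniformVec d) L (straightPath d), ?_, fun ω => ?_⟩
  · unfold wt
    rw [Finset.prod_ne_zero_iff]
    intro i _
    have hd : (0 : ℝ) < d := Nat.cast_pos.mpr (NeZero.pos d)
    refine mul_ne_zero ?_ ?_
    · simp [coinLaw, straightPath]
      exact ⟨NeZero.ne d, κ.2.1⟩
    · have h1 : coinStep κ ((straightPath d).2 i) (uniformVec d) = uniformVec d := by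
        simp [coinStep, straightPath]
      rw [h1]
      have h2 : ENNReal.ofReal (1 / (2 * (d : ℝ))) ≤
          stepMeasure (uniformVec d) ((straightPath d).1 i) {(straightPath d).1 (i + 1)} := by
        classical
        simp only [stepMeasure, Measure.coe_finsetSum, Finset.sum_apply, Measure.smul_apply,
          smul_eq_mul]
        refine le_trans ?_ (Finset.single_le_sum (f := fun e : Dir d =>
          ENNReal.ofReal (uniformVec d e) * Measure.dirac ((straightPath d).1 i + dirVec e)
            {(straightPath d).1 (i + 1)}) (fun _ _ => zero_le) (Finset.mem_univ ((0 : Fin d), true)))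
        have : (straightPath d).1 i + dirVec ((0 : Fin d), true) = (straightPath d).1 (i + 1) := by
          simp only [straightPath, succ_nsmul]
          congr 1
        simp only [this]
        rw [Measure.dirac_apply' _ (measurableSet_singleton _),
          Set.indicator_of_mem (Set.mem_singleton _), Pi.one_apply, mul_one]
        exact le_rfl
      have h3 : 0 < ENNReal.ofReal (1 / (2 * (d : ℝ))) := by
        rw [ENNReal.ofReal_pos]; positivity
      exact (lt_of_lt_of_le h3 h2).ne'
  · unfold wt
    refine Finset.prod_congr rfl fun i _ => ?_
    simp [straightPath, coinStep]

lemma detBy_straightAt (L n : ℕ) : DetBy n {φ : Trk d | StraightAt L (liftCoins φ.2) φ.1 n} :=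
  fun _ _ h hφ => (straightAt_congr h le_rfl).mp hφ

/-- Appending `straightPath` at a record has conditional probability `p` and makes `n + L` the end
of a straight piece. -/
lemma measure_Cyl_diff_straight_le {κ : EllConst d} {ω : Env d} {L n : ℕ} {p : ℝ≥0∞}
    (hp : ∀ ω, wt κ ω L (straightPath d) = p) {ψ : Trk d}
    (hrec : ∀ m < n, level (ψ.1 m) < level (ψ.1 n)) :
    markedKernel κ ω (Cyl n ψ \ {φ | StraightAt L (liftCoins φ.2) φ.1 (n + L)}) ≤
      (1 - p) * markedKernel κ ω (Cyl n ψ) := by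
  classical
  set St := {φ : Trk d | StraightAt L (liftCoins φ.2) φ.1 (n + L)} with hSt
  by_cases h0 : ψ.1 0 = 0
  swap
  · have := markedKernel_Cyl κ ω n ψ
    rw [if_neg h0] at this
    rw [measure_mono_null Set.sdiff_subset this]
    exact zero_le
  have hSm : MeasurableSet St := (detBy_straightAt L (n + L)).measurableSet
  have hsp : (straightPath d).1 0 = 0 := by simp [straightPath]
  have hsub : Cyl (n + L) (cat n ψ (straightPath d)) ⊆ Cyl n ψ ∩ St := by
    intro φ hφ
    have h1 : AgreeTo n φ ψ := (AgreeTo.mono hφ (Nat.le_add_right n L)).trans (cat_agreeTo hsp)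
    refine ⟨h1, straightAt_add_iff.mpr ⟨fun m hm => ?_, fun i hi => ?_⟩⟩
    · rw [h1.1 m hm.le, h1.1 n le_rfl]; exact hrec m hm
    · rw [hφ.2 (n + i) (by omega), hφ.1 (n + i) (by omega), hφ.1 (n + i + 1) (by omega)]
      simp only [cat, if_neg (by omega : ¬ n + i < n), if_neg (by omega : ¬ n + i + 1 < n)]
      refine ⟨rfl, ?_⟩
      rw [show n + i - n = i by omega, show n + i + 1 - n = i + 1 by omega]
      simp only [straightPath, succ_nsmul]
      abel
  have hge : p * markedKernel κ ω (Cyl n ψ) ≤ markedKernel κ ω (Cyl n ψ ∩ St) := by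
    refine le_trans (le_of_eq ?_) (measure_mono hsub)
    have hagree : AgreeTo n (cat n ψ (straightPath d)) ψ := cat_agreeTo hsp
    rw [markedKernel_Cyl, markedKernel_Cyl, if_pos h0,
      if_pos ((hagree.1 0 (Nat.zero_le _)).trans h0), wt_add, shiftT_cat hsp, hp,
      wt_congr κ ω hagree, mul_comm]
  have hsplit := measure_inter_add_sdiff (μ := markedKernel κ ω) (Cyl n ψ) hSm
  have hfin : markedKernel κ ω (Cyl n ψ ∩ St) ≠ ⊤ := measure_ne_top _ _
  rw [ENNReal.sub_mul fun _ _ => measure_ne_top _ _, one_mul]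
  calc markedKernel κ ω (Cyl n ψ \ St)
      = markedKernel κ ω (Cyl n ψ) - markedKernel κ ω (Cyl n ψ ∩ St) := by
        rw [← hsplit, ENNReal.add_sub_cancel_left hfin]
    _ ≤ _ := tsub_le_tsub_left hge _

/-- Let `E` be the set of good paths without straight piece from time `N` on. Starting from any
cylinder of length `t ≥ N`, a good path has a first record after `t`, and there a straight piece
follows with conditional probability at least `p`. So `E` occupies at most the fraction `1 - p` of
every long cylinder, hence of every event. Applied to `E` itself this forces measure `0`. -/
lemma ae_straightAt (κ : EllConst d) (ω : Env d) (c₅ : ℝ) (L : ℕ) :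
    ∀ᵐ φ ∂(markedKernel κ ω), φ ∈ good c₅ →
      ∀ N, ∃ n, N ≤ n ∧ StraightAt L (liftCoins φ.2) φ.1 n := by
  classical
  obtain ⟨p, hp0, hp⟩ := wt_straightPath_pos κ L
  suffices H : ∀ N, markedKernel κ ω (good c₅ ∩
      ⋂ n, ⋂ _ : N ≤ n, {φ | StraightAt L (liftCoins φ.2) φ.1 n}ᶜ) = 0 by
    have h2 : ∀ N, ∀ᵐ φ ∂(markedKernel κ ω), ¬ (φ ∈ good c₅ ∩
      ⋂ n, ⋂ _ : N ≤ n, {φ | StraightAt L (liftCoins φ.2) φ.1 n}ᶜ) := fun N =>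
      measure_eq_zero_iff_ae_notMem.mp (H N)
    filter_upwards [ae_all_iff.mpr h2] with φ hφ hg N
    by_contra hcon
    push Not at hcon
    refine hφ N ⟨hg, ?_⟩
    simp only [Set.mem_iInter]
    exact fun n hn => hcon n hn
  intro N
  set E := good c₅ ∩ ⋂ n, ⋂ _ : N ≤ n, {φ : Trk d | StraightAt L (liftCoins φ.2) φ.1 n}ᶜ with hE
  have hEm : MeasurableSet E := (measurableSet_good c₅).inter
    (MeasurableSet.iInter fun n => MeasurableSet.iInter fun _ =>
      (detBy_straightAt L n).measurableSet.compl)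
  have hfin : IsFiniteMeasure ((1 - p) • markedKernel κ ω) :=
    Measure.smul_finite _ (ne_top_of_le_ne_top ENNReal.one_ne_top tsub_le_self)
  have hle : (markedKernel κ ω).restrict E ≤ (1 - p) • markedKernel κ ω := by
    refine measure_le_of_Cyl_le N fun t ht ψ => ?_
    rw [Measure.restrict_apply (measurableSet_Cyl t ψ), Measure.smul_apply, smul_eq_mul]
    -- On `G m` the first record at or after time `t` occurs at `t + m`. These events are disjoint
    -- and decided at that time.
    set G : ℕ → Set (Trk d) := fun m => Cyl t ψ ∩
      {φ | (∀ i < t + m, level (φ.1 i) < level (φ.1 (t + m))) ∧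
        ∀ l < m, ¬ ∀ i < t + l, level (φ.1 i) < level (φ.1 (t + l))} with hG
    have hGdet : ∀ m, DetBy (t + m) (G m) := by
      intro m
      refine ((detBy_Cyl t ψ).mono (Nat.le_add_right t m)).inter ?_
      rintro φ χ h ⟨h1, h2⟩
      refine ⟨fun i hi => ?_, fun l hl hcon => h2 l hl fun i hi => ?_⟩
      · rw [← h.1 i hi.le, ← h.1 (t + m) le_rfl]; exact h1 i hi
      · rw [h.1 i (by omega), h.1 (t + l) (by omega)]; exact hcon i hi
    have hGdisj : Pairwise (Function.onFun Disjoint G) := by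
      intro m m' hmm
      refine Set.disjoint_left.mpr fun φ h h' => ?_
      rcases lt_or_gt_of_ne hmm with hlt | hlt
      · exact h'.2.2 m hlt h.2.1
      · exact h.2.2 m' hlt h'.2.1
    have hcover : Cyl t ψ ∩ E ⊆
        ⋃ m, G m \ {φ | StraightAt L (liftCoins φ.2) φ.1 (t + m + L)} := by
      rintro φ ⟨hφ, hφE⟩
      have hex : ∃ m, ∀ i < t + m, level (φ.1 i) < level (φ.1 (t + m)) := by
        obtain ⟨n, hn, hr⟩ := exists_record hφE.1 t
        refine ⟨n - t, ?_⟩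
        rwa [show t + (n - t) = n by omega]
      refine Set.mem_iUnion.mpr ⟨Nat.find hex, ⟨hφ, Nat.find_spec hex,
        fun l hl => Nat.find_min hex hl⟩, ?_⟩
      have := Set.mem_iInter₂.mp hφE.2 (t + Nat.find hex + L) (by omega)
      exact this
    have hone : ∀ m, markedKernel κ ω
        (G m \ {φ | StraightAt L (liftCoins φ.2) φ.1 (t + m + L)}) ≤
        (1 - p) * markedKernel κ ω (G m) := by
      intro m
      rw [measure_eq_tsum_Cyl (t + m) _ (G m \ _), measure_eq_tsum_Cyl (t + m) _ (G m),
        ← ENNReal.tsum_mul_left]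
      refine ENNReal.tsum_le_tsum fun D => ?_
      rw [Set.sdiff_inter_right_comm, (hGdet m).inter_Cyl]
      split_ifs with hD
      · exact measure_Cyl_diff_straight_le hp hD.2.1
      · simp
    calc markedKernel κ ω (Cyl t ψ ∩ E)
        ≤ ∑' m, markedKernel κ ω
            (G m \ {φ | StraightAt L (liftCoins φ.2) φ.1 (t + m + L)}) :=
          (measure_mono hcover).trans (measure_iUnion_le _)
      _ ≤ ∑' m, (1 - p) * markedKernel κ ω (G m) := ENNReal.tsum_le_tsum hone
      _ = (1 - p) * markedKernel κ ω (⋃ m, G m) := by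
          rw [ENNReal.tsum_mul_left, measure_iUnion hGdisj fun m => (hGdet m).measurableSet]
      _ ≤ (1 - p) * markedKernel κ ω (Cyl t ψ) := by
          gcongr
          exact Set.iUnion_subset fun m => Set.inter_subset_left
  have h1 := hle E
  rw [Measure.restrict_apply hEm, Set.inter_self, Measure.smul_apply, smul_eq_mul] at h1
  by_contra hne
  have hlt : (1 - p : ℝ≥0∞) < 1 := ENNReal.sub_lt_self ENNReal.one_ne_top one_ne_zero hp0
  have := ENNReal.mul_lt_mul_left hne (measure_ne_top (markedKernel κ ω) E) hlt
  rw [one_mul] at this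
  exact absurd h1 (not_le.mpr this)

/-! ### The regeneration times are finite -/

variable (P : Measure (Env d)) [IsProbabilityMeasure P]

/-- The law of the marked path, averaged over the environment. -/
noncomputable def markedLaw (P : Measure (Env d)) (κ : EllConst d) : Measure (Trk d) :=
  P.bind (markedKernel κ)

lemma markedLaw_apply (κ : EllConst d) {E : Set (Trk d)} (hE : MeasurableSet E) :
    markedLaw P κ E = ∫⁻ ω, markedKernel κ ω E ∂P :=
  Measure.bind_apply hE (markedKernel κ).aemeasurable

instance instProbMarkedLaw (κ : EllConst d) : IsProbabilityMeasure (markedLaw P κ) := by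
  constructor
  rw [markedLaw_apply P κ MeasurableSet.univ]
  simp

lemma ae_markedLaw {κ : EllConst d} {p : Trk d → Prop} (hp : MeasurableSet {φ | p φ}) :
    (∀ᵐ φ ∂(markedLaw P κ), p φ) ↔ ∀ᵐ ω ∂P, ∀ᵐ φ ∂(markedKernel κ ω), p φ := by
  have hm : MeasurableSet {φ | ¬ p φ} := hp.compl
  rw [ae_iff, markedLaw_apply P κ hm,
    lintegral_eq_zero_iff (Kernel.measurable_coe _ hm)]
  rfl

lemma lintegral_shiftEnv (hstat : Stationary P) (a : Site d) {f : Env d → ℝ≥0∞}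
    (hf : Measurable f) : ∫⁻ ω, f (shiftEnv a ω) ∂P = ∫⁻ ω, f ω ∂P := by
  conv_rhs => rw [← hstat a]
  rw [lintegral_map hf (measurable_shiftEnv a)]

lemma condE_empty {f : Env d → ℝ≥0∞} (hf : Measurable f) :
    condE P ∅ f =ᵐ[P] fun _ => ∫⁻ ω, f ω ∂P := by
  refine condE_ae_eq P ∅ hf (@measurable_const _ _ _ (sigmaAlg ∅) _) fun v hv _ => ?_
  obtain ⟨w, hw, rfl⟩ := hv.exists_eq_measurable_comp
  have : ∀ ω : Env d, restr ∅ ω = restr ∅ (fun _ => uniformVec d) := fun ω =>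
    funext fun x => absurd x.2 (Set.notMem_empty _)
  simp only [Function.comp_apply, this]
  rw [lintegral_const_mul _ hf, lintegral_const_mul _ measurable_const]
  simp

lemma shiftEnv_zero (ω : Env d) : shiftEnv 0 ω = ω := by
  funext x; simp [shiftEnv]

/-- At time `0` only the starting point has been counted, so `R > 0` depends on `c₅` and not on the
path. One good path therefore settles it for all. -/
lemma good_nonneg {c₅ : ℝ} {φ : Trk d} (h : φ ∈ good c₅) (ψ : Trk d) :
    ((0 : ℕ) : ℕ∞) < stopR c₅ ψ.1 := by
  have h0 := (mem_good_iff c₅ φ).mp h 0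
  rwa [lt_stopR_congr c₅ (Y := ψ.1) 0 fun i hi => by rw [Nat.le_zero.mp hi]; ring] at h0

/-- The quenched probability of `R = ∞`, seen from `y`, is almost independent of the environment
at the sites far below `y`. -/
lemma mix_good {r : ℕ} {γ C c₅ : ℝ} (hγ : 0 < γ) (hC : 0 < C) (hmix : MixingCond P r γ C)
    {L M : ℕ} (hL : 1 ≤ L) (hrL : r ≤ L) (hLM : L ≤ M) (y : Site d) {U Λ : Set (Site d)}
    (hU : ∀ x ∈ U, level x ≤ level y - L)
    (hΛ : ∀ x ∈ Λ, x ∈ U ∨ level x ≤ level y - M) (κ : EllConst d)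
    (hne : (good c₅ : Set (Trk d)).Nonempty) :
    Mix P U Λ (ENNReal.ofReal (Real.exp (mixExp d γ C c₅ M))) fun ω =>
      markedKernel κ (shiftEnv y ω) (good c₅) := by
  have h := mix_Cyl_good P hγ hC hmix hL hrL hLM y hU hΛ κ (u := 0)
    (ψ := ((fun _ => 0, fun _ => false) : Trk d)) (fun i hi => absurd hi (Nat.not_lt_zero i))
    (good_nonneg hne.some_mem _) (a := fun _ => 1) (@measurable_const _ _ _ (sigmaAlg _) _)
    (fun _ => le_rfl)
  have hfun : (fun ω => markedKernel κ (shiftEnv y ω) (good c₅)) = fun ω => 1 *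
      markedKernel κ (shiftEnv y ω)
        (Cyl 0 ((fun _ => 0, fun _ => false) : Trk d) ∩ shiftT 0 ⁻¹' good c₅) := by
    funext ω
    rw [one_mul, markedKernel_Cyl_inter_shift κ _ 0 rfl (measurableSet_good c₅), shiftEnv_zero]
    simp [wt]
  rw [hfun]
  exact h

/-- Mixing is used with `U = ∅`: the conditional expectation of the quenched probability of `R = ∞`
is then constant, and by stationarity equals `markedLaw P κ (good c₅)`. Because the last `L` coins
are `1`, the weight of the past reads only sites `L` levels below the endpoint. -/
lemma markedLaw_Cyl_mul_le (hstat : Stationary P) {r : ℕ} {γ C c₅ : ℝ} (hγ : 0 < γ) (hC : 0 < C)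
    (hmix : MixingCond P r γ C) {L : ℕ} (hL : 1 ≤ L) (hrL : r ≤ L) (κ : EllConst d)
    (hne : (good c₅ : Set (Trk d)).Nonempty) {t : ℕ} {ψ : Trk d}
    (hst : StraightAt L (liftCoins ψ.2) ψ.1 t) :
    markedLaw P κ (Cyl t ψ) * markedLaw P κ (good c₅) ≤
      ENNReal.ofReal (Real.exp (mixExp d γ C c₅ L)) *
        markedLaw P κ (Cyl t ψ ∩ shiftT t ⁻¹' good c₅) := by
  classical
  have hgm := measurableSet_good (d := d) c₅
  have hCm := measurableSet_Cyl t ψ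
  have hsm := measurable_shiftT (d := d) t hgm
  by_cases h0 : ψ.1 0 = 0
  swap
  · have : markedLaw P κ (Cyl t ψ) = 0 := by
      rw [markedLaw_apply P κ hCm]
      simp [markedKernel_Cyl, h0]
    rw [this, zero_mul]
    exact zero_le
  have hM := mix_good P (Λ := {x | level x ≤ level (ψ.1 t) - L}) (U := ∅) hγ hC hmix hL hrL le_rfl
    (ψ.1 t) (fun x hx => absurd hx (Set.notMem_empty x)) (fun x hx => Or.inr hx) κ hne
  have hwm : Measurable[sigmaAlg {x : Site d | level x ≤ level (ψ.1 t) - L}]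
      fun ω => wt κ ω t ψ := by
    have h1 := measurable_wt_shift κ (Λ := {x : Site d | level x ≤ level (ψ.1 t) - L}) 0 t ψ
      (fun i hi hb => by
        rw [add_zero]
        refine hst.level_le ?_
        by_contra hcon
        have h2 := (hst.2.2 (t - i) (by omega) (by omega)).1
        simp only [liftCoins, show t - (t - i) = i by omega, hb] at h2
        exact absurd h2 (by simp))
    simpa only [shiftEnv_zero] using h1
  have h1 := (hM.2 _ hwm fun ω => wt_le_one κ ω t h0).2
  have hfm := hM.1
  generalize ENNReal.ofReal (Real.exp (mixExp d γ C c₅ L)) = e at h1 ⊢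
  have e1 : ∫⁻ ω, wt κ ω t ψ * condE P ∅
      (fun ω => markedKernel κ (shiftEnv (ψ.1 t) ω) (good c₅)) ω ∂P =
      markedLaw P κ (Cyl t ψ) * markedLaw P κ (good c₅) := by
    have h2 : ∫⁻ ω, markedKernel κ (shiftEnv (ψ.1 t) ω) (good c₅) ∂P =
        markedLaw P κ (good c₅) := by
      rw [markedLaw_apply P κ hgm]
      exact lintegral_shiftEnv P hstat (ψ.1 t) (Kernel.measurable_coe _ hgm)
    have h3 : ∫⁻ ω, wt κ ω t ψ * condE P ∅
        (fun ω => markedKernel κ (shiftEnv (ψ.1 t) ω) (good c₅)) ω ∂P =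
        ∫⁻ ω, wt κ ω t ψ * markedLaw P κ (good c₅) ∂P := by
      refine lintegral_congr_ae ?_
      filter_upwards [condE_empty P hfm] with ω hω
      rw [hω, h2]
    rw [h3, lintegral_mul_const _ (hwm.mono (sigmaAlg_le _) le_rfl), markedLaw_apply P κ hCm]
    congr 1
    refine lintegral_congr fun ω => ?_
    rw [markedKernel_Cyl, if_pos h0]
  have e2 : ∫⁻ ω, wt κ ω t ψ * markedKernel κ (shiftEnv (ψ.1 t) ω) (good c₅) ∂P =
      markedLaw P κ (Cyl t ψ ∩ shiftT t ⁻¹' good c₅) := by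
    rw [markedLaw_apply P κ (hCm.inter hsm)]
    exact lintegral_congr fun ω => (markedKernel_Cyl_inter_shift κ ω t h0 hgm).symm
  rw [← e1, ← e2]
  exact h1

/-- At each time `S_k`, the conditional probability that `R ∘ θ = ∞` is bounded below. -/
lemma measure_S_mul_le (hstat : Stationary P) {r : ℕ} {γ C c₅ : ℝ} (hγ : 0 < γ) (hC : 0 < C)
    (hmix : MixingCond P r γ C) {L : ℕ} (hL : 1 ≤ L) (hrL : r ≤ L) (κ : EllConst d)
    (hne : (good c₅ : Set (Trk d)).Nonempty) (k t : ℕ) :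
    markedLaw P κ {φ | S c₅ L (k + 1) φ = t} * markedLaw P κ (good c₅) ≤
      ENNReal.ofReal (Real.exp (mixExp d γ C c₅ L)) *
        markedLaw P κ ({φ | S c₅ L (k + 1) φ = t} ∩ shiftT t ⁻¹' good c₅) := by
  classical
  have hdet := detBy_S (d := d) c₅ L (k + 1) t
  rw [measure_eq_tsum_Cyl t _ {φ | S c₅ L (k + 1) φ = t}, measure_eq_tsum_Cyl t _ (_ ∩ _),
    ← ENNReal.tsum_mul_left, ← ENNReal.tsum_mul_right]
  refine ENNReal.tsum_le_tsum fun D => ?_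
  rw [Set.inter_right_comm, hdet.inter_Cyl]
  split_ifs with hD
  · exact markedLaw_Cyl_mul_le P hstat hγ hC hmix hL hrL κ hne (S_straightAt hD)
  · simp

/-- The events `H k`, that `S_{k+1}` is finite and `R` restarted there is infinite, are disjoint. If
all `S_k` were finite with positive probability, each `H k` would have probability bounded below by
`measure_S_mul_le`, and the sum would diverge. So some `S_k` is infinite. Straight pieces never
cease, hence this can only be due to an infinite `R` at the preceding index, and then `τ_1` is
finite. -/
lemma ae_T_one_ne_top (hstat : Stationary P) {r : ℕ} {γ C c₅ : ℝ} (hγ : 0 < γ) (hC : 0 < C)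
    (hmix : MixingCond P r γ C) {L : ℕ} (hL : 1 ≤ L) (hrL : r ≤ L) (κ : EllConst d)
    (hpos : markedLaw P κ (good c₅) ≠ 0) :
    ∀ᵐ φ ∂(markedLaw P κ), φ ∈ good c₅ → T c₅ L 1 φ ≠ ⊤ := by
  have hne : (good c₅ : Set (Trk d)).Nonempty := by
    by_contra h
    rw [Set.not_nonempty_iff_eq_empty] at h
    exact hpos (by rw [h]; simp)
  set e := ENNReal.ofReal (Real.exp (mixExp d γ C c₅ L)) with he
  set H : ℕ → Set (Trk d) := fun k =>
    ⋃ t : ℕ, {φ | S c₅ L (k + 1) φ = t} ∩ shiftT t ⁻¹' good c₅ with hH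
  have hSm : ∀ k t : ℕ, MeasurableSet {φ : Trk d | S c₅ L k φ = t} := fun k t =>
    (detBy_S c₅ L k t).measurableSet
  have hHt : ∀ k t : ℕ, MeasurableSet
      ({φ : Trk d | S c₅ L (k + 1) φ = t} ∩ shiftT t ⁻¹' good c₅) := fun k t =>
    (hSm _ t).inter (measurable_shiftT t (measurableSet_good c₅))
  have hSdisj : ∀ k, Pairwise (Function.onFun Disjoint
      fun t : ℕ => {φ : Trk d | S c₅ L (k + 1) φ = t}) := fun k s t hst =>
    Set.disjoint_left.mpr fun φ h h' => hst (by
      have : (s : ℕ∞) = t := Eq.trans (Eq.symm h) h'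
      exact_mod_cast this)
  have hk : ∀ k, markedLaw P κ (⋃ t : ℕ, {φ | S c₅ L (k + 1) φ = t}) *
      markedLaw P κ (good c₅) ≤ e * markedLaw P κ (H k) := by
    intro k
    rw [measure_iUnion (hSdisj k) fun t => hSm _ t, measure_iUnion (fun s t hst =>
      (hSdisj k hst).mono Set.inter_subset_left Set.inter_subset_left) (hHt k),
      ← ENNReal.tsum_mul_left, ← ENNReal.tsum_mul_right]
    exact ENNReal.tsum_le_tsum fun t =>
      measure_S_mul_le P hstat hγ hC hmix hL hrL κ hne k t
  have hHdisj : Pairwise (Function.onFun Disjoint H) := by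
    have key : ∀ k l, k < l → Disjoint (H k) (H l) := by
      intro k l hkl
      refine Set.disjoint_left.mpr fun φ h h' => ?_
      obtain ⟨t, ht, hg⟩ := Set.mem_iUnion.mp h
      obtain ⟨t', ht', -⟩ := Set.mem_iUnion.mp h'
      have h1 := (timeR_succ_eq_top_iff ht).mpr hg
      have h2 := S_top_of_lt (by omega : k + 1 < l + 1) h1
      exact ENat.natCast_ne_top t' (Eq.trans (Eq.symm ht') h2)
    intro k l hkl
    rcases lt_or_gt_of_ne hkl with h | h
    · exact key k l h
    · exact (key l k h).symm
  set Bad : Set (Trk d) := ⋂ k : ℕ, ⋃ t : ℕ, {φ | S c₅ L (k + 1) φ = t} with hBad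
  have hBad0 : markedLaw P κ Bad = 0 := by
    by_contra hne0
    have h1 : ∑' _ : ℕ, markedLaw P κ Bad * markedLaw P κ (good c₅) ≤ e := by
      calc ∑' _ : ℕ, markedLaw P κ Bad * markedLaw P κ (good c₅)
          ≤ ∑' k, e * markedLaw P κ (H k) := ENNReal.tsum_le_tsum fun k =>
            le_trans (by gcongr; exact Set.iInter_subset _ k) (hk k)
        _ = e * markedLaw P κ (⋃ k, H k) := by
            rw [ENNReal.tsum_mul_left, measure_iUnion hHdisj fun k =>
              MeasurableSet.iUnion (hHt k)]
        _ ≤ e := by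
            calc _ ≤ e * 1 := by gcongr; exact prob_le_one
              _ = e := mul_one e
    rw [ENNReal.tsum_const_eq_top_of_ne_zero (mul_ne_zero hne0 hpos)] at h1
    exact ENNReal.ofReal_ne_top (top_le_iff.mp h1)
  have hStr : ∀ᵐ φ ∂(markedLaw P κ), φ ∈ good c₅ →
      ∀ N, ∃ n, N ≤ n ∧ StraightAt L (liftCoins φ.2) φ.1 n := by
    refine (ae_markedLaw P ?_).mpr (Filter.Eventually.of_forall fun ω => ae_straightAt κ ω c₅ L)
    have : {φ : Trk d | φ ∈ good c₅ → ∀ N, ∃ n, N ≤ n ∧ StraightAt L (liftCoins φ.2) φ.1 n} =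
        (good c₅)ᶜ ∪ ⋂ N : ℕ, ⋃ n, ⋃ _ : N ≤ n, {φ | StraightAt L (liftCoins φ.2) φ.1 n} := by
      ext φ
      simp only [Set.mem_ofPred_eq, Set.mem_union, Set.mem_compl_iff, Set.mem_iInter,
        Set.mem_iUnion, exists_prop]
      tauto
    rw [this]
    exact (measurableSet_good c₅).compl.union (MeasurableSet.iInter fun N =>
      MeasurableSet.iUnion fun n => MeasurableSet.iUnion fun _ =>
        (detBy_straightAt L n).measurableSet)
  filter_upwards [hStr, measure_eq_zero_iff_ae_notMem.mp hBad0] with φ hφ hφB hg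
  classical
  have hex : ∃ k : ℕ, S c₅ L (k + 1) φ = ⊤ := by
    by_contra hcon
    push Not at hcon
    refine hφB (Set.mem_iInter.mpr fun k => Set.mem_iUnion.mpr ?_)
    obtain ⟨t, ht⟩ := ENat.ne_top_iff_exists.mp (hcon k)
    exact ⟨t, ht.symm⟩
  -- The search for a straight piece from any finite time succeeds. In particular `S_1`, searched
  -- for from time `0`, is finite.
  have hnext : ∀ m : ℕ, nextS L (liftCoins φ.2) φ.1 m ≠ ⊤ := by
    intro m hm
    obtain ⟨n, hn, hs⟩ := hφ hg m
    exact (firstTime_eq_top_iff _).mp hm n ⟨by exact_mod_cast hn, hs⟩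
  have hspec := Nat.find_spec hex
  rcases Nat.eq_zero_or_pos (Nat.find hex) with h0 | h0
  · rw [h0] at hspec
    exact absurd hspec (hnext 0)
  · obtain ⟨k, hk'⟩ : ∃ k, Nat.find hex = k + 1 := ⟨Nat.find hex - 1, by omega⟩
    have hmin := Nat.find_min hex (m := k) (by omega)
    obtain ⟨t, ht⟩ := ENat.ne_top_iff_exists.mp hmin
    rw [hk'] at hspec
    have hR : timeR c₅ L (liftCoins φ.2) φ.1 (k + 1) = ⊤ := by
      by_contra hR
      obtain ⟨m, hm⟩ := ENat.ne_top_iff_exists.mp hR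
      refine hnext m ?_
      rw [hm]; exact hspec
    have := T_one_eq_iff.mpr ⟨⟨k, ht.symm⟩, (timeR_succ_eq_top_iff ht.symm).mp hR⟩
    rw [this]
    exact ENat.natCast_ne_top t

/-- On a cylinder the shifted path has, up to a weight at most `1`, the law of the walk in the
shifted environment, whose average is `markedLaw` by stationarity. This makes null events null after
any deterministic time. -/
lemma markedLaw_shiftT_null (hstat : Stationary P) (κ : EllConst d) {E : Set (Trk d)}
    (hE : MeasurableSet E) (h0 : markedLaw P κ E = 0) (s : ℕ) :
    markedLaw P κ (shiftT s ⁻¹' E) = 0 := by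
  classical
  have hEs := measurable_shiftT (d := d) s hE
  have key : ∀ ψ : Trk d, markedLaw P κ (shiftT s ⁻¹' E ∩ Cyl s ψ) = 0 := by
    intro ψ
    rw [Set.inter_comm, markedLaw_apply P κ ((measurableSet_Cyl s ψ).inter hEs)]
    by_cases hψ : ψ.1 0 = 0
    · have h1 : ∫⁻ ω, markedKernel κ (shiftEnv (ψ.1 s) ω) E ∂P = 0 := by
        rw [lintegral_shiftEnv P hstat (ψ.1 s) (Kernel.measurable_coe _ hE),
          ← markedLaw_apply P κ hE, h0]
      refine le_antisymm (le_trans (lintegral_mono fun ω => ?_) h1.le) zero_le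
      rw [markedKernel_Cyl_inter_shift κ ω s hψ hE]
      exact mul_le_of_le_one_left' (wt_le_one κ ω s hψ)
    · refine le_antisymm (le_of_le_of_eq (lintegral_mono fun ω =>
        (measure_mono Set.inter_subset_left).trans ?_) lintegral_zero) zero_le
      rw [markedKernel_Cyl, if_neg hψ]
  rw [measure_eq_tsum_Cyl s, ENNReal.tsum_eq_zero]
  exact fun D => key _

/-- At `τ_n` the restarted path is good again. Its failing to regenerate is null at each
deterministic time, hence at the random time `τ_n`, which has countably many values. -/
lemma ae_T_ne_top (hstat : Stationary P) {r : ℕ} {γ C c₅ : ℝ} (hγ : 0 < γ) (hC : 0 < C)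
    (hmix : MixingCond P r γ C) {L : ℕ} (hL : 1 ≤ L) (hrL : r ≤ L) (κ : EllConst d)
    (hpos : markedLaw P κ (good c₅) ≠ 0) (n : ℕ) :
    ∀ᵐ φ ∂(markedLaw P κ), φ ∈ good c₅ → T c₅ L n φ ≠ ⊤ := by
  induction n with
  | zero =>
    refine Filter.Eventually.of_forall fun φ _ => ?_
    rw [T_zero]
    exact ENat.natCast_ne_top 0
  | succ n ih =>
    have h1 := ae_T_one_ne_top P hstat hγ hC hmix hL hrL κ hpos
    have hm : MeasurableSet (good c₅ ∩ {φ : Trk d | T c₅ L 1 φ = ⊤}) :=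
      (measurableSet_good c₅).inter (measurableSet_T_top c₅ L 1)
    have h2 : markedLaw P κ (good c₅ ∩ {φ : Trk d | T c₅ L 1 φ = ⊤}) = 0 := by
      rw [measure_eq_zero_iff_ae_notMem]
      filter_upwards [h1] with φ hφ hmem
      exact hφ hmem.1 hmem.2
    have h3 : ∀ s : ℕ, ∀ᵐ φ ∂(markedLaw P κ), shiftT s φ ∉
        (good c₅ ∩ {φ : Trk d | T c₅ L 1 φ = ⊤}) := fun s =>
      measure_eq_zero_iff_ae_notMem.mp (markedLaw_shiftT_null P hstat κ hm h2 s)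
    filter_upwards [ih, ae_all_iff.mpr h3] with φ hφ hφ3 hg
    obtain ⟨s, hs⟩ := T_ne_top_iff.mp (hφ hg)
    rw [T_succ hs]
    intro htop
    refine hφ3 s ⟨good_shift_of_T hg hs, ?_⟩
    show T c₅ L 1 (shiftT s φ) = ⊤
    cases h : T c₅ L 1 (shiftT s φ) with
    | top => rfl
    | coe u =>
      rw [h] at htop
      exact absurd htop (by exact_mod_cast ENat.natCast_ne_top (u + s))

end

section
variable {d : ℕ} [NeZero d]

/-! ### Decomposition at a regeneration time -/

/-- The marked paths from the origin with `R = ∞` and `τ_n = u`. -/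
def Reg (c₅ : ℝ) (L n u : ℕ) : Set (Trk d) := {φ | φ.1 0 = 0 ∧ φ ∈ good c₅ ∧ T c₅ L n φ = u}

/-- The data up to time `u` of the paths in `Reg c₅ L n u`. -/
abbrev RegDat (d : ℕ) [NeZero d] (c₅ : ℝ) (L n u : ℕ) : Type :=
  {D : Dat d u // (Reg c₅ L n u ∩ Cyl u (extend D)).Nonempty}

/-- A path with given data up to a regeneration time. -/
noncomputable def RegDat.rep {c₅ : ℝ} {L n u : ℕ} (D : RegDat d c₅ L n u) : Trk d := D.2.some

lemma RegDat.rep_mem {c₅ : ℝ} {L n u : ℕ} (D : RegDat d c₅ L n u) : D.rep ∈ Reg c₅ L n u :=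
  D.2.some_mem.1

lemma RegDat.Cyl_rep {c₅ : ℝ} {L n u : ℕ} (D : RegDat d c₅ L n u) :
    Cyl u D.rep = Cyl u (extend D.1) := Cyl_congr D.2.some_mem.2

lemma Reg.of_agree {c₅ : ℝ} {L n u : ℕ} {φ ψ : Trk d} (hψ : ψ ∈ Reg c₅ L n u)
    (h : AgreeTo u φ ψ) (hφ : shiftT u φ ∈ good c₅) :
    φ ∈ Reg c₅ L n u ∧ ∀ i ≤ n, T c₅ L i φ = T c₅ L i ψ := by
  obtain ⟨h1, h2⟩ := regeneration_determined hψ.2.1 hψ.2.2 h hφ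
  exact ⟨⟨(h.1 0 (Nat.zero_le _)).trans hψ.1, h1, (h2 n le_rfl).trans hψ.2.2⟩, h2⟩

lemma measurableSet_Reg (c₅ : ℝ) (L n u : ℕ) : MeasurableSet (Reg (d := d) c₅ L n u) := by
  have hX : Measurable fun φ : Trk d => φ.1 0 := (measurable_pi_apply 0).comp measurable_fst
  have h0 : MeasurableSet {φ : Trk d | φ.1 0 = 0} := hX (measurableSet_singleton (0 : Site d))
  exact h0.inter ((measurableSet_good c₅).inter (measurableSet_T_eq c₅ L n u))

/-- Whether `τ_n = u` and `R = ∞` is decided by the piece up to `u` and by goodness afterwards. The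
event thus splits into pieces to which the Markov property at the fixed time `u` applies, although
`τ_n` itself looks into the future. -/
lemma iUnion_RegDat (c₅ : ℝ) (L n u : ℕ) :
    Reg (d := d) c₅ L n u = ⋃ D : RegDat d c₅ L n u, Cyl u D.rep ∩ shiftT u ⁻¹' good c₅ := by
  ext φ
  rw [Set.mem_iUnion]
  constructor
  · intro hφ
    have hc : φ ∈ Cyl u (extend (proj u φ)) := agreeTo_iff_proj.mpr (proj_extend _).symm
    have hD : (Reg c₅ L n u ∩ Cyl u (extend (proj u φ))).Nonempty := ⟨φ, hφ, hc⟩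
    have hg : shiftT u φ ∈ good c₅ := good_shift_of_T (L := L) (n := n) hφ.2.1 hφ.2.2
    have hc' : φ ∈ Cyl u (RegDat.rep ⟨proj u φ, hD⟩) := by
      rw [RegDat.Cyl_rep]
      exact hc
    exact ⟨⟨proj u φ, hD⟩, hc', hg⟩
  · rintro ⟨D, h1, h2⟩
    exact (Reg.of_agree D.rep_mem h1 h2).1

lemma pairwise_disjoint_RegDat (c₅ : ℝ) (L n u : ℕ) :
    Pairwise (Function.onFun Disjoint
      fun D : RegDat d c₅ L n u => Cyl u D.rep ∩ shiftT u ⁻¹' good c₅) := by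
  intro D D' hD
  refine Disjoint.mono Set.inter_subset_left Set.inter_subset_left ?_
  rw [RegDat.Cyl_rep, RegDat.Cyl_rep]
  exact pairwise_disjoint_Cyl u fun h => hD (Subtype.ext h)

lemma measurableSet_Cyl_inter_good (c₅ : ℝ) (u : ℕ) (ψ : Trk d) :
    MeasurableSet (Cyl u ψ ∩ shiftT u ⁻¹' good c₅) :=
  (measurableSet_Cyl u ψ).inter (measurable_shiftT u (measurableSet_good c₅))

lemma lintegral_Reg (c₅ : ℝ) (L n u : ℕ) (μ : Measure (Trk d)) (f : Trk d → ℝ≥0∞) :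
    ∫⁻ φ in Reg c₅ L n u, f φ ∂μ =
      ∑' D : RegDat d c₅ L n u, ∫⁻ φ in Cyl u D.rep ∩ shiftT u ⁻¹' good c₅, f φ ∂μ := by
  rw [iUnion_RegDat, lintegral_iUnion (fun D => measurableSet_Cyl_inter_good c₅ u _)
    (pairwise_disjoint_RegDat c₅ L n u)]

/-- The first `n` blocks. -/
noncomputable def blks (c₅ : ℝ) (L n : ℕ) (ω : Env d) (φ : Trk d) : Fin n → Block d :=
  fun i => blk c₅ L i ω φ

lemma measurable_blks (c₅ : ℝ) (L n : ℕ) :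
    Measurable fun p : Env d × Trk d => blks c₅ L n p.1 p.2 :=
  measurable_pi_lambda _ fun i => measurable_blk c₅ L i

lemma blks_congr {c₅ : ℝ} {L n u : ℕ} (ω : Env d) {φ ψ : Trk d}
    (h : ∀ i ≤ n, T c₅ L i φ = T c₅ L i ψ) (hu : T c₅ L n ψ = u) (ha : AgreeTo u φ ψ) :
    blks c₅ L n ω φ = blks c₅ L n ω ψ := by
  funext i
  obtain ⟨a, w, h1, -, h2⟩ := T_split (Nat.succ_le_of_lt i.2) hu
  exact blk_congr ω (h i i.2.le) (h (i + 1) i.2) h1 (ha.mono (by omega))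

/-- The paths with `R = ∞` whose first block exists and is in `B`. -/
def firstBlockIn (c₅ : ℝ) (L : ℕ) (B : Set (Block d)) (ω : Env d) : Set (Trk d) :=
  {φ | φ ∈ good c₅ ∧ T c₅ L 1 φ ≠ ⊤ ∧ blk c₅ L 0 ω φ ∈ B}

lemma measurableSet_firstBlockIn (c₅ : ℝ) (L : ℕ) {B : Set (Block d)} (hB : MeasurableSet B)
    (ω : Env d) : MeasurableSet (firstBlockIn c₅ L B ω) :=
  (measurableSet_good c₅).inter ((measurableSet_T_top c₅ L 1).compl.inter
    (((measurable_blk c₅ L 0).comp (measurable_const.prodMk measurable_id)) hB))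

/-- Integrals over the paths with `τ_n = u` of functions of the first `n` blocks. -/
lemma lintegral_Reg_blks (κ : EllConst d) (ω : Env d) (c₅ : ℝ) (L n u : ℕ)
    (G : (Fin n → Block d) → ℝ≥0∞) :
    ∫⁻ φ in Reg c₅ L n u, G (blks c₅ L n ω φ) ∂(markedKernel κ ω) =
      ∑' D : RegDat d c₅ L n u, wt κ ω u D.rep * G (blks c₅ L n ω D.rep) *
        markedKernel κ (shiftEnv (D.rep.1 u) ω) (good c₅) := by
  rw [lintegral_Reg]
  refine tsum_congr fun D => ?_
  have hmem := D.rep_mem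
  have hgm := measurableSet_good (d := d) c₅
  have h1 : ∫⁻ φ in Cyl u D.rep ∩ shiftT u ⁻¹' good c₅, G (blks c₅ L n ω φ) ∂(markedKernel κ ω) =
      ∫⁻ φ in Cyl u D.rep ∩ shiftT u ⁻¹' good c₅, G (blks c₅ L n ω D.rep) ∂(markedKernel κ ω) := by
    refine setLIntegral_congr_fun (measurableSet_Cyl_inter_good c₅ u _) fun φ hφ => ?_
    have h := Reg.of_agree hmem hφ.1 hφ.2
    simp only [blks_congr ω h.2 hmem.2.2 hφ.1]
  rw [h1, setLIntegral_const, markedKernel_Cyl_inter_shift κ ω u hmem.1 hgm]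
  ring

/-- Integrals over the paths with `τ_n = u` of functions of the first `n` blocks, the next block
being in `B`. -/
lemma lintegral_Reg_blks_next (κ : EllConst d) (ω : Env d) (c₅ : ℝ) (L n u : ℕ)
    (G : (Fin n → Block d) → ℝ≥0∞) {B : Set (Block d)}
    (hB : MeasurableSet B) :
    ∫⁻ φ in Reg c₅ L n u ∩ {φ | T c₅ L (n + 1) φ ≠ ⊤ ∧ blk c₅ L n ω φ ∈ B},
        G (blks c₅ L n ω φ) ∂(markedKernel κ ω) =
      ∑' D : RegDat d c₅ L n u, wt κ ω u D.rep * G (blks c₅ L n ω D.rep) *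
        markedKernel κ (shiftEnv (D.rep.1 u) ω)
          (firstBlockIn c₅ L B (shiftEnv (D.rep.1 u) ω)) := by
  classical
  have hgm := measurableSet_good (d := d) c₅
  set N : Set (Trk d) := {φ | T c₅ L (n + 1) φ ≠ ⊤ ∧ blk c₅ L n ω φ ∈ B} with hN
  have hNm : MeasurableSet N := (measurableSet_T_top c₅ L (n + 1)).compl.inter
    (((measurable_blk c₅ L n).comp (measurable_const.prodMk measurable_id)) hB)
  rw [Set.inter_comm, ← Measure.restrict_restrict hNm, ← lintegral_indicator hNm, lintegral_Reg]
  refine tsum_congr fun D => ?_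
  have hmem := D.rep_mem
  have hFm := measurableSet_firstBlockIn c₅ L hB (shiftEnv (D.rep.1 u) ω)
  have h1 : ∫⁻ φ in Cyl u D.rep ∩ shiftT u ⁻¹' good c₅,
        N.indicator (fun φ => G (blks c₅ L n ω φ)) φ ∂(markedKernel κ ω) =
      ∫⁻ φ in Cyl u D.rep ∩ shiftT u ⁻¹' good c₅,
        (shiftT u ⁻¹' firstBlockIn c₅ L B (shiftEnv (D.rep.1 u) ω)).indicator
          (fun _ => G (blks c₅ L n ω D.rep)) φ ∂(markedKernel κ ω) := by
    refine setLIntegral_congr_fun (measurableSet_Cyl_inter_good c₅ u _) fun φ hφ => ?_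
    have h := Reg.of_agree hmem hφ.1 hφ.2
    have hT := T_succ h.1.2.2
    -- The block after `τ_n = u` is the first block of the restarted path in the shifted
    -- environment.
    have hiff : φ ∈ N ↔ shiftT u φ ∈ firstBlockIn c₅ L B (shiftEnv (D.rep.1 u) ω) := by
      cases hb : T c₅ L 1 (shiftT u φ) with
      | top =>
        rw [hb, top_add] at hT
        exact ⟨fun hc => absurd hT hc.1, fun hc => absurd hb hc.2.1⟩
      | coe b =>
        have hbs := blk_shift ω h.1.2.2 (i := 0) hb
        rw [add_zero, hφ.1.1 u le_rfl] at hbs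
        have hfin : T c₅ L (n + 1) φ ≠ ⊤ := by
          rw [hT, hb]
          exact_mod_cast ENat.natCast_ne_top (b + u)
        constructor
        · rintro ⟨-, hc⟩
          exact ⟨hφ.2, by rw [hb]; exact ENat.natCast_ne_top b, hbs ▸ hc⟩
        · rintro ⟨-, -, hc⟩
          exact ⟨hfin, by rw [hbs]; exact hc⟩
    simp only [Set.indicator_apply, hiff, Set.mem_preimage, blks_congr ω h.2 hmem.2.2 hφ.1]
  have hsm := measurable_shiftT (d := d) u hFm
  rw [h1, lintegral_indicator_const hsm, Measure.restrict_apply hsm]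
  have h2 : shiftT u ⁻¹' firstBlockIn c₅ L B (shiftEnv (D.rep.1 u) ω) ∩
      (Cyl u D.rep ∩ shiftT u ⁻¹' good c₅) =
      Cyl u D.rep ∩ shiftT u ⁻¹' firstBlockIn c₅ L B (shiftEnv (D.rep.1 u) ω) := by
    ext φ
    constructor
    · rintro ⟨a, b, -⟩; exact ⟨b, a⟩
    · rintro ⟨a, b⟩; exact ⟨b, a, b.1⟩
  rw [h2, markedKernel_Cyl_inter_shift κ ω u hmem.1 hFm]
  ring

end

section
variable {d : ℕ} [NeZero d]

/-! ### Geometry of the regeneration blocks -/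

lemma T_step {c₅ : ℝ} {L m a b : ℕ} {φ : Trk d} (ha : T c₅ L m φ = a)
    (hb : T c₅ L (m + 1) φ = b) :
    ∃ w, b = a + w ∧ StraightAt L (liftCoins (shiftT a φ).2) (shiftT a φ).1 w := by
  rw [T_succ ha] at hb
  cases h : T c₅ L 1 (shiftT a φ) with
  | top => rw [h, top_add] at hb; exact absurd hb.symm (ENat.natCast_ne_top b)
  | coe w =>
    rw [h] at hb
    have hb' : w + a = b := by exact_mod_cast hb
    exact ⟨w, by omega, T_one_straightAt h⟩

lemma T_add_le {c₅ : ℝ} {L m a b : ℕ} {φ : Trk d} (ha : T c₅ L m φ = a)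
    (hb : T c₅ L (m + 1) φ = b) : a + L ≤ b := by
  obtain ⟨w, rfl, hw⟩ := T_step ha hb
  have := hw.1
  omega

lemma level_block_le {c₅ : ℝ} {L m a b i : ℕ} {φ : Trk d} (ha : T c₅ L m φ = a)
    (hb : T c₅ L (m + 1) φ = b) (hai : a ≤ i) (hib : i ≤ b - L) :
    level (φ.1 i) ≤ level (φ.1 b) - L := by
  obtain ⟨w, rfl, hw⟩ := T_step ha hb
  have := hw.level_le (i := i - a) (by omega)
  simp only [shiftT, level_sub, show a + (i - a) = i by omega] at this
  linarith

lemma coin_straight {c₅ : ℝ} {L m a b i : ℕ} {φ : Trk d} (ha : T c₅ L m φ = a)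
    (hb : T c₅ L (m + 1) φ = b) (hbi : b - L ≤ i) (hib : i < b) : φ.2 i = true := by
  obtain ⟨w, rfl, hw⟩ := T_step ha hb
  have h1 := hw.1
  have := (hw.2.2 (a + w - i) (by omega) (by omega)).1
  simpa only [liftCoins, shiftT, show a + (w - (a + w - i)) = i by omega] using this

/-- Each block ends with `L` straight steps starting at a new maximum, so it rises by at least `L`
levels. This produces the factor `k` in the final exponent. -/
lemma T_level_le {c₅ : ℝ} {L m a : ℕ} {φ : Trk d} (ha : T c₅ L m φ = a) (k : ℕ) {b : ℕ}
    (hb : T c₅ L (m + k) φ = b) : level (φ.1 a) + k * L ≤ level (φ.1 b) := by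
  induction k generalizing b with
  | zero =>
    rw [add_zero, ha] at hb
    have : a = b := by exact_mod_cast hb
    rw [this]; simp
  | succ k ih =>
    obtain ⟨s, w, hs, -, -⟩ := T_split (Nat.le_succ (m + k)) hb
    have h1 := ih hs
    have h2 := level_block_le hs hb le_rfl (by have := T_add_le hs hb; omega)
    push_cast
    linarith

lemma exists_block {c₅ : ℝ} {L n u i : ℕ} {φ : Trk d} (hu : T c₅ L n φ = u) (hi : i < u) :
    ∃ m < n, ∃ a b : ℕ, T c₅ L m φ = a ∧ T c₅ L (m + 1) φ = b ∧ a ≤ i ∧ i < b := by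
  induction n generalizing u with
  | zero =>
    rw [T_zero] at hu
    have : u = 0 := by exact_mod_cast hu.symm
    omega
  | succ n ih =>
    obtain ⟨s, w, hs, -, -⟩ := T_split (Nat.le_succ n) hu
    rcases lt_or_ge i s with h | h
    · obtain ⟨m, hm, h'⟩ := ih hs h
      exact ⟨m, by omega, h'⟩
    · exact ⟨n, Nat.lt_succ_self n, s, u, hs, hu, h, hi⟩

/-- The sites whose environment is recorded by the first `n` blocks. -/
def Vis (c₅ : ℝ) (L n : ℕ) (φ : Trk d) : Set (Site d) :=
  {x | ∃ m < n, ∃ a b : ℕ, T c₅ L m φ = a ∧ T c₅ L (m + 1) φ = b ∧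
    ∃ i, a ≤ i ∧ i ≤ b - L ∧ x = φ.1 i}

/-- In every block all sites are recorded except those of the final straight steps, where the coins
are `1`. The weight of a path up to a regeneration time thus depends on recorded sites only. -/
lemma mem_Vis_of_coin {c₅ : ℝ} {L n u i : ℕ} {φ : Trk d} (hu : T c₅ L n φ = u) (hi : i < u)
    (hc : φ.2 i = false) : φ.1 i ∈ Vis c₅ L n φ := by
  obtain ⟨m, hm, a, b, ha, hb, hai, hib⟩ := exists_block hu hi
  refine ⟨m, hm, a, b, ha, hb, i, hai, ?_, rfl⟩
  by_contra hcon
  rw [coin_straight ha hb (by omega) hib] at hc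
  exact absurd hc (by simp)

lemma exists_index_of_mem_Vis {c₅ : ℝ} {L n u : ℕ} {φ : Trk d} (hu : T c₅ L n φ = u)
    {x : Site d} (hx : x ∈ Vis c₅ L n φ) : ∃ i ≤ u, x = φ.1 i := by
  obtain ⟨m, hm, a, b, ha, hb, i, hai, hib, rfl⟩ := hx
  have := T_mono (Nat.succ_le_of_lt hm) hb hu
  exact ⟨i, by omega, rfl⟩

lemma level_Vis_le {c₅ : ℝ} {L n u : ℕ} {φ : Trk d} (hu : T c₅ L n φ = u) {x : Site d}
    (hx : x ∈ Vis c₅ L n φ) : level x ≤ level (φ.1 u) - L := by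
  obtain ⟨m, hm, a, b, ha, hb, i, hai, hib, rfl⟩ := hx
  have h1 := level_block_le ha hb hai hib
  obtain ⟨k, rfl⟩ : ∃ k, n = m + 1 + k := ⟨n - (m + 1), by omega⟩
  have h2 := T_level_le hb k hu
  have : (0 : ℤ) ≤ k * L := by positivity
  linarith

/-- The sites recorded by `m + k` blocks are recorded by the last `k` blocks or lie far below. -/
lemma mem_Vis_add {c₅ : ℝ} {L m k s : ℕ} {φ : Trk d} (hs : T c₅ L m φ = s)
    {x : Site d} (hx : x ∈ Vis c₅ L (m + k) φ) :
    x - φ.1 s ∈ Vis c₅ L k (shiftT s φ) ∨ level (x - φ.1 s) ≤ -L := by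
  obtain ⟨l, hl, a, b, ha, hb, i, hai, hib, rfl⟩ := hx
  rcases lt_or_ge l m with h | h
  · right
    have h1 : φ.1 i ∈ Vis c₅ L m φ := ⟨l, h, a, b, ha, hb, i, hai, hib, rfl⟩
    have := level_Vis_le hs h1
    rw [level_sub]
    linarith
  · left
    obtain ⟨j, rfl⟩ : ∃ j, l = m + j := ⟨l - m, by omega⟩
    have hsa := T_mono h hs ha
    have hab := T_add_le ha hb
    have key : ∀ (j c : ℕ), T c₅ L (m + j) φ = c → T c₅ L j (shiftT s φ) = (c - s : ℕ) := by
      intro j c hc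
      have hsc := T_mono (Nat.le_add_right m j) hs hc
      rw [T_add hs] at hc
      cases h : T c₅ L j (shiftT s φ) with
      | top => rw [h, top_add] at hc; exact absurd hc.symm (ENat.natCast_ne_top c)
      | coe w =>
        rw [h] at hc
        have : w + s = c := by exact_mod_cast hc
        rw [show c - s = w by omega]
    refine ⟨j, by omega, a - s, b - s, key j a ha, key (j + 1) b hb, i - s, by omega, by omega, ?_⟩
    simp only [shiftT, show s + (i - s) = i by omega]

/-! ### The blocks and the environment at the recorded sites -/

lemma measurable_blks_shiftEnv {c₅ : ℝ} {L n u : ℕ} {φ : Trk d} (hu : T c₅ L n φ = u)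
    (y : Site d) {Λ : Set (Site d)} (hΛ : ∀ x ∈ Vis c₅ L n φ, x + y ∈ Λ) :
    Measurable[sigmaAlg Λ] fun ω => blks c₅ L n (shiftEnv y ω) φ := by
  refine @measurable_pi_lambda _ _ _ (sigmaAlg Λ) _ _ fun m => ?_
  obtain ⟨b, w, hb, -, -⟩ := T_split (Nat.succ_le_of_lt m.2) hu
  obtain ⟨a, w', ha, -, -⟩ := T_split (Nat.le_succ m.1) hb
  have hab := T_add_le ha hb
  have e : (fun ω => blks c₅ L n (shiftEnv y ω) φ m) = fun ω =>
      (Sigma.mk ((List.range (b - a - L + 1)).map fun i => φ.1 (i + a) - φ.1 a)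
        ((fun x => ω (x + φ.1 a + y)), φ.1 b - φ.1 a, b - a) : Block d) := by
    funext ω
    show blk c₅ L m (shiftEnv y ω) φ = _
    rw [blk_eq_pieceBlock, ha, hb]
    rfl
  rw [e]
  have h1 : ∀ p : List (Site d), Measurable
      fun w : ({x : Site d // x ∈ p} → ProbVec d) × Site d × ℕ => (⟨p, w⟩ : Block d) :=
    fun p _ hs => by exact measurableSet_block_iff.mp hs p
  refine (h1 _).comp (@Measurable.prodMk _ (sigmaAlg Λ) _ _ _ _ _ _ ?_
    (@measurable_const _ _ _ (sigmaAlg Λ) _))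
  refine @measurable_pi_lambda _ _ _ (sigmaAlg Λ) _ _ fun x => ?_
  refine measurable_sigmaAlg_apply ?_
  obtain ⟨i, hi, hx⟩ := List.mem_map.mp x.2
  have := List.mem_range.mp hi
  refine hΛ _ ⟨m, m.2, a, b, ha, hb, i + a, by omega, by omega, ?_⟩
  rw [← hx]; abel

/-- The environment recorded by a block at a site. -/
noncomputable def lookup (x : Site d) (b : Block d) : ProbVec d := by
  classical exact if h : x ∈ b.1 then b.2.1 ⟨x, h⟩ else uniformVec d

lemma measurable_lookup (x : Site d) : Measurable (lookup x) := by
  intro s hs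
  rw [measurableSet_block_iff]
  intro p
  by_cases h : x ∈ p
  · have : Sigma.mk p ⁻¹' (lookup x ⁻¹' s) =
        (fun w : ({x : Site d // x ∈ p} → ProbVec d) × Site d × ℕ => w.1 ⟨x, h⟩) ⁻¹' s := by
      ext w; simp [lookup, h]
    rw [this]
    exact ((measurable_pi_apply _).comp measurable_fst) hs
  · have : Sigma.mk p ⁻¹' (lookup x ⁻¹' s) =
        (fun _ : ({x : Site d // x ∈ p} → ProbVec d) × Site d × ℕ => uniformVec d) ⁻¹' s := by
      ext w; simp [lookup, h]
    rw [this]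
    exact measurable_const hs

/-- The environment at a recorded site can be read off from a block that contains it. Together with
`measurable_blks_shiftEnv` this means that, along a fixed path, knowing the blocks is the same as
knowing the environment on `Vis`. -/
lemma sigmaAlg_Vis_le (c₅ : ℝ) (L n : ℕ) (φ : Trk d) :
    sigmaAlg (Vis c₅ L n φ) ≤
      MeasurableSpace.comap (fun ω => blks c₅ L n ω φ) inferInstance := by
  refine measurable_sigmaAlg_iff_le ?_
  rintro x ⟨m, hm, a, b, ha, hb, i, hai, hib, rfl⟩
  have hab := T_add_le ha hb
  have e : (fun ω : Env d => ω (φ.1 i)) =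
      (fun B : Fin n → Block d => lookup (φ.1 i - φ.1 a) (B ⟨m, hm⟩)) ∘
        fun ω => blks c₅ L n ω φ := by
    funext ω
    show _ = lookup (φ.1 i - φ.1 a) (blk c₅ L m ω φ)
    rw [blk_eq_pieceBlock, ha, hb]
    have hmem : φ.1 i - φ.1 a ∈
        (List.range (b - a - L + 1)).map fun i => φ.1 (i + a) - φ.1 a :=
      List.mem_map.mpr ⟨i - a, List.mem_range.mpr (by omega), by
        rw [show i - a + a = i by omega]⟩
    have h2 : (pieceBlock L (ENat.toNat a) (ENat.toNat b) ω φ).1 =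
        (List.range (b - a - L + 1)).map fun i => φ.1 (i + a) - φ.1 a := rfl
    unfold lookup
    rw [dif_pos (by rw [h2]; exact hmem)]
    show ω (φ.1 i) = ω (φ.1 i - φ.1 a + φ.1 a)
    rw [sub_add_cancel]
  rw [e]
  have h3 : Measurable fun B : Fin n → Block d => lookup (φ.1 i - φ.1 a) (B ⟨m, hm⟩) :=
    (measurable_lookup _).comp (measurable_pi_apply _)
  exact h3.comp (comap_measurable _)

lemma exists_eq_comp_blks {c₅ : ℝ} {L n : ℕ} {φ : Trk d} {v : Env d → ℝ≥0∞}
    (hv : Measurable[sigmaAlg (Vis c₅ L n φ)] v) :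
    ∃ g : (Fin n → Block d) → ℝ≥0∞, Measurable g ∧ ∀ ω, v ω = g (blks c₅ L n ω φ) := by
  obtain ⟨g, hg, h⟩ := (hv.mono (sigmaAlg_Vis_le c₅ L n φ) le_rfl).exists_eq_measurable_comp
  exact ⟨g, hg, fun ω => congrFun h ω⟩

/-! ### Mixing for the first block -/

variable (P : Measure (Env d)) [IsProbabilityMeasure P]

/-- The path up to `τ_1` determines the block in a given environment, so the condition on the block
comes out as a factor of each piece. -/
lemma markedKernel_firstBlockIn (κ : EllConst d) (c₅ : ℝ) (L : ℕ) {B : Set (Block d)}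
    (hB : MeasurableSet B) (ω : Env d) :
    markedKernel κ ω (firstBlockIn c₅ L B ω) = ∑' u : ℕ, ∑' D : RegDat d c₅ L 1 u,
      B.indicator 1 (blks c₅ L 1 ω D.rep 0) *
        markedKernel κ ω (Cyl u D.rep ∩ shiftT u ⁻¹' good c₅) := by
  classical
  have hm : Measurable fun φ : Trk d => blks c₅ L 1 ω φ 0 :=
    (measurable_blk c₅ L 0).comp (measurable_const.prodMk measurable_id)
  have hdisj : Pairwise (Function.onFun Disjoint fun u : ℕ => Reg (d := d) c₅ L 1 u) := by
    intro u v huv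
    refine Set.disjoint_left.mpr fun φ h h' => huv ?_
    have := h.2.2.symm.trans h'.2.2
    exact_mod_cast this
  have h1 : markedKernel κ ω (firstBlockIn c₅ L B ω) =
      ∫⁻ φ in ⋃ u : ℕ, Reg c₅ L 1 u, B.indicator 1 (blks c₅ L 1 ω φ 0) ∂(markedKernel κ ω) := by
    rw [← lintegral_indicator_one (measurableSet_firstBlockIn c₅ L hB ω),
      ← lintegral_indicator (MeasurableSet.iUnion fun u => measurableSet_Reg c₅ L 1 u)]
    refine lintegral_congr_ae ?_
    filter_upwards [ae_start κ ω] with φ hφ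
    have h2 : φ ∈ ⋃ u : ℕ, Reg c₅ L 1 u ↔ φ ∈ good c₅ ∧ T c₅ L 1 φ ≠ ⊤ := by
      rw [Set.mem_iUnion, T_ne_top_iff]
      exact ⟨fun ⟨u, h⟩ => ⟨h.2.1, u, h.2.2⟩, fun ⟨h, u, h'⟩ => ⟨u, hφ, h, h'⟩⟩
    have h3 : φ ∈ firstBlockIn c₅ L B ω ↔
        (φ ∈ good c₅ ∧ T c₅ L 1 φ ≠ ⊤) ∧ blks c₅ L 1 ω φ 0 ∈ B := and_assoc.symm
    simp only [Set.indicator_apply, h2, h3]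
    by_cases hA : φ ∈ good c₅ ∧ T c₅ L 1 φ ≠ ⊤
    · simp [hA]
    · simp [hA]
  rw [h1, lintegral_iUnion (fun u => measurableSet_Reg c₅ L 1 u) hdisj]
  refine tsum_congr fun u => ?_
  rw [lintegral_Reg_blks κ ω c₅ L 1 u (fun b => B.indicator 1 (b 0))]
  refine tsum_congr fun D => ?_
  rw [markedKernel_Cyl_inter_shift κ ω u D.rep_mem.1 (measurableSet_good c₅)]
  ring

/-- After splitting by the path up to `τ_1 = u`, each term falls under `mix_Cyl_good`: the endpoint
is a record, `R > u`, and the indicator of the block reads only sites of this path. -/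
lemma mix_firstBlockIn {r : ℕ} {γ C c₅ : ℝ} (hγ : 0 < γ) (hC : 0 < C) (hmix : MixingCond P r γ C)
    {L M : ℕ} (hL : 1 ≤ L) (hrL : r ≤ L) (hLM : L ≤ M) (y : Site d) {U Λ : Set (Site d)}
    (hU : ∀ x ∈ U, level x ≤ level y - L)
    (hΛ : ∀ x ∈ Λ, x ∈ U ∨ level x ≤ level y - M) (κ : EllConst d) {B : Set (Block d)}
    (hB : MeasurableSet B) :
    Mix P U Λ (ENNReal.ofReal (Real.exp (mixExp d γ C c₅ M))) fun ω =>
      markedKernel κ (shiftEnv y ω) (firstBlockIn c₅ L B (shiftEnv y ω)) := by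
  have hfun : (fun ω => markedKernel κ (shiftEnv y ω) (firstBlockIn c₅ L B (shiftEnv y ω))) =
      fun ω => ∑' u : ℕ, ∑' D : RegDat d c₅ L 1 u,
        B.indicator 1 (blks c₅ L 1 (shiftEnv y ω) D.rep 0) *
          markedKernel κ (shiftEnv y ω) (Cyl u D.rep ∩ shiftT u ⁻¹' good c₅) :=
    funext fun ω => markedKernel_firstBlockIn κ c₅ L hB _
  rw [hfun]
  refine Mix.tsum P fun u => Mix.tsum P fun D => ?_
  have hmem := D.rep_mem
  refine mix_Cyl_good P hγ hC hmix hL hrL hLM y hU hΛ κ (T_one_straightAt hmem.2.2).record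
    ((mem_good_iff c₅ _).mp hmem.2.1 u) (a := fun ω =>
      B.indicator 1 (blks c₅ L 1 (shiftEnv y ω) D.rep 0)) ?_ fun ω => ?_
  · have h1 := measurable_blks_shiftEnv hmem.2.2 y (Λ := {x | ∃ i ≤ u, x = D.rep.1 i + y})
      fun x hx => by
        obtain ⟨i, hi, rfl⟩ := exists_index_of_mem_Vis hmem.2.2 hx
        exact ⟨i, hi, rfl⟩
    have h2 : Measurable fun b : Fin 1 → Block d => B.indicator (1 : Block d → ℝ≥0∞) (b 0) :=
      (measurable_one.indicator hB).comp (measurable_pi_apply 0)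
    exact h2.comp h1
  · exact Set.indicator_le_self' (fun _ _ => zero_le) _

end

section
variable {d : ℕ} [NeZero d] (P : Measure (Env d)) [IsProbabilityMeasure P]

/-! ### Integrals under the conditioned measure -/

lemma measurable_wt (κ : EllConst d) (t : ℕ) (ψ : Trk d) : Measurable fun ω => wt κ ω t ψ := by
  have h := measurable_wt_shift κ (Λ := Set.univ) 0 t ψ fun _ _ _ => Set.mem_univ _
  simp only [shiftEnv_zero] at h
  exact h.mono (sigmaAlg_le _) le_rfl

lemma measurable_markedKernel_firstBlockIn (κ : EllConst d) (c₅ : ℝ) (L : ℕ) {B : Set (Block d)}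
    (hB : MeasurableSet B) :
    Measurable fun ω => markedKernel κ ω (firstBlockIn c₅ L B ω) := by
  have hE : MeasurableSet {p : Env d × Trk d | p.2 ∈ firstBlockIn c₅ L B p.1} :=
    (measurable_snd (measurableSet_good c₅)).inter
      ((measurable_snd (measurableSet_T_top c₅ L 1).compl).inter (measurable_blk c₅ L 0 hB))
  exact Kernel.measurable_kernel_prodMk_left hE

lemma measurable_blks_left (c₅ : ℝ) (L n : ℕ) (φ : Trk d) :
    Measurable fun ω : Env d => blks c₅ L n ω φ :=
  (measurable_blks c₅ L n).comp (measurable_id.prodMk measurable_const)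

lemma ae_exists_mem_Reg {κ : EllConst d} {c₅ : ℝ} {L n : ℕ}
    (hfin : ∀ᵐ φ ∂(markedLaw P κ), φ ∈ good c₅ → T c₅ L n φ ≠ ⊤) :
    ∀ᵐ ω ∂P, ∀ᵐ φ ∂(markedKernel κ ω), φ ∈ good c₅ ↔ φ ∈ ⋃ u, Reg c₅ L n u := by
  have hm : MeasurableSet {φ : Trk d | φ ∈ good c₅ → T c₅ L n φ ≠ ⊤} := by
    have : {φ : Trk d | φ ∈ good c₅ → T c₅ L n φ ≠ ⊤} =
        (good c₅)ᶜ ∪ {φ | T c₅ L n φ = ⊤}ᶜ := by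
      ext φ
      simp only [Set.mem_ofPred_eq, Set.mem_union, Set.mem_compl_iff]
      tauto
    rw [this]
    exact (measurableSet_good c₅).compl.union (measurableSet_T_top c₅ L n).compl
  filter_upwards [(ae_markedLaw P hm).mp hfin] with ω hω
  filter_upwards [hω, ae_start κ ω] with φ hφ h0
  rw [Set.mem_iUnion]
  constructor
  · intro hg
    obtain ⟨u, hu⟩ := T_ne_top_iff.mp (hφ hg)
    exact ⟨u, h0, hg, hu⟩
  · rintro ⟨u, hu⟩
    exact hu.2.1

lemma pairwise_disjoint_Reg (c₅ : ℝ) (L n : ℕ) :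
    Pairwise (Function.onFun Disjoint fun u : ℕ => Reg (d := d) c₅ L n u) := by
  intro u v huv
  refine Set.disjoint_left.mpr fun φ h h' => huv ?_
  have := h.2.2.symm.trans h'.2.2
  exact_mod_cast this

lemma setLIntegral_good_eq_tsum {κ : EllConst d} {c₅ : ℝ} {L n : ℕ}
    (hfin : ∀ᵐ φ ∂(markedLaw P κ), φ ∈ good c₅ → T c₅ L n φ ≠ ⊤) (f : Env d → Trk d → ℝ≥0∞) :
    ∀ᵐ ω ∂P, ∫⁻ φ in good c₅, f ω φ ∂(markedKernel κ ω) =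
      ∑' u : ℕ, ∫⁻ φ in Reg c₅ L n u, f ω φ ∂(markedKernel κ ω) := by
  filter_upwards [ae_exists_mem_Reg P hfin] with ω hω
  rw [← lintegral_iUnion (fun u => measurableSet_Reg c₅ L n u) (pairwise_disjoint_Reg c₅ L n)]
  exact setLIntegral_congr (Filter.eventuallyEq_set.mpr hω)

lemma lintegral_good_blks {κ : EllConst d} {c₅ : ℝ} {L n : ℕ}
    (hfin : ∀ᵐ φ ∂(markedLaw P κ), φ ∈ good c₅ → T c₅ L n φ ≠ ⊤)
    {G : (Fin n → Block d) → ℝ≥0∞} (hG : Measurable G) :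
    ∫⁻ ω, ∫⁻ φ in good c₅, G (blks c₅ L n ω φ) ∂(markedKernel κ ω) ∂P =
      ∑' u : ℕ, ∑' D : RegDat d c₅ L n u, ∫⁻ ω, wt κ ω u D.rep * G (blks c₅ L n ω D.rep) *
        markedKernel κ (shiftEnv (D.rep.1 u) ω) (good c₅) ∂P := by
  rw [lintegral_congr_ae (setLIntegral_good_eq_tsum P hfin fun ω φ => G (blks c₅ L n ω φ))]
  simp_rw [lintegral_Reg_blks]
  have hm : ∀ u : ℕ, ∀ D : RegDat d c₅ L n u, Measurable fun ω => wt κ ω u D.rep *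
      G (blks c₅ L n ω D.rep) * markedKernel κ (shiftEnv (D.rep.1 u) ω) (good c₅) := fun u D =>
    ((measurable_wt κ u _).mul (hG.comp (measurable_blks_left c₅ L n _))).mul
      ((Kernel.measurable_coe _ (measurableSet_good c₅)).comp (measurable_shiftEnv _))
  rw [lintegral_tsum fun u => (Measurable.tsum (hm u)).aemeasurable]
  exact tsum_congr fun u => lintegral_tsum fun D => (hm u D).aemeasurable

lemma lintegral_good_blks_next {κ : EllConst d} {c₅ : ℝ} {L n : ℕ}
    (hfin : ∀ n, ∀ᵐ φ ∂(markedLaw P κ), φ ∈ good c₅ → T c₅ L n φ ≠ ⊤)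
    {G : (Fin n → Block d) → ℝ≥0∞} (hG : Measurable G) {B : Set (Block d)}
    (hB : MeasurableSet B) :
    ∫⁻ ω, ∫⁻ φ in good c₅, G (blks c₅ L n ω φ) * B.indicator 1 (blk c₅ L n ω φ)
        ∂(markedKernel κ ω) ∂P =
      ∑' u : ℕ, ∑' D : RegDat d c₅ L n u, ∫⁻ ω, wt κ ω u D.rep * G (blks c₅ L n ω D.rep) *
        markedKernel κ (shiftEnv (D.rep.1 u) ω)
          (firstBlockIn c₅ L B (shiftEnv (D.rep.1 u) ω)) ∂P := by
  classical
  have h1 : ∀ᵐ ω ∂P, ∫⁻ φ in good c₅, G (blks c₅ L n ω φ) * B.indicator 1 (blk c₅ L n ω φ)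
        ∂(markedKernel κ ω) = ∑' u : ℕ, ∑' D : RegDat d c₅ L n u,
          wt κ ω u D.rep * G (blks c₅ L n ω D.rep) * markedKernel κ (shiftEnv (D.rep.1 u) ω)
            (firstBlockIn c₅ L B (shiftEnv (D.rep.1 u) ω)) := by
    filter_upwards [setLIntegral_good_eq_tsum P (hfin n) fun ω φ =>
      G (blks c₅ L n ω φ) * B.indicator 1 (blk c₅ L n ω φ),
      ae_exists_mem_Reg P (hfin (n + 1))] with ω hω hω'
    rw [hω]
    refine tsum_congr fun u => ?_
    rw [← lintegral_Reg_blks_next κ ω c₅ L n u G hB]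
    have hN : MeasurableSet {φ : Trk d | T c₅ L (n + 1) φ ≠ ⊤ ∧ blk c₅ L n ω φ ∈ B} :=
      (measurableSet_T_top c₅ L (n + 1)).compl.inter
        (((measurable_blk c₅ L n).comp (measurable_const.prodMk measurable_id)) hB)
    rw [Set.inter_comm, ← Measure.restrict_restrict hN, ← lintegral_indicator hN]
    refine setLIntegral_congr_fun_ae (measurableSet_Reg c₅ L n u) ?_
    filter_upwards [hω'] with φ hφ hmem
    have hfin' : T c₅ L (n + 1) φ ≠ ⊤ := by
      obtain ⟨v, hv⟩ := Set.mem_iUnion.mp (hφ.mp hmem.2.1)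
      rw [hv.2.2]
      exact ENat.natCast_ne_top v
    by_cases hb : blk c₅ L n ω φ ∈ B
    · simp [hb, hfin']
    · simp [hb]
  rw [lintegral_congr_ae h1]
  have hm : ∀ u : ℕ, ∀ D : RegDat d c₅ L n u, Measurable fun ω => wt κ ω u D.rep *
      G (blks c₅ L n ω D.rep) * markedKernel κ (shiftEnv (D.rep.1 u) ω)
            (firstBlockIn c₅ L B (shiftEnv (D.rep.1 u) ω)) := fun u D =>
    ((measurable_wt κ u _).mul (hG.comp (measurable_blks_left c₅ L n _))).mul
      ((measurable_markedKernel_firstBlockIn κ c₅ L hB).comp (measurable_shiftEnv _))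
  rw [lintegral_tsum fun u => (Measurable.tsum (hm u)).aemeasurable]
  exact tsum_congr fun u => lintegral_tsum fun D => (hm u D).aemeasurable

lemma lintegral_hatP (κ : EllConst d) (c₅ : ℝ) {F : Env d × Trk d → ℝ≥0∞} (hF : Measurable F) :
    ∫⁻ z, F (z.1.1, marks (z.1.2, z.2)) ∂(hatP P κ c₅) =
      (annealedCoins P κ {z | stopR c₅ z.2 = ⊤})⁻¹ *
        ∫⁻ ω, ∫⁻ φ in good c₅, F (ω, φ) ∂(markedKernel κ ω) ∂P := by
  classical
  have hmk : Measurable fun z : Triple d => marks (z.1.2, z.2) :=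
    measurable_marks.comp ((measurable_snd.comp measurable_fst).prodMk measurable_snd)
  have hgm := measurableSet_good (d := d) c₅
  have hset : MeasurableSet {z : Triple d | stopR c₅ z.2 = ⊤} := hmk hgm
  have hEm : MeasurableSet {p : Env d × Trk d | p.2 ∈ good c₅} := measurable_snd hgm
  unfold hatP
  rw [ProbabilityTheory.cond, lintegral_smul_measure, smul_eq_mul, ← lintegral_indicator hset]
  congr 1
  have h1 := lintegral_annealedCoins P κ (hF.indicator hEm)
  have h2 : ∀ z : Triple d, {z : Triple d | stopR c₅ z.2 = ⊤}.indicator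
      (fun z => F (z.1.1, marks (z.1.2, z.2))) z =
      {p : Env d × Trk d | p.2 ∈ good c₅}.indicator F (z.1.1, marks (z.1.2, z.2)) := fun z => rfl
  simp only [h2]
  refine Eq.trans h1 (lintegral_congr fun ω => ?_)
  rw [← lintegral_indicator hgm]
  rfl

/-- The defining property of the transition kernels. -/
lemma lintegral_transKernel {κ : EllConst d} {c₅ : ℝ}
    (hpos : annealedCoins P κ {z | stopR c₅ z.2 = ⊤} ≠ 0) (L n : ℕ)
    {G : (Fin n → Block d) → ℝ≥0∞} (hG : Measurable G) {B : Set (Block d)}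
    (hB : MeasurableSet B) :
    ∫⁻ ω, ∫⁻ φ in good c₅, G (blks c₅ L n ω φ) * transKernel P κ c₅ L n (blks c₅ L n ω φ) B
        ∂(markedKernel κ ω) ∂P =
      ∫⁻ ω, ∫⁻ φ in good c₅, G (blks c₅ L n ω φ) * B.indicator 1 (blk c₅ L n ω φ)
        ∂(markedKernel κ ω) ∂P := by
  have hK : Measurable fun b => transKernel P κ c₅ L n b B := Kernel.measurable_coe _ hB
  have hbs := measurable_blks (d := d) c₅ L n
  have hb := measurable_blk (d := d) c₅ L n
  have hI : Measurable (B.indicator (1 : Block d → ℝ≥0∞)) := measurable_one.indicator hB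
  have h1 := lintegral_hatP P κ c₅ (F := fun p => G (blks c₅ L n p.1 p.2) *
    transKernel P κ c₅ L n (blks c₅ L n p.1 p.2) B)
    ((hG.comp hbs).mul (hK.comp hbs))
  have h2 := lintegral_hatP P κ c₅ (F := fun p => G (blks c₅ L n p.1 p.2) *
    B.indicator 1 (blk c₅ L n p.1 p.2)) ((hG.comp hbs).mul (hI.comp hb))
  have hmk : Measurable fun z : Triple d => (z.1.1, marks (z.1.2, z.2)) :=
    (measurable_fst.comp measurable_fst).prodMk
      (measurable_marks.comp ((measurable_snd.comp measurable_fst).prodMk measurable_snd))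
  have hX : Measurable fun (z : Triple d) (m : Fin n) => block c₅ L (m : ℕ) z := by
    simp_rw [block_eq_blk]
    exact hbs.comp hmk
  have hY : Measurable fun z : Triple d => block c₅ L n z := by
    simp_rw [block_eq_blk]
    exact hb.comp hmk
  have h3 := lintegral_mul_condDistrib (hatP P κ c₅) hX hY hG hI
  simp only [lintegral_indicator_one hB] at h3
  change ∫⁻ z, G _ * transKernel P κ c₅ L n _ B ∂_ = _ at h3
  simp only [block_eq_blk] at h3
  refine (ENNReal.mul_right_inj (ENNReal.inv_ne_zero.mpr (measure_ne_top _ _))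
    (ENNReal.inv_ne_top.mpr hpos)).mp
    (h1.symm.trans (Eq.trans h3 h2))

end

section
variable {d : ℕ} [NeZero d]

/-! ### The discrete part of the blocks -/

/-- The blocks with the path, the displacement and the duration of a given block. -/
def discreteClass (b : Block d) : Set (Block d) := {b' | b'.1 = b.1 ∧ b'.2.2 = b.2.2}

lemma measurableSet_discreteClass (b : Block d) : MeasurableSet (discreteClass b) := by
  rw [measurableSet_block_iff]
  intro p
  by_cases h : p = b.1
  · have : Sigma.mk p ⁻¹' discreteClass b =
        (fun w : ({x : Site d // x ∈ p} → ProbVec d) × Site d × ℕ => w.2) ⁻¹' {b.2.2} := by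
      ext w
      simp [discreteClass, h]
    rw [this]
    exact measurable_snd (measurableSet_singleton _)
  · have : Sigma.mk p ⁻¹' discreteClass b =
        (∅ : Set (({x : Site d // x ∈ p} → ProbVec d) × Site d × ℕ)) := by
      ext w
      simp [discreteClass, h]
    rw [this]
    exact MeasurableSet.empty

/-- The sequences of blocks with the same discrete parts as the blocks of a given path. -/
def blockClass (c₅ : ℝ) (L k : ℕ) (φ : Trk d) : Set (Fin k → Block d) :=
  {b | ∀ i : Fin k, b i ∈ discreteClass (blk c₅ L i (fun _ => uniformVec d) φ)}

lemma measurableSet_blockClass (c₅ : ℝ) (L k : ℕ) (φ : Trk d) :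
    MeasurableSet (blockClass c₅ L k φ) := by
  unfold blockClass
  rw [Set.ofPred_forall]
  exact MeasurableSet.iInter fun i => measurable_pi_apply i (measurableSet_discreteClass _)

lemma blks_mem_blockClass (c₅ : ℝ) (L k : ℕ) (ω : Env d) (φ : Trk d) :
    blks c₅ L k ω φ ∈ blockClass c₅ L k φ := fun _ => ⟨rfl, rfl⟩

lemma blk_eq_of_T {c₅ : ℝ} {L i a b : ℕ} {φ : Trk d} (ha : T c₅ L i φ = a)
    (hb : T c₅ L (i + 1) φ = b) (ω : Env d) : blk c₅ L i ω φ = pieceBlock L a b ω φ := by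
  rw [blk_eq_pieceBlock, ha, hb]
  rfl

/-- Displacements and durations of the blocks add up, so the regeneration times and positions are
functions of the discrete parts. -/
lemma eq_of_blockClass {c₅ : ℝ} {L k : ℕ} {ω : Env d} {φ ψ : Trk d} (hφ : φ.1 0 = 0)
    (hψ : ψ.1 0 = 0) (h : blks c₅ L k ω φ ∈ blockClass c₅ L k ψ) {j : ℕ} (hj : j ≤ k) {a b : ℕ}
    (ha : T c₅ L j φ = a) (hb : T c₅ L j ψ = b) : a = b ∧ φ.1 a = ψ.1 b := by
  induction j generalizing a b with
  | zero =>
    rw [T_zero] at ha hb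
    have ha' : a = 0 := by exact_mod_cast ha.symm
    have hb' : b = 0 := by exact_mod_cast hb.symm
    rw [ha', hb', hφ, hψ]
    exact ⟨rfl, rfl⟩
  | succ j ih =>
    obtain ⟨a', w, ha', -, -⟩ := T_split (Nat.le_succ j) ha
    obtain ⟨b', w', hb', -, -⟩ := T_split (Nat.le_succ j) hb
    obtain ⟨h1, h2⟩ := ih (by omega) ha' hb'
    have h3 := (h ⟨j, by omega⟩).2
    change (blk c₅ L j ω φ).2.2 = _ at h3
    have h4 := T_add_le ha' ha
    have h5 := T_add_le hb' hb
    simp only [blk_eq_pieceBlock, ha, hb, ha', hb', pieceBlock, mkBlock, ENat.toNat_natCast,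
      Prod.mk.injEq] at h3
    refine ⟨by omega, ?_⟩
    have := h3.1
    rw [h2] at this
    exact sub_left_inj.mp this

/-- With the same relative paths and the same regeneration positions, both paths record the same
absolute sites, whatever the environment. Blocks do not record coins, so different marked paths can
share them, and the weights of all of these have to be summed in `classWt`. -/
lemma blks_eq_of_blockClass {c₅ : ℝ} {L k u v : ℕ} {ω : Env d} {φ ψ : Trk d}
    (hφ : φ ∈ Reg c₅ L k u) (hψ : ψ ∈ Reg c₅ L k v)
    (h : blks c₅ L k ω φ ∈ blockClass c₅ L k ψ) :
    u = v ∧ φ.1 u = ψ.1 v ∧ ∀ ω', blks c₅ L k ω' φ = blks c₅ L k ω' ψ := by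
  have h0 := eq_of_blockClass hφ.1 hψ.1 h le_rfl hφ.2.2 hψ.2.2
  refine ⟨h0.1, h0.2, fun ω' => funext fun i => ?_⟩
  obtain ⟨a', w, ha', -, -⟩ := T_split (Nat.succ_le_of_lt i.2) hφ.2.2
  obtain ⟨b', w', hb', -, -⟩ := T_split (Nat.succ_le_of_lt i.2) hψ.2.2
  obtain ⟨a, -, ha, -, -⟩ := T_split (Nat.le_succ i.1) ha'
  obtain ⟨b, -, hb, -, -⟩ := T_split (Nat.le_succ i.1) hb'
  obtain ⟨h1, h2⟩ := eq_of_blockClass hφ.1 hψ.1 h (j := i) i.2.le ha hb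
  have h3 := h i
  change blk c₅ L i ω φ ∈ _ at h3
  show blk c₅ L i ω' φ = blk c₅ L i ω' ψ
  rw [blk_eq_of_T ha ha', blk_eq_of_T hb hb'] at h3
  rw [blk_eq_of_T ha ha', blk_eq_of_T hb hb']
  obtain ⟨h4, h5⟩ := h3
  simp only [pieceBlock, mkBlock, Prod.mk.injEq] at h4 h5
  unfold pieceBlock
  rw [h4, h5.1, h5.2, h2]

/-! ### The weight of a class -/

variable (P : Measure (Env d)) [IsProbabilityMeasure P]

open Classical in
/-- The quenched probability of the pieces of path that yield blocks of a given class. -/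
noncomputable def classWt (κ : EllConst d) (c₅ : ℝ) (L k u : ℕ) (φ : Trk d) (ω : Env d) : ℝ≥0∞ :=
  ∑' D : RegDat d c₅ L k u,
    if ∃ ω', blks c₅ L k ω' D.rep ∈ blockClass c₅ L k φ then wt κ ω u D.rep else 0

lemma classWt_le_one (κ : EllConst d) (c₅ : ℝ) (L k u : ℕ) (φ : Trk d) (ω : Env d) :
    classWt κ c₅ L k u φ ω ≤ 1 := by
  classical
  calc classWt κ c₅ L k u φ ω
      ≤ ∑' D : RegDat d c₅ L k u, markedKernel κ ω (Cyl u D.rep) := by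
        refine ENNReal.tsum_le_tsum fun D => ?_
        rw [markedKernel_Cyl, if_pos D.rep_mem.1]
        split_ifs
        · exact le_rfl
        · exact zero_le
    _ = markedKernel κ ω (⋃ D : RegDat d c₅ L k u, Cyl u D.rep) := by
        refine (measure_iUnion ?_ fun D => measurableSet_Cyl u _).symm
        intro D D' hD
        show Disjoint (Cyl u D.rep) (Cyl u D'.rep)
        rw [RegDat.Cyl_rep, RegDat.Cyl_rep]
        exact pairwise_disjoint_Cyl u fun h => hD (Subtype.ext h)
    _ ≤ 1 := prob_le_one

lemma classWt_ne_zero {κ : EllConst d} {c₅ : ℝ} {L k u : ℕ} {φ : Trk d}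
    (hφ : φ ∈ Reg c₅ L k u) {ω : Env d} (h : wt κ ω u φ ≠ 0) : classWt κ c₅ L k u φ ω ≠ 0 := by
  classical
  have hc : φ ∈ Cyl u (extend (proj u φ)) := agreeTo_iff_proj.mpr (proj_extend _).symm
  have hD : (Reg c₅ L k u ∩ Cyl u (extend (proj u φ))).Nonempty := ⟨φ, hφ, hc⟩
  set D : RegDat d c₅ L k u := ⟨proj u φ, hD⟩ with hDdef
  have hc' : AgreeTo u D.rep φ := by
    have : φ ∈ Cyl u D.rep := by rw [RegDat.Cyl_rep]; exact hc
    exact AgreeTo.symm this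
  have h1 := Reg.of_agree hφ hc' (good_shift_of_T D.rep_mem.2.1 D.rep_mem.2.2)
  intro h0
  have h2 := ENNReal.tsum_eq_zero.mp h0 D
  rw [if_pos ⟨ω, by rw [blks_congr ω h1.2 hφ.2.2 hc']; exact blks_mem_blockClass c₅ L k ω φ⟩,
    wt_congr κ ω hc'] at h2
  exact h h2

lemma measurable_wt_Vis (κ : EllConst d) {c₅ : ℝ} {L k u : ℕ} {φ : Trk d}
    (hu : T c₅ L k φ = u) (y : Site d) {Λ : Set (Site d)} (hΛ : ∀ x ∈ Vis c₅ L k φ, x + y ∈ Λ) :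
    Measurable[sigmaAlg Λ] fun ω => wt κ (shiftEnv y ω) u φ :=
  measurable_wt_shift κ y u φ fun _ hi hc => hΛ _ (mem_Vis_of_coin hu hi hc)

lemma measurable_blks_Vis {c₅ : ℝ} {L k u : ℕ} {φ : Trk d} (hu : T c₅ L k φ = u) :
    Measurable[sigmaAlg (Vis c₅ L k φ)] fun ω => blks c₅ L k ω φ := by
  have h := measurable_blks_shiftEnv hu 0 (Λ := Vis c₅ L k φ) fun x hx => by rwa [add_zero]
  simpa only [shiftEnv_zero] using h

/-- The weight of another path of the class is a function of that path's own blocks. These coincide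
with the blocks of `φ` in every environment and so depend only on the sites recorded by `φ`. -/
lemma measurable_classWt (κ : EllConst d) {c₅ : ℝ} {L k u : ℕ} {φ : Trk d}
    (hφ : φ ∈ Reg c₅ L k u) :
    Measurable[sigmaAlg (Vis c₅ L k φ)] fun ω => classWt κ c₅ L k u φ ω := by
  classical
  unfold classWt
  refine @Measurable.tsum _ _ _ (sigmaAlg (Vis c₅ L k φ)) _ _ _ _ _ _ _ _ _ _ _ _ fun D => ?_
  split_ifs with h
  · obtain ⟨ω', h'⟩ := h
    have h1 := (blks_eq_of_blockClass D.rep_mem hφ h').2.2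
    have h2 := measurable_wt_Vis κ D.rep_mem.2.2 0 (Λ := Vis c₅ L k D.rep)
      fun x hx => by rwa [add_zero]
    simp only [shiftEnv_zero] at h2
    obtain ⟨g, hg, h3⟩ := exists_eq_comp_blks h2
    simp only [h3, h1]
    exact hg.comp (measurable_blks_Vis hφ.2.2)
  · exact @measurable_const _ _ _ (sigmaAlg _) _

/-- A function carried by the class selects one duration `u₁` and the paths of the class. These
share blocks and endpoint, so only their weights remain to be summed. -/
lemma tsum_blockClass (κ : EllConst d) {c₅ : ℝ} {L k u₁ : ℕ} {φ : Trk d}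
    (hφ : φ ∈ Reg c₅ L k u₁) {G : (Fin k → Block d) → ℝ≥0∞} (hG : Measurable G)
    (hG0 : ∀ b ∉ blockClass c₅ L k φ, G b = 0) {F : Env d → ℝ≥0∞} (hF : Measurable F) :
    ∑' u : ℕ, ∑' D : RegDat d c₅ L k u, ∫⁻ ω, wt κ ω u D.rep * G (blks c₅ L k ω D.rep) *
        F (shiftEnv (D.rep.1 u) ω) ∂P =
      ∫⁻ ω, classWt κ c₅ L k u₁ φ ω * (G (blks c₅ L k ω φ) * F (shiftEnv (φ.1 u₁) ω)) ∂P := by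
  classical
  rw [tsum_eq_single u₁]
  · simp only [classWt, ← ENNReal.tsum_mul_right]
    rw [lintegral_tsum]
    · refine tsum_congr fun D => lintegral_congr fun ω => ?_
      split_ifs with h
      · obtain ⟨ω', h'⟩ := h
        obtain ⟨-, h2, h3⟩ := blks_eq_of_blockClass D.rep_mem hφ h'
        rw [h2, h3, mul_assoc]
      · rw [hG0 _ fun hmem => h ⟨ω, hmem⟩]
        simp
    · intro D
      refine Measurable.aemeasurable (Measurable.mul ?_ ((hG.comp (measurable_blks_left c₅ L k φ)).mul
        (hF.comp (measurable_shiftEnv _))))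
      split_ifs
      · exact measurable_wt κ u₁ _
      · exact measurable_const
  · intro u hu
    refine ENNReal.tsum_eq_zero.mpr fun D => ?_
    refine Eq.trans (lintegral_congr fun ω => ?_) lintegral_zero
    rw [hG0 _ fun hmem => hu (blks_eq_of_blockClass D.rep_mem hφ hmem).1]
    simp

/-- The transition kernel as a ratio of conditional expectations given the recorded environment. -/
lemma condE_firstBlockIn_eq {κ : EllConst d} {c₅ : ℝ} {L k u : ℕ}
    (hpos : annealedCoins P κ {z | stopR c₅ z.2 = ⊤} ≠ 0)
    (hfin : ∀ n, ∀ᵐ φ ∂(markedLaw P κ), φ ∈ good c₅ → T c₅ L n φ ≠ ⊤) {φ : Trk d}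
    (hφ : φ ∈ Reg c₅ L k u) {B : Set (Block d)} (hB : MeasurableSet B) :
    ∀ᵐ ω ∂P, wt κ ω u φ ≠ 0 →
      condE P (Vis c₅ L k φ) (fun ω => markedKernel κ (shiftEnv (φ.1 u) ω)
        (firstBlockIn c₅ L B (shiftEnv (φ.1 u) ω))) ω =
      transKernel P κ c₅ L k (blks c₅ L k ω φ) B *
        condE P (Vis c₅ L k φ) (fun ω => markedKernel κ (shiftEnv (φ.1 u) ω) (good c₅)) ω := by
  classical
  have hF1 : Measurable fun ω => markedKernel κ ω (firstBlockIn c₅ L B ω) :=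
    measurable_markedKernel_firstBlockIn κ c₅ L hB
  have hF2 : Measurable fun ω => markedKernel κ ω (good c₅) :=
    Kernel.measurable_coe _ (measurableSet_good c₅)
  have hf1 := hF1.comp (measurable_shiftEnv (φ.1 u))
  have hf2 := hF2.comp (measurable_shiftEnv (φ.1 u))
  have hK : Measurable fun b => transKernel P κ c₅ L k b B := Kernel.measurable_coe _ hB
  have hKm : Measurable[sigmaAlg (Vis c₅ L k φ)]
      fun ω => transKernel P κ c₅ L k (blks c₅ L k ω φ) B := hK.comp (measurable_blks_Vis hφ.2.2)
  have hwm := measurable_classWt κ hφ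
  have hc1 := measurable_condE P (Vis c₅ L k φ) hf1
  have hc2 := measurable_condE P (Vis c₅ L k φ) hf2
  -- A test function of the recorded environment is a function `g` of the blocks. With `g` cut off
  -- to the class of `φ`, the defining property of the transition kernel turns into an identity of
  -- integrals weighted by `classWt`.
  have key : (fun ω => classWt κ c₅ L k u φ ω * condE P (Vis c₅ L k φ) (fun ω =>
      markedKernel κ (shiftEnv (φ.1 u) ω) (firstBlockIn c₅ L B (shiftEnv (φ.1 u) ω))) ω) =ᵐ[P]
      fun ω => classWt κ c₅ L k u φ ω * transKernel P κ c₅ L k (blks c₅ L k ω φ) B *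
        condE P (Vis c₅ L k φ) (fun ω => markedKernel κ (shiftEnv (φ.1 u) ω) (good c₅)) ω := by
    refine ae_eq_of_sigmaAlg P _ (hwm.mul hc1) ((hwm.mul hKm).mul hc2) fun v hv _ => ?_
    obtain ⟨g, hg, hvg⟩ := exists_eq_comp_blks hv
    have hGm : Measurable ((blockClass c₅ L k φ).indicator g) :=
      hg.indicator (measurableSet_blockClass c₅ L k φ)
    have h1 := lintegral_transKernel P hpos L k hGm hB
    rw [lintegral_good_blks_next P hfin hGm hB,
      lintegral_good_blks P (hfin k) (G := fun b => (blockClass c₅ L k φ).indicator g b *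
        transKernel P κ c₅ L k b B) (hGm.mul hK),
      tsum_blockClass P κ hφ (G := fun b => (blockClass c₅ L k φ).indicator g b *
        transKernel P κ c₅ L k b B) (hGm.mul hK) (fun b hb => by simp [hb]) hF2,
      tsum_blockClass P κ hφ hGm (fun b hb => by simp [hb]) hF1] at h1
    simp only [Set.indicator_of_mem (blks_mem_blockClass c₅ L k _ φ), ← hvg] at h1
    have h2 := lintegral_mul_condE P (Vis c₅ L k φ) hf1 (hv.mul hwm)
    have h3 := lintegral_mul_condE P (Vis c₅ L k φ) hf2 (hv.mul (hwm.mul hKm))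
    simp only [Pi.mul_apply, Function.comp_def] at h2 h3
    simp only [← mul_assoc] at h1 h2 h3 ⊢
    rw [h2, h3]
    refine Eq.trans (lintegral_congr fun ω => ?_) (Eq.trans h1.symm (lintegral_congr fun ω => ?_))
    · ring
    · ring
  -- The class weight is finite, and positive wherever the weight of `φ` is, so there it cancels.
  filter_upwards [key] with ω hω h
  have h0 := classWt_ne_zero hφ h
  have ht := ne_top_of_le_ne_top ENNReal.one_ne_top (classWt_le_one κ c₅ L k u φ ω)
  rw [mul_assoc] at hω
  exact (ENNReal.mul_right_inj h0 ht).mp hω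

end

section
variable {d : ℕ} [NeZero d] (P : Measure (Env d)) [IsProbabilityMeasure P]

/-! ### Comparison of the transition kernels -/

instance instMarkovTransKernel (κ : EllConst d) (c₅ : ℝ) (L i : ℕ) :
    IsMarkovKernel (transKernel P κ c₅ L i) := by
  unfold transKernel; infer_instance

lemma shiftEnv_shiftEnv (a b : Site d) (ω : Env d) :
    shiftEnv b (shiftEnv a ω) = shiftEnv (b + a) ω := by
  funext x
  simp only [shiftEnv, add_assoc]

/-- The comparison for a single regeneration path, seen from the site where its last `k` blocks
start. -/
lemma compare_of_Vis {r : ℕ} {γ C c₅ : ℝ} (hγ : 0 < γ) (hC : 0 < C) (hmix : MixingCond P r γ C)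
    {L k u : ℕ} (hL : 1 ≤ L) (hrL : r ≤ L) {κ : EllConst d}
    (hpos : annealedCoins P κ {z | stopR c₅ z.2 = ⊤} ≠ 0)
    (hfin : ∀ n, ∀ᵐ φ ∂(markedLaw P κ), φ ∈ good c₅ → T c₅ L n φ ≠ ⊤) {φ : Trk d}
    (hφ : φ ∈ Reg c₅ L k u) {B : Set (Block d)} (hB : MeasurableSet B) {v : Env d → ℝ≥0∞}
    (hv : Measurable[sigmaAlg (Vis c₅ L k φ ∪ {x | level x ≤ -L})] v) (hv1 : ∀ ω, v ω ≤ 1)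
    (hv0 : ∀ ω, v ω ≠ 0 → wt κ ω u φ ≠ 0) {e : ℝ≥0∞}
    (he : e = ENNReal.ofReal (Real.exp (mixExp d γ C c₅ ((k + 1) * L)))) :
    ∫⁻ ω, v ω * markedKernel κ (shiftEnv (φ.1 u) ω)
        (firstBlockIn c₅ L B (shiftEnv (φ.1 u) ω)) ∂P ≤
      e * (e * ∫⁻ ω, v ω * transKernel P κ c₅ L k (blks c₅ L k ω φ) B *
        markedKernel κ (shiftEnv (φ.1 u) ω) (good c₅) ∂P) ∧
    ∫⁻ ω, v ω * transKernel P κ c₅ L k (blks c₅ L k ω φ) B *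
        markedKernel κ (shiftEnv (φ.1 u) ω) (good c₅) ∂P ≤
      e * (e * ∫⁻ ω, v ω * markedKernel κ (shiftEnv (φ.1 u) ω)
        (firstBlockIn c₅ L B (shiftEnv (φ.1 u) ω)) ∂P) := by
  -- The path starts at level `0` and its `k` blocks climb `k L` levels. Sites at level at most `-L`
  -- are therefore `(k + 1) L` below its end.
  have hlev : (k : ℤ) * L ≤ level (φ.1 u) := by
    have h := T_level_le (T_zero c₅ L φ) k (b := u) (by rw [zero_add]; exact hφ.2.2)
    rw [hφ.1, level_zero, zero_add] at h
    exact h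
  have hU : ∀ x ∈ Vis c₅ L k φ, level x ≤ level (φ.1 u) - L := fun x hx =>
    level_Vis_le hφ.2.2 hx
  have hΛ : ∀ x ∈ Vis c₅ L k φ ∪ {x | level x ≤ -L}, x ∈ Vis c₅ L k φ ∨
      level x ≤ level (φ.1 u) - ((k + 1) * L : ℕ) := by
    rintro x (hx | hx)
    · exact Or.inl hx
    · refine Or.inr ?_
      have hx' : level x ≤ -L := hx
      push_cast
      linarith
  have hLM : L ≤ (k + 1) * L := Nat.le_mul_of_pos_left L (Nat.succ_pos k)
  have m1 := mix_firstBlockIn P (c₅ := c₅) hγ hC hmix hL hrL hLM (φ.1 u) hU hΛ κ hB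
  have m2 := mix_good P hγ hC hmix hL hrL hLM (φ.1 u) hU hΛ κ ⟨φ, hφ.2.1⟩
  have hkm : Measurable[sigmaAlg (Vis c₅ L k φ ∪ {x | level x ≤ -L})]
      fun ω => transKernel P κ c₅ L k (blks c₅ L k ω φ) B :=
    ((Kernel.measurable_coe _ hB).comp (measurable_blks_Vis hφ.2.2)).mono
      (sigmaAlg_mono Set.subset_union_left) le_rfl
  have a1 := m1.2 v hv hv1
  have a2 := m2.2 _ (hv.mul hkm) fun ω => mul_le_one' (hv1 ω) prob_le_one
  rw [← he] at a1 a2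
  -- The ratio formula is available only where the weight of `φ` is positive, and `v` vanishes
  -- elsewhere. Passing to and from conditional expectations costs one factor `e` for the numerator
  -- and one for the denominator.
  have hid : ∫⁻ ω, v ω * condE P (Vis c₅ L k φ) (fun ω => markedKernel κ (shiftEnv (φ.1 u) ω)
        (firstBlockIn c₅ L B (shiftEnv (φ.1 u) ω))) ω ∂P =
      ∫⁻ ω, v ω * transKernel P κ c₅ L k (blks c₅ L k ω φ) B *
        condE P (Vis c₅ L k φ) (fun ω => markedKernel κ (shiftEnv (φ.1 u) ω) (good c₅)) ω ∂P := by
    refine lintegral_congr_ae ?_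
    filter_upwards [condE_firstBlockIn_eq P hpos hfin hφ hB] with ω hω
    by_cases h : v ω = 0
    · simp [h]
    · rw [hω (hv0 ω h), mul_assoc]
  simp only [Pi.mul_apply] at a2
  rw [hid] at a1
  exact ⟨a1.1.trans (by gcongr; exact a2.2), a2.1.trans (by gcongr; exact a1.2)⟩

/-- The last `k` of `m + k` blocks. -/
def lastBlocks (m k : ℕ) (b : Fin (m + k) → Block d) : Fin k → Block d :=
  fun i => b (Fin.natAdd m i)

lemma measurable_lastBlocks (m k : ℕ) : Measurable (lastBlocks (d := d) m k) :=
  measurable_pi_lambda _ fun _ => measurable_pi_apply _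

lemma lastBlocks_blks {c₅ : ℝ} {L m k s t : ℕ} (ω : Env d) {ψ : Trk d} (hs : T c₅ L m ψ = s)
    (ht : T c₅ L (m + k) ψ = t) :
    lastBlocks m k (blks c₅ L (m + k) ω ψ) = blks c₅ L k (shiftEnv (ψ.1 s) ω) (shiftT s ψ) := by
  funext i
  show blk c₅ L (m + i) ω ψ = _
  have h1 := T_add hs k
  rw [ht] at h1
  cases h : T c₅ L k (shiftT s ψ) with
  | top => rw [h, top_add] at h1; exact absurd h1 (ENat.natCast_ne_top t)
  | coe w =>
    obtain ⟨b, -, hb, -, -⟩ := T_split (Nat.succ_le_of_lt i.2) h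
    exact blk_shift ω hs hb

/-- By stationarity the origin is moved to the site where the last `k` blocks start. Seen from
there, the weight and the blocks of the whole path read only sites recorded by the last `k` blocks
and sites at level at most `-L`. They form an admissible test function `v` for `compare_of_Vis`. -/
lemma compare_of_Reg (hstat : Stationary P) {r : ℕ} {γ C c₅ : ℝ} (hγ : 0 < γ) (hC : 0 < C)
    (hmix : MixingCond P r γ C) {L m k t : ℕ} (hL : 1 ≤ L) (hrL : r ≤ L) {κ : EllConst d}
    (hpos : annealedCoins P κ {z | stopR c₅ z.2 = ⊤} ≠ 0)
    (hfin : ∀ n, ∀ᵐ φ ∂(markedLaw P κ), φ ∈ good c₅ → T c₅ L n φ ≠ ⊤) {ψ : Trk d}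
    (hψ : ψ ∈ Reg c₅ L (m + k) t) {B : Set (Block d)} (hB : MeasurableSet B)
    {G : (Fin (m + k) → Block d) → ℝ≥0∞} (hG : Measurable G) (hG1 : ∀ b, G b ≤ 1) {e : ℝ≥0∞}
    (he : e = ENNReal.ofReal (Real.exp (mixExp d γ C c₅ ((k + 1) * L)))) :
    ∫⁻ ω, wt κ ω t ψ * G (blks c₅ L (m + k) ω ψ) * markedKernel κ (shiftEnv (ψ.1 t) ω)
        (firstBlockIn c₅ L B (shiftEnv (ψ.1 t) ω)) ∂P ≤
      e * (e * ∫⁻ ω, wt κ ω t ψ * (G (blks c₅ L (m + k) ω ψ) *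
        transKernel P κ c₅ L k (lastBlocks m k (blks c₅ L (m + k) ω ψ)) B) *
          markedKernel κ (shiftEnv (ψ.1 t) ω) (good c₅) ∂P) ∧
    ∫⁻ ω, wt κ ω t ψ * (G (blks c₅ L (m + k) ω ψ) *
        transKernel P κ c₅ L k (lastBlocks m k (blks c₅ L (m + k) ω ψ)) B) *
          markedKernel κ (shiftEnv (ψ.1 t) ω) (good c₅) ∂P ≤
      e * (e * ∫⁻ ω, wt κ ω t ψ * G (blks c₅ L (m + k) ω ψ) * markedKernel κ (shiftEnv (ψ.1 t) ω)
        (firstBlockIn c₅ L B (shiftEnv (ψ.1 t) ω)) ∂P) := by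
  obtain ⟨s, u, hs, hu, hsu⟩ := T_split (Nat.le_add_right m k) hψ.2.2
  rw [Nat.add_sub_cancel_left] at hu
  have hφ : shiftT s ψ ∈ Reg c₅ L k u := ⟨by simp [shiftT], good_shift_of_T hψ.2.1 hs, hu⟩
  have hend : (shiftT s ψ).1 u + ψ.1 s = ψ.1 t := by
    simp only [shiftT, ← hsu, add_comm u s, sub_add_cancel]
  set v : Env d → ℝ≥0∞ := fun ω => wt κ (shiftEnv (-ψ.1 s) ω) t ψ *
    G (blks c₅ L (m + k) (shiftEnv (-ψ.1 s) ω) ψ) with hvdef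
  have hΛ : ∀ x ∈ Vis c₅ L (m + k) ψ,
      x + -ψ.1 s ∈ Vis c₅ L k (shiftT s ψ) ∪ {x | level x ≤ -L} := by
    intro x hx
    rw [← sub_eq_add_neg]
    exact mem_Vis_add hs hx
  have hv : Measurable[sigmaAlg (Vis c₅ L k (shiftT s ψ) ∪ {x | level x ≤ -L})] v :=
    (measurable_wt_Vis κ hψ.2.2 _ hΛ).mul (hG.comp (measurable_blks_shiftEnv hψ.2.2 _ hΛ))
  have hv1 : ∀ ω, v ω ≤ 1 := fun ω => mul_le_one' (wt_le_one κ _ t hψ.1) (hG1 _)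
  have hback : ∀ ω : Env d, shiftEnv (-ψ.1 s) (shiftEnv (ψ.1 s) ω) = ω := fun ω => by
    rw [shiftEnv_shiftEnv, neg_add_cancel, shiftEnv_zero]
  have hback' : ∀ ω : Env d, shiftEnv (ψ.1 s) (shiftEnv (-ψ.1 s) ω) = ω := fun ω => by
    rw [shiftEnv_shiftEnv, add_neg_cancel, shiftEnv_zero]
  -- The weight of the whole path contains that of its last `k` blocks as a factor.
  have hv0 : ∀ ω, v ω ≠ 0 → wt κ ω u (shiftT s ψ) ≠ 0 := by
    intro ω h h0
    refine h ?_
    rw [hvdef]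
    simp only
    rw [← hsu, add_comm u s, wt_add, hback', h0, mul_zero, zero_mul]
  have main := compare_of_Vis P hγ hC hmix hL hrL hpos hfin hφ hB hv hv1 hv0 he
  have hF1 : Measurable fun ω => markedKernel κ (shiftEnv ((shiftT s ψ).1 u) ω)
      (firstBlockIn c₅ L B (shiftEnv ((shiftT s ψ).1 u) ω)) :=
    (measurable_markedKernel_firstBlockIn κ c₅ L hB).comp (measurable_shiftEnv _)
  have hF2 : Measurable fun ω => markedKernel κ (shiftEnv ((shiftT s ψ).1 u) ω) (good c₅) :=
    (Kernel.measurable_coe _ (measurableSet_good c₅)).comp (measurable_shiftEnv _)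
  have hK : Measurable fun ω => transKernel P κ c₅ L k (blks c₅ L k ω (shiftT s ψ)) B :=
    (Kernel.measurable_coe _ hB).comp (measurable_blks_left c₅ L k _)
  have hvm : Measurable v := hv.mono (sigmaAlg_le _) le_rfl
  have r1 := lintegral_shiftEnv P hstat (ψ.1 s) (hvm.mul hF1)
  have r2 := lintegral_shiftEnv P hstat (ψ.1 s) ((hvm.mul hK).mul hF2)
  simp only [Pi.mul_apply] at r1 r2
  rw [← r1, ← r2] at main
  simp only [hvdef, hback, shiftEnv_shiftEnv, hend,
    ← lastBlocks_blks _ hs hψ.2.2] at main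
  simpa only [mul_assoc] using main

/-- Under the integral the kernel for all blocks becomes the indicator of the next block, so only
the kernel for the last `k` blocks has to be expressed as a ratio. The comparison is then made path
by path. -/
lemma compare_integrals (hstat : Stationary P) {r : ℕ} {γ C c₅ : ℝ} (hγ : 0 < γ) (hC : 0 < C)
    (hmix : MixingCond P r γ C) {L m k : ℕ} (hL : 1 ≤ L) (hrL : r ≤ L) {κ : EllConst d}
    (hpos : annealedCoins P κ {z | stopR c₅ z.2 = ⊤} ≠ 0)
    (hfin : ∀ n, ∀ᵐ φ ∂(markedLaw P κ), φ ∈ good c₅ → T c₅ L n φ ≠ ⊤)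
    {B : Set (Block d)} (hB : MeasurableSet B)
    {G : (Fin (m + k) → Block d) → ℝ≥0∞} (hG : Measurable G) (hG1 : ∀ b, G b ≤ 1) {e : ℝ≥0∞}
    (he : e = ENNReal.ofReal (Real.exp (mixExp d γ C c₅ ((k + 1) * L)))) :
    ∫⁻ ω, ∫⁻ φ in good c₅, G (blks c₅ L (m + k) ω φ) *
        transKernel P κ c₅ L (m + k) (blks c₅ L (m + k) ω φ) B ∂(markedKernel κ ω) ∂P ≤
      e * (e * ∫⁻ ω, ∫⁻ φ in good c₅, G (blks c₅ L (m + k) ω φ) *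
        transKernel P κ c₅ L k (lastBlocks m k (blks c₅ L (m + k) ω φ)) B
          ∂(markedKernel κ ω) ∂P) ∧
    ∫⁻ ω, ∫⁻ φ in good c₅, G (blks c₅ L (m + k) ω φ) *
        transKernel P κ c₅ L k (lastBlocks m k (blks c₅ L (m + k) ω φ)) B
          ∂(markedKernel κ ω) ∂P ≤
      e * (e * ∫⁻ ω, ∫⁻ φ in good c₅, G (blks c₅ L (m + k) ω φ) *
        transKernel P κ c₅ L (m + k) (blks c₅ L (m + k) ω φ) B ∂(markedKernel κ ω) ∂P) := by
  have hK : Measurable fun b : Fin (m + k) → Block d =>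
      transKernel P κ c₅ L k (lastBlocks m k b) B :=
    (Kernel.measurable_coe _ hB).comp (measurable_lastBlocks m k)
  rw [lintegral_transKernel P hpos L (m + k) hG hB, lintegral_good_blks_next P hfin hG hB,
    lintegral_good_blks P (hfin (m + k)) (G := fun b => G b *
      transKernel P κ c₅ L k (lastBlocks m k b) B) (hG.mul hK)]
  simp only [← ENNReal.tsum_mul_left]
  have h := fun (t : ℕ) (D : RegDat d c₅ L (m + k) t) =>
    compare_of_Reg P hstat hγ hC hmix hL hrL hpos hfin D.rep_mem hB hG hG1 he
  exact ⟨ENNReal.tsum_le_tsum fun t => ENNReal.tsum_le_tsum fun D => (h t D).1,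
    ENNReal.tsum_le_tsum fun t => ENNReal.tsum_le_tsum fun D => (h t D).2⟩

lemma measurable_env_marks :
    Measurable fun z : Triple d => (z.1.1, marks (z.1.2, z.2)) :=
  (measurable_fst.comp measurable_fst).prodMk
    (measurable_marks.comp ((measurable_snd.comp measurable_fst).prodMk measurable_snd))

/-- The integrated inequalities over all sets `A` of histories give an almost sure inequality for
each `B`. Since the σ-algebra of blocks is countably generated, it holds for all `B` at once. -/
lemma ae_transKernel_le (hstat : Stationary P) {r : ℕ} {γ C c₅ : ℝ} (hγ : 0 < γ) (hC : 0 < C)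
    (hmix : MixingCond P r γ C) {L : ℕ} (m k : ℕ) (hL : 1 ≤ L) (hrL : r ≤ L) {κ : EllConst d}
    (hpos : annealedCoins P κ {z | stopR c₅ z.2 = ⊤} ≠ 0)
    (hfin : ∀ n, ∀ᵐ φ ∂(markedLaw P κ), φ ∈ good c₅ → T c₅ L n φ ≠ ⊤) {e : ℝ≥0∞}
    (he : e = ENNReal.ofReal (Real.exp (mixExp d γ C c₅ ((k + 1) * L)))) :
    ∀ᵐ z ∂(hatP P κ c₅), ∀ B : Set (Block d), MeasurableSet B →
      transKernel P κ c₅ L (m + k) (blks c₅ L (m + k) z.1.1 (marks (z.1.2, z.2))) B ≤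
        e * e * transKernel P κ c₅ L k
          (lastBlocks m k (blks c₅ L (m + k) z.1.1 (marks (z.1.2, z.2)))) B ∧
      transKernel P κ c₅ L k
          (lastBlocks m k (blks c₅ L (m + k) z.1.1 (marks (z.1.2, z.2)))) B ≤
        e * e * transKernel P κ c₅ L (m + k)
          (blks c₅ L (m + k) z.1.1 (marks (z.1.2, z.2))) B := by
  set J : Triple d → Fin (m + k) → Block d :=
    fun z => blks c₅ L (m + k) z.1.1 (marks (z.1.2, z.2)) with hJ
  have hJm : Measurable J := (measurable_blks c₅ L (m + k)).comp measurable_env_marks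
  set K₁ : Kernel (Fin (m + k) → Block d) (Block d) := transKernel P κ c₅ L (m + k) with hK₁
  set K₂ : Kernel (Fin (m + k) → Block d) (Block d) :=
    (transKernel P κ c₅ L k).comap (lastBlocks m k) (measurable_lastBlocks m k) with hK₂
  have hee : e * e ≠ ⊤ := by
    rw [he]
    exact ENNReal.mul_ne_top ENNReal.ofReal_ne_top ENNReal.ofReal_ne_top
  have hint : ∀ (B : Set (Block d)) (A : Set (Fin (m + k) → Block d)) (K : Kernel _ (Block d)),
      MeasurableSet B → MeasurableSet A → ∫⁻ b in A, K b B ∂((hatP P κ c₅).map J) =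
        (annealedCoins P κ {z | stopR c₅ z.2 = ⊤})⁻¹ * ∫⁻ ω, ∫⁻ φ in good c₅,
          A.indicator 1 (blks c₅ L (m + k) ω φ) * K (blks c₅ L (m + k) ω φ) B
            ∂(markedKernel κ ω) ∂P := by
    intro B A K hB hA
    have hKB : Measurable fun b => K b B := Kernel.measurable_coe _ hB
    have hF : Measurable fun b => A.indicator (1 : (Fin (m + k) → Block d) → ℝ≥0∞) b * K b B :=
      (measurable_one.indicator hA).mul hKB
    rw [← lintegral_indicator hA, lintegral_map (hKB.indicator hA) hJm]
    refine Eq.trans (lintegral_congr fun z => ?_)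
      (lintegral_hatP P κ c₅ (hF.comp (measurable_blks c₅ L (m + k))))
    simp only [Function.comp_apply]
    by_cases h : J z ∈ A
    · have h' : blks c₅ L (m + k) z.1.1 (marks (z.1.2, z.2)) ∈ A := h
      simp [h', hJ]
    · have h' : blks c₅ L (m + k) z.1.1 (marks (z.1.2, z.2)) ∉ A := h
      simp [h, h']
  have hcmp : ∀ (B : Set (Block d)) (A : Set (Fin (m + k) → Block d)),
      MeasurableSet B → MeasurableSet A →
      ∫⁻ b in A, K₁ b B ∂((hatP P κ c₅).map J) ≤
        ∫⁻ b in A, e * e * K₂ b B ∂((hatP P κ c₅).map J) ∧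
      ∫⁻ b in A, K₂ b B ∂((hatP P κ c₅).map J) ≤
        ∫⁻ b in A, e * e * K₁ b B ∂((hatP P κ c₅).map J) := by
    intro B A hB hA
    have h := compare_integrals P hstat hγ hC hmix (m := m) (k := k) hL hrL hpos hfin hB
      (G := A.indicator 1) (measurable_one.indicator hA)
      (fun b => Set.indicator_le_self' (fun _ _ => zero_le) b) he
    rw [lintegral_const_mul _ (Kernel.measurable_coe _ hB),
      lintegral_const_mul _ (Kernel.measurable_coe _ hB), hint B A K₁ hB hA, hint B A K₂ hB hA]
    constructor
    · calc _ ≤ _ := mul_le_mul_right h.1 _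
        _ = _ := by simp only [hK₂, Kernel.comap_apply]; ring
    · calc _ ≤ _ := mul_le_mul_right h.2 _
        _ = _ := by simp only [hK₁]; ring
  have hfinite : IsFiniteMeasure ((hatP P κ c₅).map J) := inferInstance
  have hle : ∀ B : Set (Block d), MeasurableSet B →
      (∀ᵐ b ∂((hatP P κ c₅).map J), K₁ b B ≤ e * e * K₂ b B) ∧
      ∀ᵐ b ∂((hatP P κ c₅).map J), K₂ b B ≤ e * e * K₁ b B := by
    intro B hB
    exact ⟨ae_le_of_forall_setLIntegral_le_of_sigmaFinite (Kernel.measurable_coe _ hB)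
        fun A hA _ => (hcmp B A hB hA).1,
      ae_le_of_forall_setLIntegral_le_of_sigmaFinite (Kernel.measurable_coe _ hB)
        fun A hA _ => (hcmp B A hB hA).2⟩
  have h1 := ae_of_ae_map hJm.aemeasurable
    (ae_forall_measure_le _ K₁ K₂ (e * e) hee fun B hB => (hle B hB).1)
  have h2 := ae_of_ae_map hJm.aemeasurable
    (ae_forall_measure_le _ K₂ K₁ (e * e) hee fun B hB => (hle B hB).2)
  filter_upwards [h1, h2] with z hz1 hz2 B hB
  exact ⟨hz1 B hB, hz2 B hB⟩

lemma annealedCoins_good (κ : EllConst d) (c₅ : ℝ) :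
    annealedCoins P κ {z | stopR c₅ z.2 = ⊤} = markedLaw P κ (good c₅) := by
  have hgm := measurableSet_good (d := d) c₅
  have hset : MeasurableSet {z : Triple d | stopR c₅ z.2 = ⊤} :=
    (measurable_snd.comp (measurable_env_marks (d := d))) hgm
  have hEm : MeasurableSet {p : Env d × Trk d | p.2 ∈ good c₅} := measurable_snd hgm
  have h := lintegral_annealedCoins P κ (measurable_one.indicator hEm : Measurable
    ({p : Env d × Trk d | p.2 ∈ good c₅}.indicator (1 : Env d × Trk d → ℝ≥0∞)))
  rw [markedLaw_apply P κ hgm, ← lintegral_indicator_one hset]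
  refine Eq.trans h (lintegral_congr fun ω => ?_)
  rw [← lintegral_indicator_one hgm]
  rfl

/-- Halving the decay rate gains a factor that outgrows any constant. The dependence on `c₅` is
thereby moved into the threshold and the rate depends on `γ` alone. The `2` accounts for numerator
and denominator. -/
lemma eventually_two_mul_mixExp_le (d : ℕ) [NeZero d] {γ : ℝ} (hγ : 0 < γ) (C c₅ : ℝ) :
    ∃ N : ℕ, ∀ M : ℕ, N ≤ M → 2 * mixExp d γ C c₅ M ≤ Real.exp (-(γ / 4 * M)) := by
  set Z : ℝ := 2 * (C * (latticeSum d (γ / 2) * levelSum c₅ (γ / 2) + 1)) with hZ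
  have h : Filter.Tendsto (fun M : ℕ => Real.exp (γ / 4 * M)) Filter.atTop Filter.atTop :=
    Real.tendsto_exp_atTop.comp
      (tendsto_natCast_atTop_atTop.const_mul_atTop (by positivity : (0 : ℝ) < γ / 4))
  obtain ⟨N, hN⟩ := Filter.eventually_atTop.mp (h.eventually_ge_atTop Z)
  refine ⟨N, fun M hM => ?_⟩
  have h1 : Real.exp (γ / 4 * M) * Real.exp (-(γ / 2) * M) = Real.exp (-(γ / 4 * M)) := by
    rw [← Real.exp_add]
    congr 1
    ring
  calc 2 * mixExp d γ C c₅ M = Z * Real.exp (-(γ / 2) * M) := by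
        unfold mixExp
        rw [hZ]
        ring
    _ ≤ Real.exp (γ / 4 * M) * Real.exp (-(γ / 2) * M) := by
        gcongr
        exact hN M hM
    _ = _ := h1

end

end RWRE

/-! ### Choice of the constants and conclusion. -/

theorem lemmal4 {d : ℕ} [NeZero d] (hd : 2 ≤ d)
    (P : Measure (RWRE.Env d)) [IsProbabilityMeasure P]
    (hstat : RWRE.Stationary P)
    (κ : RWRE.EllConst d) (hell : RWRE.UniformlyElliptic P κ)
    (r : ℕ) (hr : 1 ≤ r) (hMarkov : RWRE.IsMarkovEnv P r) (hmix : RWRE.SatisfiesMixing P r) :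
    ∃ c : ℝ, 0 < c ∧ ∀ c₅ : ℝ,
      0 < RWRE.annealed P {z | RWRE.stopR c₅ z.2 = ⊤} →
      ∃ L₀ : ℕ, ∀ L : ℕ, L₀ ≤ L → ∀ k n : ℕ, k ≤ n →
        ∀ᵐ z ∂(RWRE.hatP P κ c₅), ∀ B : Set (RWRE.Block d), MeasurableSet B →
          ENNReal.ofReal (Real.exp (-Real.exp (-(c * ((k : ℝ) + 1) * (L : ℝ))))) *
              RWRE.transKernel P κ c₅ L k
                (fun m : Fin k => RWRE.block c₅ L (n - k + (m : ℕ)) z) B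
            ≤ RWRE.transKernel P κ c₅ L n (fun m : Fin n => RWRE.block c₅ L (m : ℕ) z) B ∧
          RWRE.transKernel P κ c₅ L n (fun m : Fin n => RWRE.block c₅ L (m : ℕ) z) B
            ≤ ENNReal.ofReal (Real.exp (Real.exp (-(c * ((k : ℝ) + 1) * (L : ℝ))))) *
              RWRE.transKernel P κ c₅ L k
                (fun m : Fin k => RWRE.block c₅ L (n - k + (m : ℕ)) z) B := by
  obtain ⟨γ, C, hγ, hC, hmix⟩ := hmix
  refine ⟨γ / 4, by positivity, fun c₅ _ => ?_⟩
  obtain ⟨N, hN⟩ := RWRE.eventually_two_mul_mixExp_le d hγ C c₅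
  refine ⟨max N (max r 1), fun L hL k n hkn => ?_⟩
  have hL1 : 1 ≤ L := le_trans (le_trans (le_max_right _ _) (le_max_right _ _)) hL
  have hLr : r ≤ L := le_trans (le_trans (le_max_left _ _) (le_max_right _ _)) hL
  have hLN : N ≤ L := le_trans (le_max_left _ _) hL
  -- Conditioning on a null event yields the zero measure, for which the claim is void.
  by_cases hpos : RWRE.annealedCoins P κ {z | RWRE.stopR c₅ z.2 = ⊤} = 0
  · have h0 : RWRE.hatP P κ c₅ = 0 := ProbabilityTheory.cond_eq_zero_of_meas_eq_zero hpos
    rw [h0, MeasureTheory.ae_zero]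
    exact Filter.eventually_bot
  have hfin := fun n => RWRE.ae_T_ne_top P hstat hγ hC hmix hL1 hLr κ (c₅ := c₅)
    (by rwa [← RWRE.annealedCoins_good]) n
  obtain ⟨m, rfl⟩ : ∃ m, n = m + k := ⟨n - k, by omega⟩
  have hM := hN ((k + 1) * L) (hLN.trans (Nat.le_mul_of_pos_left L (Nat.succ_pos k)))
  set x : ℝ := Real.exp (-(γ / 4 * ((k : ℝ) + 1) * (L : ℝ))) with hx
  have hx' : Real.exp (-(γ / 4 * (((k + 1) * L : ℕ) : ℝ))) = x := by
    rw [hx]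
    push_cast
    ring_nf
  rw [hx'] at hM
  have hee : ENNReal.ofReal (Real.exp (RWRE.mixExp d γ C c₅ ((k + 1) * L))) *
      ENNReal.ofReal (Real.exp (RWRE.mixExp d γ C c₅ ((k + 1) * L))) ≤
        ENNReal.ofReal (Real.exp x) := by
    rw [← ENNReal.ofReal_mul (Real.exp_pos _).le, ← Real.exp_add, ← two_mul]
    exact ENNReal.ofReal_le_ofReal (Real.exp_le_exp.mpr hM)
  -- The lower bound is the upper bound with the two kernels exchanged, multiplied by `exp (-x)`.
  have hinv : ENNReal.ofReal (Real.exp (-x)) * ENNReal.ofReal (Real.exp x) = 1 := by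
    rw [← ENNReal.ofReal_mul (Real.exp_pos _).le, ← Real.exp_add, neg_add_cancel, Real.exp_zero,
      ENNReal.ofReal_one]
  filter_upwards [RWRE.ae_transKernel_le P hstat hγ hC hmix m k hL1 hLr hpos hfin rfl]
    with z hz B hB
  have e1 : (fun i : Fin (m + k) => RWRE.block c₅ L (i : ℕ) z) =
      RWRE.blks c₅ L (m + k) z.1.1 (RWRE.marks (z.1.2, z.2)) :=
    funext fun i => RWRE.block_eq_blk c₅ L i z
  have e2 : (fun i : Fin k => RWRE.block c₅ L (m + k - k + (i : ℕ)) z) =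
      RWRE.lastBlocks m k (RWRE.blks c₅ L (m + k) z.1.1 (RWRE.marks (z.1.2, z.2))) := by
    funext i
    rw [Nat.add_sub_cancel]
    exact RWRE.block_eq_blk c₅ L (m + i) z
  rw [e1, e2]
  obtain ⟨h1, h2⟩ := hz B hB
  refine ⟨?_, h1.trans (by gcongr)⟩
  calc _ ≤ ENNReal.ofReal (Real.exp (-x)) * (ENNReal.ofReal (Real.exp x) *
        RWRE.transKernel P κ c₅ L (m + k)
          (RWRE.blks c₅ L (m + k) z.1.1 (RWRE.marks (z.1.2, z.2))) B) := by
        gcongr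
        exact h2.trans (by gcongr)
    _ = _ := by rw [← mul_assoc, hinv, one_mul]
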